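/- Let $G=(V,E)$ be a finite simple graph. A vertex $v$ \emph{dominates} $u$ if $u=v$ or $uv\in E$. A sequence $S=(v_1,\dots,v_k)$ of distinct vertices is a \emph{double neighborhood sequence} if, for each $i$, the vertex $v_i$ dominates at least one vertex that is dominated by at most one of $v_1,\dots,v_{i-1}$; it is a \emph{double dominating sequence} if, moreover, every vertex of $G$ is dominated by at least two of $v_1,\dots,v_k$. A \emph{Grundy double dominating sequence} (GDDS) of $G$ is a double dominating sequence of maximum length, and its length is the \emph{Grundy double domination number} (GDDN) of $G$; these are defined for graphs without isolated vertices. A \emph{cograph} is a graph with no induced path on four vertices. \textbf{Theorem.} The GDDN and a GDDS of a cograph can be computed in linear time. That is, there is an algorithm for a random access machine (unit-cost additions, subtractions, comparisons and indexed memory accesses, on words of $O(\log(n+m))$ bits) which, given adjacency lists, in arbitrary order, of any cograph $G$ without isolated vertices with $n$ vertices and $m$ edges, outputs the GDDN of $G$ and a GDDS of $G$ after at most $O(n+m)$ steps. -/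

import Mathlib

namespace GrundyDouble

/-! ### Double dominating sequences and cographs -/

/-- The vertex `v` dominates `u`, that is, `u` lies in the closed neighbourhood of `v`. -/
def Dominates {V : Type*} (G : SimpleGraph V) (v u : V) : Prop :=
  u = v ∨ G.Adj v u

/-- Every vertex is dominated by at least two members of `D`. -/
def IsDoubleDominatingSet {V : Type*} (G : SimpleGraph V) (D : Set V) : Prop :=
  ∀ u : V, 2 ≤ {v : V | v ∈ D ∧ Dominates G v u}.encard

/-- Double neighbourhood sequence: a sequence of distinct vertices, each of which dominates a
vertex that is dominated at most once by the vertices that come earlier in the sequence. -/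
def IsDNS {V : Type*} (G : SimpleGraph V) (S : List V) : Prop :=
  S.Nodup ∧ ∀ (i : ℕ) (hi : i < S.length), ∃ u : V,
    Dominates G S[i] u ∧ {v : V | v ∈ S.take i ∧ Dominates G v u}.encard ≤ 1

/-- Double dominating sequence: a double neighbourhood sequence whose set of vertices is a
double dominating set. -/
def IsDDS {V : Type*} (G : SimpleGraph V) (S : List V) : Prop :=
  IsDNS G S ∧ IsDoubleDominatingSet G {v : V | v ∈ S}

/-- Grundy double dominating sequence: a double dominating sequence of maximum length. -/
def IsGDDS {V : Type*} (G : SimpleGraph V) (S : List V) : Prop :=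
  IsDDS G S ∧ ∀ T : List V, IsDDS G T → T.length ≤ S.length

/-- The Grundy double domination number, the maximum length of a double dominating sequence. -/
noncomputable def gddn {V : Type*} (G : SimpleGraph V) : ℕ :=
  sSup {k : ℕ | ∃ S : List V, IsDDS G S ∧ S.length = k}

/-- Cographs: the graphs without an induced path on four vertices. (An embedding of graphs
preserves adjacency and non-adjacency, so that its image is an induced subgraph.) -/
def IsCograph {V : Type*} (G : SimpleGraph V) : Prop :=
  IsEmpty (SimpleGraph.pathGraph 4 ↪g G)

/-- No vertex is isolated. -/
def NoIsolated {V : Type*} (G : SimpleGraph V) : Prop :=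
  ∀ v : V, ∃ u : V, G.Adj v u

/-! ### A random access machine with a step count -/

/-- The memory of the machine: registers, and arrays that are accessed by index. A program is a
finite text and so mentions only finitely many registers and finitely many arrays. -/
structure Memory where
  reg : ℕ → ℕ
  arr : ℕ → ℕ → ℕ

/-- The memory after register `x` has been given the value `k`. -/
def Memory.setReg (s : Memory) (x k : ℕ) : Memory :=
  { s with reg := Function.update s.reg x k }

/-- The memory after cell `i` of array `a` has been given the value `k`. -/
def Memory.setArr (s : Memory) (a i k : ℕ) : Memory :=
  { s with arr := Function.update s.arr a (Function.update (s.arr a) i k) }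

/-- Structured programs. The arguments `x y z i` are names of registers, `a` is the name of an
array, and `k` is a numeral. -/
inductive Program where
  /-- Do nothing. -/
  | skip : Program
  /-- `x := k` -/
  | const (x k : ℕ) : Program
  /-- `x := y` -/
  | copy (x y : ℕ) : Program
  /-- `x := y + z` -/
  | add (x y z : ℕ) : Program
  /-- `x := max (y - z) 0` -/
  | sub (x y z : ℕ) : Program
  /-- `x := a[i]` -/
  | load (x a i : ℕ) : Program
  /-- `a[i] := y` -/
  | store (a i y : ℕ) : Program
  /-- First `P`, then `Q`. -/
  | seq (P Q : Program) : Program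
  /-- If `x < y` then `P` else `Q`. -/
  | ifLt (x y : ℕ) (P Q : Program) : Program
  /-- While `x < y` do `P`. -/
  | whileLt (x y : ℕ) (P : Program) : Program

/-- `Exec B P s t s'`: on a machine whose words hold the numbers `0, …, B`, the program `P`, started
with memory `s`, halts after exactly `t` steps with memory `s'`. Each assignment and each evaluation
of a test is one step; a run that computes a number larger than `B` does not count as an execution. -/
inductive Exec (B : ℕ) : Program → Memory → ℕ → Memory → Prop where
  | skip (s : Memory) : Exec B .skip s 1 s
  | const (s : Memory) (x k : ℕ) (hk : k ≤ B) :
      Exec B (.const x k) s 1 (s.setReg x k)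
  | copy (s : Memory) (x y : ℕ) :
      Exec B (.copy x y) s 1 (s.setReg x (s.reg y))
  | add (s : Memory) (x y z : ℕ) (h : s.reg y + s.reg z ≤ B) :
      Exec B (.add x y z) s 1 (s.setReg x (s.reg y + s.reg z))
  | sub (s : Memory) (x y z : ℕ) :
      Exec B (.sub x y z) s 1 (s.setReg x (s.reg y - s.reg z))
  | load (s : Memory) (x a i : ℕ) :
      Exec B (.load x a i) s 1 (s.setReg x (s.arr a (s.reg i)))
  | store (s : Memory) (a i y : ℕ) :
      Exec B (.store a i y) s 1 (s.setArr a (s.reg i) (s.reg y))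
  | seq {P Q : Program} {s s₁ s₂ : Memory} {t₁ t₂ : ℕ}
      (h₁ : Exec B P s t₁ s₁) (h₂ : Exec B Q s₁ t₂ s₂) :
      Exec B (.seq P Q) s (t₁ + t₂) s₂
  | ifLt_true {x y : ℕ} {P Q : Program} {s s' : Memory} {t : ℕ}
      (hxy : s.reg x < s.reg y) (h : Exec B P s t s') :
      Exec B (.ifLt x y P Q) s (t + 1) s'
  | ifLt_false {x y : ℕ} {P Q : Program} {s s' : Memory} {t : ℕ}
      (hxy : ¬ s.reg x < s.reg y) (h : Exec B Q s t s') :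
      Exec B (.ifLt x y P Q) s (t + 1) s'
  | while_done {x y : ℕ} {P : Program} {s : Memory}
      (hxy : ¬ s.reg x < s.reg y) :
      Exec B (.whileLt x y P) s 1 s
  | while_step {x y : ℕ} {P : Program} {s s₁ s₂ : Memory} {t₁ t₂ : ℕ}
      (hxy : s.reg x < s.reg y) (h₁ : Exec B P s t₁ s₁)
      (h₂ : Exec B (.whileLt x y P) s₁ t₂ s₂) :
      Exec B (.whileLt x y P) s (t₁ + t₂ + 1) s₂

/-! ### Input and output -/

/-- `L` is an adjacency-list representation of `G`: the list of `v` enumerates the neighbours of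
`v` without repetition, in an arbitrary order. -/
def IsAdjacencyLists {n : ℕ} (G : SimpleGraph (Fin n)) (L : Fin n → List (Fin n)) : Prop :=
  ∀ v : Fin n, (L v).Nodup ∧ ∀ u : Fin n, u ∈ L v ↔ G.Adj v u

/-- The memory that presents a graph on `0, …, n - 1`: register `0` holds `n`; array `1` holds the
adjacency lists of `0, …, n - 1` one after the other; for `v < n`, the list of `v` occupies the cells
of array `1` from index `arr 0 v` (included) to index `arr 0 (v + 1)` (excluded). Everything else
is `0`. -/
def inputMemory {n : ℕ} (L : Fin n → List (Fin n)) : Memory where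
  reg := fun x => if x = 0 then n else 0
  arr := fun a i =>
    if a = 0 then (if i ≤ n then ((List.ofFn L).take i).flatten.length else 0)
    else if a = 1 then ((List.ofFn L).flatten.map Fin.val).getD i 0
    else 0

/-- The final memory presents the sequence `S`: register `0` holds its length, and the cells
`0, …, S.length - 1` of array `2` hold its entries. -/
def OutputsSequence {n : ℕ} (s : Memory) (S : List (Fin n)) : Prop :=
  s.reg 0 = S.length ∧ ∀ (i : ℕ) (hi : i < S.length), s.arr 2 i = (S[i] : Fin n).val

end GrundyDouble

/-!
A sequence is built vertex by vertex (`Legal`), and the longest double neighbourhood sequences of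
induced subgraphs (`Optimal`) are composed along the structure of a cograph.

* In a graph without isolated vertices a longest double neighbourhood sequence is a Grundy double
  dominating sequence: a vertex that it dominates at most once would allow to extend it
  (`Optimal.isGDDS`). So double domination can be forgotten.
* The part of a legal sequence that lies on one side of a disjoint union or of a join is legal on
  that side (`Legal.filter_left`). Hence the optimal sequences of the sides of a union are
  concatenated (`Optimal.union`). In a join, every vertex of one side dominates the whole other
  side, and one gets the maximum, over both sides, of the optimal length plus `1` if the side has an
  isolated vertex, which is dominated only once within its side (`Optimal.join`). Only the lengths,
  the flags for isolated vertices, and the end points of linked lists are needed, so that each step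
  of the evaluation of a cotree takes constant time (`mergeLists_spec`, `runs_evaluate`).

The cotree is built by inserting the vertices `1, …, n` one by one, the vertex `x` at a cost
proportional to `1` plus the length of its adjacency list.

* Starting from the neighbours of `x` that are already in the tree, one marks the full nodes, that
  is, those all of whose leaves are neighbours of `x` (`runs_mark`). As every inner node has two
  children, there are at most twice as many full nodes as neighbours (`Cotree.card_fullNodes_le`).
* If some node has neighbours and non-neighbours of `x` below it, a lowest such node is the pivot.
  Since there is no induced path on four vertices, `x` looks, from outside of the pivot, like the
  leaves below the pivot (`Cotree.pivot_twin`). Candidates for the pivot are the nodes that are not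
  full but have a full child. Above the pivot all join nodes are candidates, and labels alternate
  along the tree; so the pivot is the only candidate that is not the parent or grandparent of
  another one (`Cotree.exists_candidate_below`, `runs_locate`).
* The new vertex belongs together with the full children of the pivot if the pivot is a union, and
  with the children without neighbours of `x` if it is a join. These are separated from the other
  children by a new node (`Cotree.split`), and `x` is hung next to them (`Cotree.attach`). Only full
  children can be listed in time, and so it is always these that move to the new node. If `x`
  belongs next to a single child that is not full, this child is found in constant time, because
  every node stores the sum of the names of its children modulo a number that exceeds all names
  (`Counted`).

Programs are treated in the logic of total correctness with time bounds given by `Runs`. The vertex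
`v` of the input is called `v + 1` in the tree, so that the number `0` can serve as the parent of
the root.
-/

namespace GrundyDouble

set_option linter.unusedSimpArgs false

/-! ### Legal sequences in induced subgraphs -/

section Legal

variable {V : Type*}

open Classical in
/-- The number of members of the list `S` that dominate `u`. -/
noncomputable def domCount (G : SimpleGraph V) (S : List V) (u : V) : ℕ :=
  S.countP (fun v => Dominates G v u)

/-- Double neighbourhood sequences of the subgraph induced by `A`, built by appending one vertex
at a time. -/
inductive Legal (G : SimpleGraph V) (A : Finset V) : List V → Prop where
  | nil : Legal G A []
  | snoc {S : List V} {r u : V} (hS : Legal G A S) (hr : r ∈ A) (hrS : r ∉ S) (hu : u ∈ A)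
      (hd : Dominates G r u) (hc : domCount G S u ≤ 1) : Legal G A (S ++ [r])

/-- `S` is a longest double neighbourhood sequence of the subgraph induced by `A`. -/
def Optimal (G : SimpleGraph V) (A : Finset V) (S : List V) : Prop :=
  Legal G A S ∧ ∀ T, Legal G A T → T.length ≤ S.length

/-- The subgraph induced by `A` has an isolated vertex. -/
def HasIso (G : SimpleGraph V) (A : Finset V) : Prop :=
  ∃ x ∈ A, ∀ y ∈ A, ¬ G.Adj x y

/-- `i` is the truth value, as a number, of `HasIso G A`. -/
def IsoFlag (G : SimpleGraph V) (A : Finset V) (i : ℕ) : Prop :=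
  (i = 1 ∧ HasIso G A) ∨ (i = 0 ∧ ¬ HasIso G A)

variable {G : SimpleGraph V} {A B : Finset V} {S T : List V}

@[simp] lemma domCount_nil (u : V) : domCount G [] u = 0 := by simp [domCount]

lemma domCount_append (u : V) : domCount G (S ++ T) u = domCount G S u + domCount G T u := by
  simp [domCount]

lemma domCount_le_length (u : V) : domCount G S u ≤ S.length := List.countP_le_length

lemma domCount_filter_le (p : V → Bool) (u : V) : domCount G (S.filter p) u ≤ domCount G S u :=
  List.Sublist.countP_le List.filter_sublist

lemma domCount_eq_zero {u : V} : domCount G S u = 0 ↔ ∀ v ∈ S, ¬ Dominates G v u := by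
  simp [domCount, List.countP_eq_zero]

lemma domCount_eq_length {u : V} (h : ∀ v ∈ S, Dominates G v u) : domCount G S u = S.length := by
  simpa [domCount, List.countP_eq_length] using h

lemma domCount_singleton_le (r u : V) : domCount G [r] u ≤ 1 := by
  simpa using domCount_le_length (G := G) (S := [r]) u

lemma Legal.subset (h : Legal G A S) : ∀ v ∈ S, v ∈ A := by
  induction h with
  | nil => simp
  | snoc _ hr _ _ _ _ ih =>
    intro v hv
    rcases List.mem_append.1 hv with h | h
    · exact ih v h
    · rw [List.mem_singleton] at h; exact h ▸ hr

lemma Legal.nodup (h : Legal G A S) : S.Nodup := by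
  induction h with
  | nil => simp
  | snoc _ _ hrS _ _ _ ih =>
    refine List.nodup_append.2 ⟨ih, by simp, ?_⟩
    intro a ha b hb
    rw [List.mem_singleton] at hb
    rintro rfl
    exact hrS (hb ▸ ha)

lemma Legal.mono (h : Legal G A S) (hAB : A ⊆ B) : Legal G B S := by
  induction h with
  | nil => exact .nil
  | snoc _ hr hrS hu hd hc ih => exact .snoc ih (hAB hr) hrS (hAB hu) hd hc

lemma legal_snoc_iff {r : V} : Legal G A (S ++ [r]) ↔
    Legal G A S ∧ r ∈ A ∧ r ∉ S ∧ ∃ u ∈ A, Dominates G r u ∧ domCount G S u ≤ 1 := by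
  constructor
  · intro h
    generalize hR : S ++ [r] = R at h
    cases h with
    | nil => simp at hR
    | snoc hS hr hrS hu hd hc =>
      obtain ⟨rfl, h2⟩ := List.append_inj' hR rfl
      obtain rfl : r = _ := by simpa using h2
      exact ⟨hS, hr, hrS, _, hu, hd, hc⟩
  · rintro ⟨hS, hr, hrS, u, hu, hd, hc⟩
    exact .snoc hS hr hrS hu hd hc

/-- A legal sequence that dominates some vertex at most once can be extended, unless that vertex
is isolated. -/
lemma Optimal.length_bound {i : ℕ} (hS : Optimal G A S) (hi : IsoFlag G A i) (hT : Legal G A T)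
    {u : V} (hu : u ∈ A) (hc : domCount G T u ≤ 1) : T.length + 1 ≤ S.length + i := by
  rcases hi with ⟨rfl, _⟩ | ⟨rfl, hi⟩
  · have := hS.2 T hT; omega
  · unfold HasIso at hi
    push Not at hi
    obtain ⟨y, hy, hadj⟩ := hi u hu
    have key : ∃ w ∈ A, w ∉ T ∧ Dominates G w u := by
      by_contra hcon
      push Not at hcon
      have h1 : u ∈ T := by_contra fun h => hcon u hu h (Or.inl rfl)
      have h2 : y ∈ T := by_contra fun h => hcon y hy h (Or.inr hadj.symm)
      have h3 : [u, y].Subperm T := by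
        refine List.subperm_of_subset ?_ ?_
        · simp [hadj.ne]
        · intro v hv; simp at hv; rcases hv with rfl | rfl <;> assumption
      have h4 := h3.countP_le (fun v => @decide (Dominates G v u) (Classical.propDecidable _))
      have h5 : domCount G [u, y] u = 2 := by
        rw [domCount_eq_length]
        · rfl
        · intro v hv; simp at hv
          rcases hv with rfl | rfl
          · exact Or.inl rfl
          · exact Or.inr hadj.symm
      have h6 : domCount G [u, y] u ≤ domCount G T u := by
        unfold domCount; exact h4
      omega
    obtain ⟨w, hw, hwT, hd⟩ := key
    have := hS.2 _ (hT.snoc hw hwT hu hd hc)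
    simpa using this

lemma optimal_singleton (v : V) : Optimal G {v} [v] := by
  refine ⟨Legal.snoc (S := []) .nil (by simp) (by simp) (u := v) (by simp) (Or.inl rfl)
    (by simp), fun T hT => ?_⟩
  classical
  have h2 : T.toFinset ⊆ {v} := fun a ha => hT.subset a (List.mem_toFinset.1 ha)
  have h3 : T.toFinset.card = T.length := List.toFinset_card_of_nodup hT.nodup
  have := Finset.card_le_card h2
  simp at this ⊢
  omega

lemma isoFlag_singleton (v : V) : IsoFlag G {v} 1 :=
  Or.inl ⟨rfl, v, by simp, fun y hy => by
    rw [Finset.mem_singleton] at hy; subst hy; exact G.loopless.irrefl y⟩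

variable [DecidableEq V]

/-- If `A` is separated from `B` completely or joined to it completely, then the members in `A`
of a legal sequence of `A ∪ B` form a legal sequence of `A`: a vertex of `A` whose footprint lies
in `B` is, in the case of a join, among the first two vertices chosen in `A`, and then it is a
footprint of itself. -/
lemma Legal.filter_left (h : Legal G (A ∪ B) S)
    (hAB : (∀ a ∈ A, ∀ b ∈ B, ¬ G.Adj a b) ∨ (∀ a ∈ A, ∀ b ∈ B, G.Adj a b)) :
    Legal G A (S.filter (· ∈ A)) := by
  induction h with
  | nil => exact .nil
  | @snoc S r u hS hr hrS hu hd hc ih =>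
    by_cases hrA : r ∈ A
    · have e : (S ++ [r]).filter (· ∈ A) = S.filter (· ∈ A) ++ [r] := by simp [hrA]
      rw [e]
      have hrS' : r ∉ S.filter (· ∈ A) := fun h => hrS (List.mem_filter.1 h).1
      by_cases huA : u ∈ A
      · exact .snoc ih hrA hrS' huA hd ((domCount_filter_le _ _).trans hc)
      · have huB : u ∈ B := (Finset.mem_union.1 hu).resolve_left huA
        have hadj : G.Adj r u := hd.resolve_left (fun h => huA (h ▸ hrA))
        rcases hAB with hAB | hAB
        · exact absurd hadj (hAB r hrA u huB)
        · refine .snoc ih hrA hrS' hrA (Or.inl rfl) ?_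
          calc domCount G (S.filter (· ∈ A)) r ≤ (S.filter (· ∈ A)).length := domCount_le_length _
            _ = domCount G (S.filter (· ∈ A)) u := by
              refine (domCount_eq_length fun v hv => Or.inr (hAB v ?_ u huB)).symm
              simpa using (List.mem_filter.1 hv).2
            _ ≤ 1 := (domCount_filter_le _ _).trans hc
    · have e : (S ++ [r]).filter (· ∈ A) = S.filter (· ∈ A) := by simp [hrA]
      rw [e]; exact ih

lemma length_filter_add {S : List V} (hS : ∀ v ∈ S, v ∈ A ∪ B) (hd : Disjoint A B) :
    (S.filter (· ∈ A)).length + (S.filter (· ∈ B)).length = S.length := by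
  induction S with
  | nil => rfl
  | cons a S ih =>
    have h1 := ih fun v hv => hS v (List.mem_cons_of_mem _ hv)
    have h2 := hS a List.mem_cons_self
    rw [Finset.mem_union] at h2
    have h3 : a ∈ A → a ∉ B := fun h => Finset.disjoint_left.1 hd h
    by_cases hA : a ∈ A
    · have hB := h3 hA
      simp [hA, hB]; omega
    · have hB := h2.resolve_left hA
      simp [hA, hB]; omega

/-- In a disjoint union the optimal sequences of the parts are concatenated. -/
lemma Optimal.union (hS : Optimal G A S) (hT : Optimal G B T) (hd : Disjoint A B)
    (hAB : ∀ a ∈ A, ∀ b ∈ B, ¬ G.Adj a b) : Optimal G (A ∪ B) (S ++ T) := by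
  constructor
  · have h := hT.1
    clear hT
    induction h with
    | nil => simpa using hS.1.mono Finset.subset_union_left
    | @snoc T r u hT hr hrT hu hdom hc ih =>
      rw [← List.append_assoc]
      refine .snoc ih (Finset.mem_union_right _ hr) ?_ (Finset.mem_union_right _ hu) hdom ?_
      · intro h
        rcases List.mem_append.1 h with h | h
        · exact Finset.disjoint_left.1 hd (hS.1.subset _ h) hr
        · exact hrT h
      · rw [domCount_append]
        have : domCount G S u = 0 := by
          rw [domCount_eq_zero]
          rintro v hv (rfl | h)
          · exact Finset.disjoint_left.1 hd (hS.1.subset _ hv) hu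
          · exact hAB v (hS.1.subset _ hv) u hu h
        omega
  · intro R hR
    have h1 := hS.2 _ (hR.filter_left (Or.inl hAB))
    have h2 := hT.2 _ ((Finset.union_comm A B ▸ hR).filter_left
      (Or.inl fun b hb a ha h => hAB a ha b hb h.symm))
    have h3 := length_filter_add (fun v hv => hR.subset v hv) hd
    rw [List.length_append]; omega

lemma IsoFlag.union {i j k : ℕ} (hi : IsoFlag G A i) (hj : IsoFlag G B j)
    (hk : k = if 0 < j then 1 else i)
    (hAB : ∀ a ∈ A, ∀ b ∈ B, ¬ G.Adj a b) : IsoFlag G (A ∪ B) k := by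
  have key : HasIso G (A ∪ B) ↔ HasIso G A ∨ HasIso G B := by
    constructor
    · rintro ⟨x, hx, h⟩
      rcases Finset.mem_union.1 hx with hx | hx
      · exact Or.inl ⟨x, hx, fun y hy => h y (Finset.mem_union_left _ hy)⟩
      · exact Or.inr ⟨x, hx, fun y hy => h y (Finset.mem_union_right _ hy)⟩
    · rintro (⟨x, hx, h⟩ | ⟨x, hx, h⟩)
      · refine ⟨x, Finset.mem_union_left _ hx, fun y hy => ?_⟩
        rcases Finset.mem_union.1 hy with hy | hy
        · exact h y hy
        · exact hAB x hx y hy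
      · refine ⟨x, Finset.mem_union_right _ hx, fun y hy => ?_⟩
        rcases Finset.mem_union.1 hy with hy | hy
        · exact fun h => hAB y hy x hx h.symm
        · exact h y hy
  unfold IsoFlag at *
  rcases hi with ⟨rfl, hi⟩ | ⟨rfl, hi⟩ <;> rcases hj with ⟨rfl, hj⟩ | ⟨rfl, hj⟩ <;>
    simp_all

lemma isoFlag_join (hA : A.Nonempty) (hB : B.Nonempty)
    (hAB : ∀ a ∈ A, ∀ b ∈ B, G.Adj a b) : IsoFlag G (A ∪ B) 0 := by
  refine Or.inr ⟨rfl, ?_⟩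
  rintro ⟨x, hx, h⟩
  obtain ⟨a, ha⟩ := hA
  obtain ⟨b, hb⟩ := hB
  rcases Finset.mem_union.1 hx with hx | hx
  · exact h b (Finset.mem_union_right _ hb) (hAB x hx b hb)
  · exact h a (Finset.mem_union_left _ ha) (hAB a ha x hx).symm

/-- The upper bound for a join when the last vertex has its footprint in `A`: all but that vertex
come from a legal sequence of `A` that dominates the footprint at most once. -/
lemma join_bound_aux {i : ℕ} (hS : Optimal G A S) (hi : IsoFlag G A i) (hd : Disjoint A B)
    (hAB : ∀ a ∈ A, ∀ b ∈ B, G.Adj a b) {R : List V} (hR : Legal G (A ∪ B) R) {u : V}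
    (hu : u ∈ A) (hc : domCount G R u ≤ 1) : R.length + 1 ≤ S.length + i := by
  have hF := hR.filter_left (Or.inr hAB)
  have hlen := length_filter_add (fun v hv => hR.subset v hv) hd
  have hsplit : domCount G (R.filter (· ∈ A)) u + (R.filter (· ∈ B)).length ≤ domCount G R u := by
    have hB : domCount G (R.filter (· ∈ B)) u = (R.filter (· ∈ B)).length :=
      domCount_eq_length fun v hv => Or.inr (hAB u hu v (by simpa using (List.mem_filter.1 hv).2)).symm
    rw [← hB, ← domCount_append]
    unfold domCount
    refine List.Subperm.countP_le _ (List.subperm_of_subset ?_ ?_)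
    · refine List.nodup_append.2 ⟨hF.nodup, hR.nodup.filter _, ?_⟩
      rintro a ha b hb rfl
      exact Finset.disjoint_left.1 hd (by simpa using (List.mem_filter.1 ha).2)
        (by simpa using (List.mem_filter.1 hb).2)
    · intro v hv
      rcases List.mem_append.1 hv with h | h <;> exact (List.mem_filter.1 h).1
  rcases Nat.eq_zero_or_pos (R.filter (· ∈ B)).length with h0 | h0
  · have := hS.length_bound hi hF hu (by omega)
    omega
  · have hz : domCount G (R.filter (· ∈ A)) u = 0 := by omega
    have hnot : u ∉ R.filter (· ∈ A) := fun h => domCount_eq_zero.1 hz u h (Or.inl rfl)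
    have := hS.length_bound hi (hF.snoc hu hnot hu (Or.inl rfl) (by omega)) hu (by
      rw [domCount_append, hz]; simpa using domCount_singleton_le u u)
    simp at this
    omega

/-- In a join one takes the better side, and one vertex of the other side more if the better side
has an isolated vertex. -/
lemma Optimal.join {i j : ℕ} (hS : Optimal G A S) (hT : Optimal G B T) (hi : IsoFlag G A i)
    (hj : IsoFlag G B j) (hd : Disjoint A B) (hAB : ∀ a ∈ A, ∀ b ∈ B, G.Adj a b)
    (hle : T.length + j ≤ S.length + i) {w : V} (hw : w ∈ B) :
    Optimal G (A ∪ B) (if 0 < i then S ++ [w] else S) := by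
  have hlen : (if 0 < i then S ++ [w] else S).length = S.length + i := by
    rcases hi with ⟨rfl, _⟩ | ⟨rfl, _⟩ <;> simp
  constructor
  · rcases hi with ⟨rfl, x, hx, hxi⟩ | ⟨rfl, _⟩
    · simp only [Nat.lt_one_iff, if_true]
      refine .snoc (hS.1.mono Finset.subset_union_left) (Finset.mem_union_right _ hw) ?_
        (Finset.mem_union_left _ hx) (Or.inr (hAB x hx w hw).symm) ?_
      · exact fun h => Finset.disjoint_left.1 hd (hS.1.subset _ h) hw
      · have : domCount G S x ≤ domCount G [x] x := by
          have e : domCount G S x = S.count x := by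
            unfold domCount List.count
            refine List.countP_congr fun v hv => ?_
            simp only [decide_eq_true_eq, beq_iff_eq]
            constructor
            · rintro (h | h)
              · exact h.symm
              · exact absurd h.symm (hxi v (hS.1.subset _ hv))
            · rintro rfl; exact Or.inl rfl
          rw [e]
          have h1 := List.nodup_iff_count_le_one.1 hS.1.nodup x
          have h2 : domCount G [x] x = 1 :=
            domCount_eq_length fun v hv => by simp at hv; exact Or.inl hv.symm
          omega
        exact this.trans (domCount_singleton_le _ _)
    · simpa using hS.1.mono Finset.subset_union_left
  · intro R hR
    rw [hlen]
    rcases List.eq_nil_or_concat R with rfl | ⟨R', r, rfl⟩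
    · simp
    · rw [List.concat_eq_append] at hR ⊢
      obtain ⟨hR', -, -, u, hu, -, hc⟩ := legal_snoc_iff.1 hR
      rw [List.length_append, List.length_singleton]
      rcases Finset.mem_union.1 hu with hu | hu
      · exact join_bound_aux hS hi hd hAB hR' hu hc
      · exact (join_bound_aux hT hj hd.symm (fun b hb a ha => (hAB a ha b hb).symm)
          (Finset.union_comm A B ▸ hR') hu hc).trans hle

end Legal

/-! ### Optimal sequences of the whole graph -/

section Whole

variable {V : Type*} {G : SimpleGraph V}

lemma encard_eq_domCount {S : List V} (hS : S.Nodup) (u : V) :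
    {v : V | v ∈ S ∧ Dominates G v u}.encard = domCount G S u := by
  classical
  have : {v : V | v ∈ S ∧ Dominates G v u} = ((S.filter (fun v => Dominates G v u)).toFinset : Set V) := by
    ext v; simp
  rw [this, Set.encard_coe_eq_coe_finsetCard, List.toFinset_card_of_nodup (hS.filter _)]
  simp [domCount, List.countP_eq_length_filter]

lemma isDNS_snoc_iff {S : List V} {r : V} : IsDNS G (S ++ [r]) ↔
    IsDNS G S ∧ r ∉ S ∧ ∃ u, Dominates G r u ∧ domCount G S u ≤ 1 := by
  have hcard : ∀ {T : List V} (u : V), T.Nodup →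
      ({v : V | v ∈ T ∧ Dominates G v u}.encard ≤ 1 ↔ domCount G T u ≤ 1) := by
    intro T u hT
    rw [encard_eq_domCount hT]; exact_mod_cast Iff.rfl
  constructor
  · rintro ⟨h1, h2⟩
    have hn := List.nodup_append.1 h1
    refine ⟨⟨hn.1, fun i hi => ?_⟩, fun h => hn.2.2 r h r (by simp) rfl, ?_⟩
    · obtain ⟨u, hu, hc⟩ := h2 i (by simp; omega)
      rw [List.getElem_append_left hi] at hu
      rw [List.take_append_of_le_length hi.le] at hc
      exact ⟨u, hu, hc⟩
    · obtain ⟨u, hu, hc⟩ := h2 S.length (by simp)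
      rw [List.getElem_concat_length rfl] at hu
      rw [List.take_left' rfl, hcard u hn.1] at hc
      exact ⟨u, hu, hc⟩
  · rintro ⟨⟨h1, h2⟩, hr, u, hu, hc⟩
    refine ⟨List.nodup_append.2 ⟨h1, by simp, ?_⟩, fun i hi => ?_⟩
    · rintro a ha b hb rfl
      rw [List.mem_singleton] at hb; exact hr (hb ▸ ha)
    · rcases Nat.lt_or_ge i S.length with hi' | hi'
      · obtain ⟨u, hu, hc⟩ := h2 i hi'
        refine ⟨u, ?_, ?_⟩
        · rwa [List.getElem_append_left hi']
        · rwa [List.take_append_of_le_length hi'.le]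
      · obtain rfl : i = S.length := by simp at hi; omega
        refine ⟨u, ?_, ?_⟩
        · rwa [List.getElem_concat_length rfl]
        · rwa [List.take_left' rfl, hcard u h1]

lemma isDNS_iff_legal [Fintype V] {S : List V} : IsDNS G S ↔ Legal G Finset.univ S := by
  induction S using List.reverseRecOn with
  | nil => exact ⟨fun _ => .nil, fun _ => ⟨by simp, fun i hi => by simp at hi⟩⟩
  | append_singleton S r ih => rw [isDNS_snoc_iff, legal_snoc_iff, ih]; simp

/-- Without isolated vertices, a longest double neighbourhood sequence is a Grundy double
dominating sequence, as a vertex that is dominated at most once would allow to extend it. -/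
lemma Optimal.isGDDS [Fintype V] {S : List V} (hS : Optimal G Finset.univ S) (hG : NoIsolated G) :
    IsGDDS G S := by
  classical
  refine ⟨⟨isDNS_iff_legal.2 hS.1, fun u => ?_⟩, fun T hT => hS.2 T (isDNS_iff_legal.1 hT.1)⟩
  rw [show {v : V | v ∈ {v : V | v ∈ S} ∧ Dominates G v u} = {v : V | v ∈ S ∧ Dominates G v u}
    from rfl, encard_eq_domCount hS.1.nodup]
  by_contra h
  have hc : domCount G S u ≤ 1 := by
    have : ¬ 2 ≤ domCount G S u := fun h' => h (by exact_mod_cast h')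
    omega
  have hi : IsoFlag G Finset.univ 0 := Or.inr ⟨rfl, by
    rintro ⟨x, -, hx⟩
    obtain ⟨y, hy⟩ := hG x
    exact hx y (Finset.mem_univ _) hy⟩
  have := hS.length_bound hi hS.1 (Finset.mem_univ u) hc
  omega

lemma IsGDDS.gddn_eq {S : List V} (hS : IsGDDS G S) : gddn G = S.length := by
  have : IsGreatest {k : ℕ | ∃ S : List V, IsDDS G S ∧ S.length = k} S.length :=
    ⟨⟨S, hS.1, rfl⟩, by rintro k ⟨T, hT, rfl⟩; exact hS.2 T hT⟩
  exact this.csSup_eq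

lemma legal_map_iff {W : Type*} [DecidableEq W] (e : V ↪ W) {A : Finset V} {S : List V} :
    Legal (G.map e) (A.map e) (S.map e) ↔ Legal G A S := by
  have hdom : ∀ v u, Dominates (G.map e) (e v) (e u) ↔ Dominates G v u := by
    intro v u; simp [Dominates]
  induction S using List.reverseRecOn with
  | nil => exact ⟨fun _ => .nil, fun _ => .nil⟩
  | append_singleton S r ih =>
    have hc : ∀ u, domCount (G.map e) (S.map e) (e u) = domCount G S u := by
      intro u
      unfold domCount
      rw [List.countP_map]
      refine List.countP_congr fun v _ => ?_
      simp [hdom]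
    rw [List.map_append, List.map_singleton, legal_snoc_iff, legal_snoc_iff]
    refine and_congr ih ?_
    simp [hdom, hc]

/-- Every legal sequence of the image of a graph under an embedding comes from the graph. -/
lemma Optimal.exists_of_map {W : Type*} [DecidableEq W] (e : V ↪ W) {A : Finset V} {S : List W}
    (hS : Optimal (G.map e) (A.map e) S) : ∃ S' : List V, S'.map e = S ∧ Optimal G A S' := by
  obtain ⟨S', rfl⟩ : ∃ S' : List V, S'.map e = S := by
    have : S ∈ Set.range (List.map e) := by
      rw [Set.range_list_map]
      intro v hv
      obtain ⟨a, -, rfl⟩ := Finset.mem_map.1 (hS.1.subset v hv)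
      exact ⟨a, rfl⟩
    exact this
  refine ⟨S', rfl, (legal_map_iff e).1 hS.1, fun T hT => ?_⟩
  simpa using hS.2 _ ((legal_map_iff e).2 hT)

end Whole

/-! ### Reasoning about programs -/

section Logic

variable {B : ℕ} {P Q : Program} {s s' : Memory}

/-- The registers that a program may change. -/
def Program.regs : Program → List ℕ
  | .skip => []
  | .const x _ => [x]
  | .copy x _ => [x]
  | .add x _ _ => [x]
  | .sub x _ _ => [x]
  | .load x _ _ => [x]
  | .store _ _ _ => []
  | .seq P Q => P.regs ++ Q.regs
  | .ifLt _ _ P Q => P.regs ++ Q.regs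
  | .whileLt _ _ P => P.regs

/-- The arrays that a program may change. -/
def Program.arrs : Program → List ℕ
  | .store a _ _ => [a]
  | .seq P Q => P.arrs ++ Q.arrs
  | .ifLt _ _ P Q => P.arrs ++ Q.arrs
  | .whileLt _ _ P => P.arrs
  | _ => []

/-- The memories `s` and `s'` agree on all that the program `P` cannot change. -/
def Agree (P : Program) (s s' : Memory) : Prop :=
  (∀ r, r ∉ P.regs → s'.reg r = s.reg r) ∧ ∀ a, a ∉ P.arrs → s'.arr a = s.arr a

lemma Agree.refl (P : Program) (s : Memory) : Agree P s s := ⟨fun _ _ => rfl, fun _ _ => rfl⟩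

lemma Agree.trans {s₁ s₂ s₃ : Memory} (h : Agree P s₁ s₂) (h' : Agree P s₂ s₃) : Agree P s₁ s₃ :=
  ⟨fun r hr => (h'.1 r hr).trans (h.1 r hr), fun a ha => (h'.2 a ha).trans (h.2 a ha)⟩

lemma Agree.of_subset (h : Agree P s s') (hr : P.regs ⊆ Q.regs) (ha : P.arrs ⊆ Q.arrs) :
    Agree Q s s' :=
  ⟨fun r h' => h.1 r fun h'' => h' (hr h''), fun a h' => h.2 a fun h'' => h' (ha h'')⟩

lemma Exec.agree {t : ℕ} (h : Exec B P s t s') : Agree P s s' := by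
  induction h with
  | skip s => exact .refl _ _
  | const s x k hk =>
    exact ⟨fun r hr => Function.update_of_ne (by simpa [Program.regs] using hr) _ _, fun _ _ => rfl⟩
  | copy s x y =>
    exact ⟨fun r hr => Function.update_of_ne (by simpa [Program.regs] using hr) _ _, fun _ _ => rfl⟩
  | add s x y z h =>
    exact ⟨fun r hr => Function.update_of_ne (by simpa [Program.regs] using hr) _ _, fun _ _ => rfl⟩
  | sub s x y z =>
    exact ⟨fun r hr => Function.update_of_ne (by simpa [Program.regs] using hr) _ _, fun _ _ => rfl⟩
  | load s x a i =>
    exact ⟨fun r hr => Function.update_of_ne (by simpa [Program.regs] using hr) _ _, fun _ _ => rfl⟩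
  | store s a i y =>
    exact ⟨fun _ _ => rfl, fun b hb => Function.update_of_ne (by simpa [Program.arrs] using hb) _ _⟩
  | seq _ _ ih₁ ih₂ =>
    exact (ih₁.of_subset (by simp [Program.regs]) (by simp [Program.arrs])).trans
      (ih₂.of_subset (by simp [Program.regs]) (by simp [Program.arrs]))
  | ifLt_true _ _ ih => exact ih.of_subset (by simp [Program.regs]) (by simp [Program.arrs])
  | ifLt_false _ _ ih => exact ih.of_subset (by simp [Program.regs]) (by simp [Program.arrs])
  | while_done _ => exact .refl _ _
  | while_step _ _ _ ih₁ ih₂ => exact Agree.trans ⟨ih₁.1, ih₁.2⟩ ih₂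

/-- The program contains no loop. -/
def Program.loopFree : Program → Bool
  | .seq P Q => P.loopFree && Q.loopFree
  | .ifLt _ _ P Q => P.loopFree && Q.loopFree
  | .whileLt _ _ _ => false
  | _ => true

/-- A bound for the number of steps of a program without loops. -/
def Program.cost : Program → ℕ
  | .seq P Q => P.cost + Q.cost
  | .ifLt _ _ P Q => max P.cost Q.cost + 1
  | _ => 1

/-- The effect of a program without loops; for a loop the value is a dummy. -/
def Program.run : Program → Memory → Memory
  | .skip, s => s
  | .const x k, s => s.setReg x k
  | .copy x y, s => s.setReg x (s.reg y)
  | .add x y z, s => s.setReg x (s.reg y + s.reg z)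
  | .sub x y z, s => s.setReg x (s.reg y - s.reg z)
  | .load x a i, s => s.setReg x (s.arr a (s.reg i))
  | .store a i y, s => s.setArr a (s.reg i) (s.reg y)
  | .seq P Q, s => Q.run (P.run s)
  | .ifLt x y P Q, s => if s.reg x < s.reg y then P.run s else Q.run s
  | .whileLt _ _ _, s => s

/-- No number larger than `B` is computed by the program without loops. -/
def Program.ok (B : ℕ) : Program → Memory → Prop
  | .const _ k, _ => k ≤ B
  | .add _ y z, s => s.reg y + s.reg z ≤ B
  | .seq P Q, s => P.ok B s ∧ Q.ok B (P.run s)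
  | .ifLt x y P Q, s => if s.reg x < s.reg y then P.ok B s else Q.ok B s
  | _, _ => True

lemma exec_run : ∀ (P : Program) (s : Memory), P.loopFree = true → P.ok B s →
    ∃ t ≤ P.cost, Exec B P s t (P.run s)
  | .skip, s, _, _ => ⟨1, le_rfl, .skip s⟩
  | .const x k, s, _, h => ⟨1, le_rfl, .const s x k h⟩
  | .copy x y, s, _, _ => ⟨1, le_rfl, .copy s x y⟩
  | .add x y z, s, _, h => ⟨1, le_rfl, .add s x y z h⟩
  | .sub x y z, s, _, _ => ⟨1, le_rfl, .sub s x y z⟩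
  | .load x a i, s, _, _ => ⟨1, le_rfl, .load s x a i⟩
  | .store a i y, s, _, _ => ⟨1, le_rfl, .store s a i y⟩
  | .seq P Q, s, hl, h => by
    simp only [Program.loopFree, Bool.and_eq_true] at hl
    obtain ⟨t₁, h₁, e₁⟩ := exec_run P s hl.1 h.1
    obtain ⟨t₂, h₂, e₂⟩ := exec_run Q _ hl.2 h.2
    exact ⟨t₁ + t₂, Nat.add_le_add h₁ h₂, .seq e₁ e₂⟩
  | .ifLt x y P Q, s, hl, h => by
    simp only [Program.loopFree, Bool.and_eq_true] at hl
    simp only [Program.ok] at h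
    simp only [Program.run, Program.cost]
    split_ifs at h ⊢ with hxy
    · obtain ⟨t, ht, e⟩ := exec_run P s hl.1 h
      exact ⟨t + 1, by omega, .ifLt_true hxy e⟩
    · obtain ⟨t, ht, e⟩ := exec_run Q s hl.2 h
      exact ⟨t + 1, by omega, .ifLt_false hxy e⟩

/-- Started with memory `s`, the program `P` halts within `T` steps with a memory that
satisfies `R`. -/
def Runs (B : ℕ) (P : Program) (s : Memory) (T : ℕ) (R : Memory → Prop) : Prop :=
  ∃ t s', t ≤ T ∧ Exec B P s t s' ∧ R s'

variable {T T₁ T₂ : ℕ} {R R' : Memory → Prop}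

lemma Runs.straight (hl : P.loopFree = true) (ho : P.ok B s) (hT : P.cost ≤ T)
    (hR : R (P.run s)) : Runs B P s T R :=
  let ⟨t, ht, he⟩ := exec_run P s hl ho
  ⟨t, _, ht.trans hT, he, hR⟩

lemma Runs.mono (h : Runs B P s T₁ R) (hT : T₁ ≤ T) (hR : ∀ s', Agree P s s' → R s' → R' s') :
    Runs B P s T R' :=
  let ⟨t, s', ht, he, h'⟩ := h
  ⟨t, s', ht.trans hT, he, hR s' he.agree h'⟩

lemma Runs.seq (h₁ : Runs B P s T₁ R) (h₂ : ∀ s', Agree P s s' → R s' → Runs B Q s' T₂ R')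
    (hT : T₁ + T₂ ≤ T) : Runs B (.seq P Q) s T R' := by
  obtain ⟨t₁, s₁, ht₁, he₁, hR₁⟩ := h₁
  obtain ⟨t₂, s₂, ht₂, he₂, hR₂⟩ := h₂ s₁ he₁.agree hR₁
  exact ⟨t₁ + t₂, s₂, by omega, .seq he₁ he₂, hR₂⟩

lemma Runs.ifLt {x y : ℕ} (h₁ : s.reg x < s.reg y → Runs B P s T R)
    (h₂ : ¬ s.reg x < s.reg y → Runs B Q s T R) : Runs B (.ifLt x y P Q) s (T + 1) R := by
  by_cases h : s.reg x < s.reg y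
  · obtain ⟨t, s', ht, he, hR⟩ := h₁ h
    exact ⟨t + 1, s', by omega, .ifLt_true h he, hR⟩
  · obtain ⟨t, s', ht, he, hR⟩ := h₂ h
    exact ⟨t + 1, s', by omega, .ifLt_false h he, hR⟩

/-- The rule for loops. The number `k` in the invariant `I k` is the time that is left. -/
lemma Runs.while {x y : ℕ} (I : ℕ → Memory → Prop)
    (hstep : ∀ k s', Agree P s s' → I k s' → s'.reg x < s'.reg y →
      ∃ T, Runs B P s' T fun s'' => ∃ k', k' + T + 1 ≤ k ∧ I k' s'')
    {k : ℕ} (h0 : I k s) :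
    Runs B (.whileLt x y P) s (k + 1) fun s' => Agree P s s' ∧ ¬ s'.reg x < s'.reg y ∧ ∃ k', I k' s' := by
  suffices H : ∀ k s₁, Agree P s s₁ → I k s₁ → Runs B (.whileLt x y P) s₁ (k + 1)
      fun s' => Agree P s s' ∧ ¬ s'.reg x < s'.reg y ∧ ∃ k', I k' s' from H k s (.refl _ _) h0
  intro k
  induction k using Nat.strong_induction_on with
  | _ k ih =>
    intro s₁ ha hI
    by_cases hxy : s₁.reg x < s₁.reg y
    · obtain ⟨T, t₁, s₂, ht₁, he₁, k', hk', hI'⟩ := hstep k s₁ ha hI hxy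
      obtain ⟨t₂, s₃, ht₂, he₂, hR⟩ := ih k' (by omega) s₂ (ha.trans he₁.agree) hI'
      exact ⟨t₁ + t₂ + 1, s₃, by omega, .while_step hxy he₁ he₂, hR⟩
    · exact ⟨1, s₁, by omega, .while_done hxy, ha, hxy, k, hI⟩

/-- The rule for loops whose body has no loop. The invariant `I i` holds after `i` rounds, where
the count may start at any `i₀`, and `K` bounds the number of rounds. -/
lemma Runs.for {x y : ℕ} (I : ℕ → Memory → Prop) (K i₀ : ℕ) (hl : P.loopFree = true)
    (hstep : ∀ i s', Agree P s s' → I i s' → s'.reg x < s'.reg y →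
      i < K ∧ P.ok B s' ∧ I (i + 1) (P.run s'))
    (h0 : I i₀ s) (hT : (P.cost + 1) * (K - i₀) + 1 ≤ T) :
    Runs B (.whileLt x y P) s T fun s' => ¬ s'.reg x < s'.reg y ∧ ∃ i, I i s' := by
  refine (Runs.while (I := fun k s' => ∃ i, k = (P.cost + 1) * (K - i) ∧ I i s') ?_
    ⟨i₀, rfl, h0⟩).mono hT ?_
  · rintro k s' ha ⟨i, rfl, hI⟩ hlt
    obtain ⟨hi, ho, hI'⟩ := hstep i s' ha hI hlt
    refine ⟨P.cost, .straight hl ho le_rfl ⟨_, ?_, i + 1, rfl, hI'⟩⟩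
    rw [show K - i = K - (i + 1) + 1 by omega, Nat.mul_succ, Nat.add_assoc]
  · rintro s' _ ⟨_, h, k, i, _, hI⟩
    exact ⟨h, i, hI⟩

@[simp] lemma reg_setReg (s : Memory) (x k y : ℕ) :
    (s.setReg x k).reg y = if y = x then k else s.reg y := by
  simp [Memory.setReg, Function.update_apply]

@[simp] lemma arr_setReg (s : Memory) (x k : ℕ) : (s.setReg x k).arr = s.arr := rfl

@[simp] lemma reg_setArr (s : Memory) (a i k : ℕ) : (s.setArr a i k).reg = s.reg := rfl

@[simp] lemma arr_setArr (s : Memory) (a i k b : ℕ) :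
    (s.setArr a i k).arr b = if b = a then Function.update (s.arr a) i k else s.arr b := by
  by_cases h : b = a
  · subst h; simp [Memory.setArr]
  · simp [Memory.setArr, h]

lemma setReg_setReg (s : Memory) (x k k' : ℕ) : (s.setReg x k).setReg x k' = s.setReg x k' := by
  simp [Memory.setReg]

/-- The programs of a list, one after the other. -/
def block : List Program → Program
  | [] => .skip
  | [P] => P
  | P :: Q :: l => .seq P (block (Q :: l))

/-- If `x = y` then `P` else `Q`. -/
def ifEq (x y : ℕ) (P Q : Program) : Program := .ifLt x y Q (.ifLt y x Q P)

lemma run_ifEq (x y : ℕ) (P Q : Program) (s : Memory) :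
    (ifEq x y P Q).run s = if s.reg x = s.reg y then P.run s else Q.run s := by
  simp only [ifEq, Program.run]
  split_ifs <;> first | rfl | omega

lemma ok_ifEq (x y : ℕ) (P Q : Program) (s : Memory) :
    (ifEq x y P Q).ok B s = if s.reg x = s.reg y then P.ok B s else Q.ok B s := by
  simp only [ifEq, Program.ok]
  split_ifs <;> first | rfl | omega

end Logic

/-! ### Addition and subtraction modulo a register -/

/-- The sum of two residues modulo `M`. -/
def addm (M a b : ℕ) : ℕ := if a + b < M then a + b else a + b - M

/-- The difference of two residues modulo `M`. -/
def subm (M a b : ℕ) : ℕ := if a + M - b < M then a + M - b else a + M - b - M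

lemma addm_lt {M a b : ℕ} (ha : a < M) (hb : b < M) : addm M a b < M := by
  unfold addm; split_ifs <;> omega

lemma subm_lt {M a b : ℕ} (ha : a < M) : subm M a b < M := by
  unfold subm; split_ifs <;> omega

lemma cast_addm {M a b : ℕ} : ((addm M a b : ℕ) : ZMod M) = a + b := by
  unfold addm
  split_ifs with h
  · push_cast; rfl
  · rw [Nat.cast_sub (by omega)]; simp

lemma cast_subm {M a b : ℕ} (hb : b < M) : ((subm M a b : ℕ) : ZMod M) = a - b := by
  have h : ((a + M - b : ℕ) : ZMod M) = a - b := by rw [Nat.cast_sub (by omega)]; simp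
  unfold subm
  split_ifs with h'
  · exact h
  · rw [Nat.cast_sub (by omega), h]; simp

lemma eq_of_cast_eq {M a b : ℕ} (ha : a < M) (hb : b < M) (h : (a : ZMod M) = b) : a = b := by
  have := (ZMod.natCast_eq_natCast_iff' a b M).1 h
  rwa [Nat.mod_eq_of_lt ha, Nat.mod_eq_of_lt hb] at this

/-- `x := y + z` modulo register `m`. -/
def addMod (m x y z : ℕ) : Program := .seq (.add x y z) (.ifLt x m .skip (.sub x x m))

/-- `x := y - z` modulo register `m`. -/
def subMod (m x y z : ℕ) : Program :=
  .seq (.add x y m) (.seq (.sub x x z) (.ifLt x m .skip (.sub x x m)))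

lemma run_addMod {m x : ℕ} (hx : m ≠ x) (y z : ℕ) (s : Memory) :
    (addMod m x y z).run s = s.setReg x (addm (s.reg m) (s.reg y) (s.reg z)) := by
  simp only [addMod, Program.run, reg_setReg, if_true, if_neg hx, addm]
  split_ifs
  · rfl
  · rw [setReg_setReg]

lemma run_subMod {m x z : ℕ} (hx : m ≠ x) (hz : z ≠ x) (y : ℕ) (s : Memory) :
    (subMod m x y z).run s = s.setReg x (subm (s.reg m) (s.reg y) (s.reg z)) := by
  simp only [subMod, Program.run, reg_setReg, if_true, if_neg hx, if_neg hz, subm, setReg_setReg]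
  split_ifs
  · rfl
  · rfl

lemma ok_addMod {B m x : ℕ} (y z : ℕ) (s : Memory) :
    (addMod m x y z).ok B s ↔ s.reg y + s.reg z ≤ B := by
  simp only [addMod, Program.ok]
  split_ifs <;> simp

lemma ok_subMod {B m x : ℕ} (y z : ℕ) (s : Memory) :
    (subMod m x y z).ok B s ↔ s.reg y + s.reg m ≤ B := by
  simp only [subMod, Program.ok]
  split_ifs <;> simp

/-! ### Cotrees -/

/-- `par` and `lab` describe a cotree, with set of nodes `N`, of the subgraph of `H` induced by `X`.
The vertices in `X` are the leaves, with label `0`; the label of an inner node is `1` for a disjoint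
union and `2` for a join; the parent of the root is the number `0`, which is no node. The set of
leaves below `u` is `Λ u`. Inner nodes with only one child are allowed. -/
structure Cotree (H : SimpleGraph ℕ) (X N : Finset ℕ) (Λ : ℕ → Finset ℕ) (par lab : ℕ → ℕ) :
    Prop where
  zero : 0 ∉ N
  par_zero : par 0 = 0
  leaf_mem : X ⊆ N
  leaf : ∀ v ∈ X, Λ v = {v}
  lab_leaf : ∀ v ∈ X, lab v = 0
  lab_node : ∀ u ∈ N, u ∉ X → lab u = 1 ∨ lab u = 2
  sub : ∀ u ∈ N, Λ u ⊆ X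
  nonempty : ∀ u ∈ N, (Λ u).Nonempty
  par_mem : ∀ u ∈ N, par u ≠ 0 → par u ∈ N
  par_leaf : ∀ u ∈ N, par u ∉ X
  par_sub : ∀ u ∈ N, par u ≠ 0 → Λ u ⊆ Λ (par u)
  root : ∀ u ∈ N, par u = 0 → Λ u = X
  child : ∀ p ∈ N, p ∉ X → ∀ v ∈ Λ p, ∃ u ∈ N, par u = p ∧ v ∈ Λ u
  sib : ∀ u ∈ N, ∀ u' ∈ N, u ≠ u' → par u = par u' → ∀ v ∈ Λ u, ∀ v' ∈ Λ u',
    v ≠ v' ∧ (H.Adj v v' ↔ lab (par u) = 2)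

/-- Every node has fewer leaves than its parent, that is, no inner node has only one child. -/
def Strict (N : Finset ℕ) (Λ : ℕ → Finset ℕ) (par : ℕ → ℕ) : Prop :=
  ∀ u ∈ N, par u ≠ 0 → Λ u ⊂ Λ (par u)

/-- Labels of adjacent nodes differ. -/
def Alternating (N : Finset ℕ) (par lab : ℕ → ℕ) : Prop :=
  ∀ u ∈ N, par u ≠ 0 → lab u ≠ lab (par u)

/-- There is no induced path on four vertices; the distinctness of the vertices is implied. -/
def P4Free {V : Type*} (H : SimpleGraph V) : Prop :=
  ∀ a b c d, H.Adj a b → H.Adj b c → H.Adj c d → ¬ H.Adj a c → ¬ H.Adj b d → ¬ H.Adj a d → False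

namespace Cotree

variable {H : SimpleGraph ℕ} {X N : Finset ℕ} {Λ : ℕ → Finset ℕ} {par lab : ℕ → ℕ}

lemma par_notMem_of_notMem (T : Cotree H X N Λ par lab) {g u : ℕ} (hg : g ∉ N) (hg0 : g ≠ 0)
    (hu : u ∈ N) : par u ≠ g := by
  rintro rfl
  exact hg (T.par_mem u hu hg0)

lemma notMem_of_par (T : Cotree H X N Λ par lab) {u α : ℕ} (hu : u ∈ N) (h : par u = α) :
    α ∉ X := h ▸ T.par_leaf u hu

lemma strict_of_two (T : Cotree H X N Λ par lab)
    (h : ∀ u ∈ N, par u ≠ 0 → ∃ u' ∈ N, u' ≠ u ∧ par u' = par u) : Strict N Λ par := by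
  intro u hu hp
  refine (Finset.ssubset_iff_of_subset (T.par_sub u hu hp)).2 ?_
  obtain ⟨u', hu', hne, he⟩ := h u hu hp
  obtain ⟨v, hv⟩ := T.nonempty u' hu'
  refine ⟨v, he ▸ T.par_sub u' hu' (he ▸ hp) hv, fun hv' => ?_⟩
  exact (T.sib u hu u' hu' hne.symm he.symm v hv' v hv).1 rfl

lemma iterate_zero (T : Cotree H X N Λ par lab) (k : ℕ) : par^[k] 0 = 0 := by
  induction k with
  | zero => rfl
  | succ k ih => rw [Function.iterate_succ_apply, T.par_zero, ih]

lemma subset_iterate (T : Cotree H X N Λ par lab) (k : ℕ) : ∀ u ∈ N, par^[k] u ∈ N →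
    Λ u ⊆ Λ (par^[k] u) := by
  induction k with
  | zero => intro u _ _; exact subset_rfl
  | succ k ih =>
    intro u hu h
    rw [Function.iterate_succ_apply] at h ⊢
    have h0 : par u ≠ 0 := by
      intro h0; rw [h0, T.iterate_zero] at h; exact T.zero h
    exact (T.par_sub u hu h0).trans (ih _ (T.par_mem u hu h0) h)

lemma exists_iterate (T : Cotree H X N Λ par lab) (hs : Strict N Λ par) {w : ℕ} :
    ∀ q ∈ N, w ∈ Λ q → ∃ k, par^[k] w = q := by
  intro q
  induction h : (Λ q).card using Nat.strong_induction_on generalizing q with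
  | _ m ih =>
    intro hq hw
    by_cases hX : q ∈ X
    · rw [T.leaf q hX, Finset.mem_singleton] at hw
      exact ⟨0, hw⟩
    · obtain ⟨u, hu, rfl, hwu⟩ := T.child q hq hX w hw
      have h0 : par u ≠ 0 := fun h0 => T.zero (h0 ▸ hq)
      obtain ⟨k, hk⟩ := ih _ (h ▸ Finset.card_lt_card (hs u hu h0)) u rfl hu hwu
      exact ⟨k + 1, by rw [Function.iterate_succ_apply', hk]⟩

/-- The nodes above a leaf form a chain. -/
lemma chain (T : Cotree H X N Λ par lab) (hs : Strict N Λ par) {u q w : ℕ} (hu : u ∈ N)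
    (hq : q ∈ N) (hwu : w ∈ Λ u) (hwq : w ∈ Λ q) :
    u = q ∨ (par u ≠ 0 ∧ Λ (par u) ⊆ Λ q) ∨ (par q ≠ 0 ∧ Λ (par q) ⊆ Λ u) := by
  have key : ∀ u ∈ N, ∀ q ∈ N, ∀ i d, par^[i] w = u → par^[i + d + 1] w = q →
      par u ≠ 0 ∧ Λ (par u) ⊆ Λ q := by
    intro u hu q hq i d hi hj
    rw [show i + d + 1 = d + 1 + i by omega, Function.iterate_add_apply, hi,
      Function.iterate_succ_apply] at hj
    have h0 : par u ≠ 0 := by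
      intro h0; rw [h0, T.iterate_zero] at hj; exact T.zero (hj ▸ hq)
    exact ⟨h0, hj ▸ T.subset_iterate d _ (T.par_mem u hu h0) (hj ▸ hq)⟩
  obtain ⟨i, hi⟩ := T.exists_iterate hs u hu hwu
  obtain ⟨j, hj⟩ := T.exists_iterate hs q hq hwq
  rcases lt_trichotomy i j with h | h | h
  · exact Or.inr (Or.inl (key u hu q hq i (j - i - 1) hi (by convert hj using 2; omega)))
  · left; rw [← hi, ← hj, h]
  · exact Or.inr (Or.inr (key q hq u hu j (i - j - 1) hj (by convert hi using 2; omega)))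

lemma injective (T : Cotree H X N Λ par lab) (hs : Strict N Λ par) {u q : ℕ} (hu : u ∈ N)
    (hq : q ∈ N) (h : Λ u = Λ q) : u = q := by
  obtain ⟨w, hw⟩ := T.nonempty u hu
  rcases T.chain hs hu hq hw (h ▸ hw) with h' | ⟨h0, h'⟩ | ⟨h0, h'⟩
  · exact h'
  · exact absurd (h ▸ h') (hs u hu h0).not_subset
  · exact absurd (h ▸ h') (hs q hq h0).not_subset

lemma laminar (T : Cotree H X N Λ par lab) (hs : Strict N Λ par) {u q : ℕ} (hu : u ∈ N)
    (hq : q ∈ N) : Λ u ⊆ Λ q ∨ Λ q ⊂ Λ u ∨ Disjoint (Λ u) (Λ q) := by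
  by_cases h : Disjoint (Λ u) (Λ q)
  · exact Or.inr (Or.inr h)
  · obtain ⟨w, hwu, hwq⟩ := Finset.not_disjoint_iff.1 h
    rcases T.chain hs hu hq hwu hwq with rfl | ⟨h0, h'⟩ | ⟨h0, h'⟩
    · exact Or.inl subset_rfl
    · exact Or.inl ((T.par_sub u hu h0).trans h')
    · exact Or.inr (Or.inl ((hs q hq h0).trans_subset h'))

lemma climb (T : Cotree H X N Λ par lab) (hs : Strict N Λ par) {u q : ℕ} (hu : u ∈ N)
    (hq : q ∈ N) (h : Λ u ⊂ Λ q) : par u ≠ 0 ∧ Λ (par u) ⊆ Λ q := by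
  obtain ⟨w, hw⟩ := T.nonempty u hu
  rcases T.chain hs hu hq hw (h.subset hw) with rfl | h' | ⟨h0, h'⟩
  · exact absurd h (ssubset_irrefl _)
  · exact h'
  · exact absurd (h.trans (hs q hq h0)) (fun h'' => h''.not_subset h')

/-- A node strictly below `q` lies below a child of `q`. -/
lemma exists_child_above (T : Cotree H X N Λ par lab) (hs : Strict N Λ par) {q : ℕ} (hq : q ∈ N) :
    ∀ u ∈ N, Λ u ⊂ Λ q → ∃ u' ∈ N, par u' = q ∧ Λ u ⊆ Λ u' := by
  intro u
  induction h : (Λ q).card - (Λ u).card using Nat.strong_induction_on generalizing u with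
  | _ m ih =>
    intro hu huq
    obtain ⟨h0, hle⟩ := T.climb hs hu hq huq
    rcases hle.eq_or_ssubset with he | hlt
    · exact ⟨u, hu, T.injective hs (T.par_mem u hu h0) hq he, subset_rfl⟩
    · have h1 := Finset.card_lt_card (hs u hu h0)
      have h2 := Finset.card_lt_card hlt
      obtain ⟨u', hu', he, hsub⟩ := ih _ (by omega) (par u) rfl (T.par_mem u hu h0) hlt
      exact ⟨u', hu', he, (T.par_sub u hu h0).trans hsub⟩

/-- The leaves below a node are not distinguished by a vertex outside. -/
lemma adj_iff (T : Cotree H X N Λ par lab) (hs : Strict N Λ par) {v : ℕ} (hv : v ∈ X) :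
    ∀ u ∈ N, v ∉ Λ u → ∀ w ∈ Λ u, ∀ w' ∈ Λ u, (H.Adj w v ↔ H.Adj w' v) := by
  intro u
  induction h : X.card - (Λ u).card using Nat.strong_induction_on generalizing u with
  | _ m ih =>
    intro hu hvu w hw w' hw'
    have h0 : par u ≠ 0 := fun h0 => hvu (T.root u hu h0 ▸ hv)
    have hp := T.par_mem u hu h0
    have hsub := T.par_sub u hu h0
    by_cases hvp : v ∈ Λ (par u)
    · obtain ⟨u', hu', he, hvu'⟩ := T.child _ hp (T.par_leaf u hu) v hvp
      have hne : u ≠ u' := by rintro rfl; exact hvu hvu'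
      rw [(T.sib u hu u' hu' hne he.symm w hw v hvu').2,
        (T.sib u hu u' hu' hne he.symm w' hw' v hvu').2]
    · have h1 := Finset.card_lt_card (hs u hu h0)
      have h2 := Finset.card_le_card (T.sub _ hp)
      exact ih _ (by omega) (par u) rfl hp hvp w (hsub hw) w' (hsub hw')

lemma exists_root (T : Cotree H X N Λ par lab) (hs : Strict N Λ par) (hX : X.Nonempty) :
    ∃ r ∈ N, par r = 0 ∧ ∀ u ∈ N, par u = 0 → u = r := by
  obtain ⟨r, hr, hmax⟩ := Finset.exists_max_image N (fun u => (Λ u).card) (hX.mono T.leaf_mem)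
  have h0 : par r = 0 := by
    by_contra h0
    have := Finset.card_lt_card (hs r hr h0)
    have := hmax _ (T.par_mem r hr h0)
    omega
  exact ⟨r, hr, h0, fun u hu h => T.injective hs hu hr ((T.root u hu h).trans (T.root r hr h0).symm)⟩

/-! ### The place of a new vertex -/

variable {x α : ℕ}

/-- `α` is a lowest node that has both neighbours and non-neighbours of `x` below it. -/
structure Pivot (H : SimpleGraph ℕ) (N : Finset ℕ) (Λ : ℕ → Finset ℕ) (par : ℕ → ℕ)
    (x α : ℕ) : Prop where
  mem : α ∈ N
  exists_adj : ∃ f ∈ Λ α, H.Adj x f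
  exists_not_adj : ∃ e ∈ Λ α, ¬ H.Adj x e
  children : ∀ u ∈ N, par u = α → (∀ v ∈ Λ u, H.Adj x v) ∨ ∀ v ∈ Λ u, ¬ H.Adj x v

lemma Pivot.notMem (T : Cotree H X N Λ par lab) (h : Pivot H N Λ par x α) : α ∉ X := by
  intro hX
  obtain ⟨f, hf, hxf⟩ := h.exists_adj
  obtain ⟨e, he, hxe⟩ := h.exists_not_adj
  rw [T.leaf α hX, Finset.mem_singleton] at hf he
  exact hxe (he ▸ hf ▸ hxf)

/-- The heart of the insertion: if `x` extends the graph without creating an induced path on four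
vertices, then from outside of a pivot `α` the vertex `x` looks like the leaves below `α`. -/
lemma pivot_twin (T : Cotree H X N Λ par lab) (hs : Strict N Λ par) (ha : Alternating N par lab)
    (hH : P4Free H) (h : Pivot H N Λ par x α) {v w : ℕ} (hv : v ∈ X) (hvα : v ∉ Λ α)
    (hw : w ∈ Λ α) : H.Adj x v ↔ H.Adj w v := by
  have hαN := h.mem
  have hαX := h.notMem T
  obtain ⟨f, hf, hxf⟩ := h.exists_adj
  obtain ⟨e, he, hxe⟩ := h.exists_not_adj
  obtain ⟨uf, huf, hpf, hfu⟩ := T.child α hαN hαX f hf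
  obtain ⟨ue, hue, hpe, heu⟩ := T.child α hαN hαX e he
  have hne : uf ≠ ue := by
    rintro rfl
    rcases h.children uf huf hpf with h' | h'
    · exact hxe (h' e heu)
    · exact h' f hfu hxf
  have hfe : H.Adj f e ↔ lab α = 2 := by
    have := (T.sib uf huf ue hue hne (hpf.trans hpe.symm) f hfu e heu).2
    rwa [hpf] at this
  have h0 : par α ≠ 0 := fun h0 => hvα (T.root α hαN h0 ▸ hv)
  have hp := T.par_mem α hαN h0
  have hlp := T.lab_node _ hp (T.par_leaf α hαN)
  have hlα := T.lab_node _ hαN hαX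
  have hal := ha α hαN h0
  -- half of the claim needs no alternation
  have one : ∀ z ∈ X, z ∉ Λ α → (lab α = 2 → H.Adj x z → H.Adj e z) ∧
      (lab α = 1 → H.Adj e z → H.Adj x z) := by
    intro z hz hzα
    have hfz := T.adj_iff hs hz α hαN hzα f hf e he
    refine ⟨fun hl hxz => ?_, fun hl hez => ?_⟩
    · by_contra hez
      exact hH z x f e hxz.symm hxf (hfe.2 hl) (fun h => hez (hfz.1 h.symm)) hxe
        (fun h => hez h.symm)
    · by_contra hxz
      exact hH x f z e hxf (hfz.2 hez) hez.symm hxz (fun h => by rw [hfe] at h; omega) hxe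
  obtain ⟨z, hzp, hzα⟩ := Finset.exists_of_ssubset (hs α hαN h0)
  have hzX := T.sub _ hp hzp
  obtain ⟨uz, huz, hpz, hzu⟩ := T.child _ hp (T.par_leaf α hαN) z hzp
  have hnz : α ≠ uz := by rintro rfl; exact hzα hzu
  have hez : H.Adj e z ↔ lab (par α) = 2 := (T.sib α hαN uz huz hnz hpz.symm e he z hzu).2
  have hfz := T.adj_iff hs hzX α hαN hzα f hf e he
  have hfv := T.adj_iff hs hv α hαN hvα f hf e he
  have hvp : v ∈ Λ (par α) → (H.Adj e v ↔ lab (par α) = 2) := by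
    intro hvp
    obtain ⟨uv, huv, hpv, hvu⟩ := T.child _ hp (T.par_leaf α hαN) v hvp
    have hnv : α ≠ uv := by rintro rfl; exact hvα hvu
    exact (T.sib α hαN uv huv hnv hpv.symm e he v hvu).2
  have hzv : v ∉ Λ (par α) → (H.Adj z v ↔ H.Adj e v) := fun hvp =>
    T.adj_iff hs hv _ hp hvp z hzp e (T.par_sub α hαN h0 he)
  rw [T.adj_iff hs hv α hαN hvα w hw e he]
  rcases hlα with hl | hl
  · refine ⟨fun hxv => ?_, (one v hv hvα).2 hl⟩
    by_contra hev
    have hl2 : lab (par α) = 2 := by omega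
    have hvp' : v ∉ Λ (par α) := fun h => hev ((hvp h).2 hl2)
    have hxz := (one z hzX hzα).2 hl (hez.2 hl2)
    exact hH v x z e hxv.symm hxz (hez.2 hl2).symm (fun h => hev ((hzv hvp').1 h.symm)) hxe
      (fun h => hev h.symm)
  · refine ⟨(one v hv hvα).1 hl, fun hev => ?_⟩
    by_contra hxv
    have hl2 : lab (par α) ≠ 2 := by omega
    have hvp' : v ∉ Λ (par α) := fun h => hl2 ((hvp h).1 hev)
    have hxz : ¬ H.Adj x z := fun h => hl2 (hez.1 ((one z hzX hzα).1 hl h))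
    exact hH x f v z hxf (hfv.2 hev) ((hzv hvp').2 hev).symm hxv
      (fun h => hl2 (hez.1 (hfz.1 h))) hxz

/-- The node `q` has a child with only neighbours of `x` below it, and a non-neighbour of `x`
below it. -/
def Candidate (H : SimpleGraph ℕ) (N : Finset ℕ) (Λ : ℕ → Finset ℕ) (par : ℕ → ℕ)
    (x q : ℕ) : Prop :=
  q ∈ N ∧ (∃ u ∈ N, par u = q ∧ ∀ v ∈ Λ u, H.Adj x v) ∧ ∃ v ∈ Λ q, ¬ H.Adj x v

lemma exists_pivot (T : Cotree H X N Λ par lab) {r : ℕ} (hr : r ∈ N)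
    (h1 : ∃ v ∈ Λ r, H.Adj x v) (h2 : ∃ v ∈ Λ r, ¬ H.Adj x v) (hs : Strict N Λ par) :
    ∃ α, Pivot H N Λ par x α := by
  classical
  obtain ⟨α, hα, hmin⟩ := Finset.exists_min_image
    (N.filter fun q => (∃ v ∈ Λ q, H.Adj x v) ∧ ∃ v ∈ Λ q, ¬ H.Adj x v) (fun q => (Λ q).card)
    ⟨r, by simpa using ⟨hr, h1, h2⟩⟩
  simp only [Finset.mem_filter] at hα hmin
  refine ⟨α, hα.1, hα.2.1, hα.2.2, fun u hu hpu => ?_⟩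
  by_contra hcon
  push Not at hcon
  have := hmin u ⟨hu, hcon.2, hcon.1⟩
  have h0 : par u ≠ 0 := fun h0 => T.zero (h0 ▸ hpu ▸ hα.1)
  have := Finset.card_lt_card (hpu ▸ hs u hu h0)
  omega

lemma Pivot.candidate (T : Cotree H X N Λ par lab) (h : Pivot H N Λ par x α) :
    Candidate H N Λ par x α := by
  obtain ⟨f, hf, hxf⟩ := h.exists_adj
  obtain ⟨u, hu, hpu, hfu⟩ := T.child α h.mem (h.notMem T) f hf
  exact ⟨h.mem, ⟨u, hu, hpu, (h.children u hu hpu).resolve_right fun h' => h' f hfu hxf⟩,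
    h.exists_not_adj⟩

lemma Candidate.mixed (T : Cotree H X N Λ par lab) {q : ℕ} (h : Candidate H N Λ par x q) :
    (∃ v ∈ Λ q, H.Adj x v) ∧ ∃ v ∈ Λ q, ¬ H.Adj x v := by
  obtain ⟨hq, ⟨u, hu, rfl, hfull⟩, h2⟩ := h
  obtain ⟨v, hv⟩ := T.nonempty u hu
  exact ⟨⟨v, T.par_sub u hu (fun h0 => T.zero (h0 ▸ hq)) hv, hfull v hv⟩, h2⟩

lemma Pivot.not_candidate (T : Cotree H X N Λ par lab) (h : Pivot H N Λ par x α) {q : ℕ}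
    (hq : Candidate H N Λ par x q) : par q ≠ α ∧ par (par q) ≠ α := by
  have hα0 : α ≠ 0 := fun h0 => T.zero (h0 ▸ h.mem)
  obtain ⟨⟨v, hv, hxv⟩, ⟨w, hw, hxw⟩⟩ := hq.mixed T
  constructor
  · intro hp
    rcases h.children q hq.1 hp with h' | h'
    · exact hxw (h' w hw)
    · exact h' v hv hxv
  · intro hp
    have h0 : par q ≠ 0 := by
      intro h0; rw [h0, T.par_zero] at hp; exact hα0 hp.symm
    have hsub := T.par_sub q hq.1 h0
    rcases h.children (par q) (T.par_mem q hq.1 h0) hp with h' | h'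
    · exact hxw (h' w (hsub hw))
    · exact h' v (hsub hv) hxv

/-- Every candidate other than the pivot is the parent or grandparent of a candidate: on the way
from the pivot to the root, all join nodes are candidates. -/
lemma exists_candidate_below (T : Cotree H X N Λ par lab) (hs : Strict N Λ par)
    (ha : Alternating N par lab) (hH : P4Free H) (h : Pivot H N Λ par x α) {q : ℕ}
    (hq : Candidate H N Λ par x q) (hne : q ≠ α) :
    ∃ q', Candidate H N Λ par x q' ∧ (par q' = q ∨ par (par q') = q) := by
  have hαc := h.candidate T
  obtain ⟨w, hw⟩ := T.nonempty α h.mem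
  have twin : ∀ v ∈ X, v ∉ Λ α → (H.Adj x v ↔ H.Adj w v) := fun v hv hvα =>
    T.pivot_twin hs ha hH h hv hvα hw
  obtain ⟨⟨v₁, hv₁, hxv₁⟩, ⟨v₂, hv₂, hxv₂⟩⟩ := hq.mixed T
  have hsub : Λ α ⊂ Λ q := by
    rcases T.laminar hs h.mem hq.1 with h' | h' | h'
    · exact h'.ssubset_of_ne fun he => hne (T.injective hs h.mem hq.1 he).symm
    · obtain ⟨u, hu, hpu, hqu⟩ := T.exists_child_above hs h.mem q hq.1 h'
      rcases h.children u hu hpu with h'' | h''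
      · exact absurd (h'' v₂ (hqu hv₂)) hxv₂
      · exact absurd hxv₁ (h'' v₁ (hqu hv₁))
    · have hd := Finset.disjoint_left.1 h'
      have h1 := twin v₁ (T.sub q hq.1 hv₁) fun h => hd h hv₁
      have h2 := twin v₂ (T.sub q hq.1 hv₂) fun h => hd h hv₂
      have h3 := T.adj_iff hs (T.sub α h.mem hw) q hq.1 (hd hw) v₁ hv₁ v₂ hv₂
      rw [H.adj_comm v₁, H.adj_comm v₂] at h3
      exact absurd (h2.2 (h3.1 (h1.1 hxv₁))) hxv₂
  -- a join node above the pivot is a candidate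
  have join : ∀ p ∈ N, Λ α ⊂ Λ p → lab p = 2 → Candidate H N Λ par x p := by
    intro p hp hαp hl
    obtain ⟨u, hu, hpu, hαu⟩ := T.exists_child_above hs hp α h.mem hαp
    have h0 : par u ≠ 0 := fun h0 => T.zero (h0 ▸ hpu ▸ hp)
    obtain ⟨z, hzp, hzu⟩ := Finset.exists_of_ssubset (hs u hu h0)
    obtain ⟨u', hu', hpu', hzu'⟩ := T.child p hp (T.notMem_of_par hu hpu) z (hpu ▸ hzp)
    have hne : u ≠ u' := by rintro rfl; exact hzu hzu'
    refine ⟨hp, ⟨u', hu', hpu', fun v hv => ?_⟩, ?_⟩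
    · have hs1 := T.sib u hu u' hu' hne (hpu.trans hpu'.symm)
      have hvα : v ∉ Λ α := fun hvα => (hs1 v (hαu hvα) v hv).1 rfl
      rw [twin v (T.sub u' hu' hv) hvα, (hs1 w (hαu hw) v hv).2, hpu, hl]
    · obtain ⟨e, he, hxe⟩ := h.exists_not_adj
      exact ⟨e, hαp.subset he, hxe⟩
  obtain ⟨u, hu, hpu, hαu⟩ := T.exists_child_above hs hq.1 α h.mem hsub
  rcases hαu.eq_or_ssubset with he | hlt
  · exact ⟨α, hαc, Or.inl (T.injective hs h.mem hu he ▸ hpu)⟩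
  · have h0 : par u ≠ 0 := fun h0 => T.zero (h0 ▸ hpu ▸ hq.1)
    obtain ⟨u₂, hu₂, hpu₂, hαu₂⟩ := T.exists_child_above hs hu α h.mem hlt
    have huX := T.notMem_of_par hu₂ hpu₂
    rcases T.lab_node u hu huX with hl | hl
    · rcases hαu₂.eq_or_ssubset with he | hlt₂
      · exact ⟨α, hαc, Or.inr (by rw [T.injective hs h.mem hu₂ he, hpu₂, hpu])⟩
      · have h0' : par u₂ ≠ 0 := fun h0 => T.zero (h0 ▸ hpu₂ ▸ hu)
        obtain ⟨u₃, hu₃, hpu₃, -⟩ := T.exists_child_above hs hu₂ α h.mem hlt₂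
        have hal := ha u₂ hu₂ h0'
        rw [hpu₂, hl] at hal
        have hl₂ := T.lab_node u₂ hu₂ (T.notMem_of_par hu₃ hpu₃)
        exact ⟨u₂, join u₂ hu₂ hlt₂ (by omega), Or.inr (by rw [hpu₂, hpu])⟩
    · exact ⟨u, join u hu hlt hl, Or.inl hpu⟩

/-- The leaves that take part on the side of `x` below a pivot: the neighbours of `x` if the pivot
is a union, and the non-neighbours if it is a join. -/
lemma pivot_part_twin (T : Cotree H X N Λ par lab) (hs : Strict N Λ par)
    (ha : Alternating N par lab) (hH : P4Free H) (h : Pivot H N Λ par x α) {v w : ℕ} (hv : v ∈ X)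
    (hvS : ¬ (v ∈ Λ α ∧ (H.Adj x v ↔ lab α = 1))) (hw : w ∈ Λ α) (hwS : H.Adj x w ↔ lab α = 1) :
    H.Adj x v ↔ H.Adj w v := by
  by_cases hvα : v ∈ Λ α
  · have hαX := h.notMem T
    obtain ⟨uv, huv, hpv, hvu⟩ := T.child α h.mem hαX v hvα
    obtain ⟨uw, huw, hpw, hwu⟩ := T.child α h.mem hαX w hw
    have hne : uw ≠ uv := by
      rintro rfl
      rcases h.children uw huv hpv with h' | h'
      · have := h' v hvu; have := h' w hwu; tauto
      · have := h' v hvu; have := h' w hwu; tauto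
    have := (T.sib uw huw uv huv hne (hpw.trans hpv.symm) w hwu v hvu).2
    rw [hpw] at this
    have hl := T.lab_node α h.mem hαX
    rw [this]
    constructor
    · intro hx; by_contra h2; exact hvS ⟨hvα, fun _ => by omega, fun _ => hx⟩
    · intro hl2; by_contra hx; exact hvS ⟨hvα, fun h => absurd h hx, fun h1 => by omega⟩
  · exact T.pivot_twin hs ha hH h hv hvα hw

/-! ### Changes of a cotree -/

/-- A new node `g` is put on an edge: of the two nodes `α` and `g`, the upper one is `t` and the
lower one is `b`, and the children of `α` are divided between them. The leaves below `b` are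
those in `S`. -/
lemma split (T : Cotree H X N Λ par lab) {g t b : ℕ} {S : Finset ℕ} {par' lab' : ℕ → ℕ}
    (hα : α ∈ N) (hαα : par α ≠ α) (hg : g ∉ N) (hg0 : g ≠ 0)
    (htb : (t = α ∧ b = g) ∨ (t = g ∧ b = α)) (hS : S ⊆ Λ α) (hSne : S.Nonempty)
    (hD : ∀ u ∈ N, par u = α → (Λ u ⊆ S ∧ par' u = b) ∨ (Disjoint (Λ u) S ∧ par' u = t))
    (hleaf : α ∈ X → b = α ∧ S = Λ α) (hpt : par' t = par α) (hpb : par' b = t)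
    (hpo : ∀ u ∈ N, u ≠ α → par u ≠ α → par' u = par u) (hp0 : par' 0 = 0)
    (hlab : ∀ u ∈ N, lab' u = lab u)
    (hlg : (lab' g = lab α ∧ α ∉ X) ∨ (S = Λ α ∧ t = g ∧ (lab' g = 1 ∨ lab' g = 2))) :
    Cotree H X (insert g N) (fun u => if u = b then S else if u = t then Λ α else Λ u)
      par' lab' := by
  have hgX : g ∉ X := fun h => hg (T.leaf_mem h)
  have hα0 : α ≠ 0 := fun h => T.zero (h ▸ hα)
  have hgα : g ≠ α := fun h => hg (h ▸ hα)
  have hbt : b ≠ t := by rcases htb with ⟨rfl, rfl⟩ | ⟨rfl, rfl⟩ <;> tauto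
  have hb0 : b ≠ 0 := by rcases htb with ⟨rfl, rfl⟩ | ⟨rfl, rfl⟩ <;> tauto
  have ht0 : t ≠ 0 := by rcases htb with ⟨rfl, rfl⟩ | ⟨rfl, rfl⟩ <;> tauto
  have hbN : b ∈ insert g N := by rcases htb with ⟨rfl, rfl⟩ | ⟨rfl, rfl⟩ <;> simp [hα]
  have htN : t ∈ insert g N := by rcases htb with ⟨rfl, rfl⟩ | ⟨rfl, rfl⟩ <;> simp [hα]
  have htX : t ∉ X := by
    rcases htb with ⟨rfl, rfl⟩ | ⟨rfl, rfl⟩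
    · exact fun h => hgα (hleaf h).1
    · exact hgX
  -- an old node other than `α` is neither `b` nor `t`
  have hold : ∀ u, u ∉ N ∨ u ≠ α → u ≠ g → u ≠ b ∧ u ≠ t := by
    intro u h1 h2
    rcases htb with ⟨rfl, rfl⟩ | ⟨rfl, rfl⟩ <;> refine ⟨?_, ?_⟩ <;> rintro rfl <;> tauto
  have hold' : ∀ u ∈ N, par u ≠ α → par u ≠ b ∧ par u ≠ t := fun u hu h =>
    hold _ (Or.inr h) (T.par_notMem_of_notMem hg hg0 hu)
  have hlt : lab' t = 1 ∨ lab' t = 2 := by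
    rcases htb with ⟨rfl, rfl⟩ | ⟨rfl, rfl⟩
    · rw [hlab t hα]; exact T.lab_node t hα htX
    · rcases hlg with ⟨h1, h2⟩ | h1
      · rw [h1]; exact T.lab_node _ hα h2
      · exact h1.2.2
  have hlb : b ∉ X → lab' b = 1 ∨ lab' b = 2 := by
    intro hbX
    rcases htb with ⟨rfl, rfl⟩ | ⟨rfl, rfl⟩
    · rcases hlg with ⟨h1, h2⟩ | h1
      · rw [h1]; exact T.lab_node _ hα h2
      · exact absurd h1.2.1 hgα.symm
    · rw [hlab b hα]; exact T.lab_node b hα hbX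
  -- the five kinds of nodes
  have cls : ∀ u ∈ insert g N, u = b ∨ u = t ∨
      (u ∈ N ∧ u ≠ b ∧ u ≠ t ∧ par u = α ∧ Λ u ⊆ S ∧ par' u = b) ∨
      (u ∈ N ∧ u ≠ b ∧ u ≠ t ∧ par u = α ∧ Disjoint (Λ u) S ∧ par' u = t) ∨
      (u ∈ N ∧ u ≠ b ∧ u ≠ t ∧ u ≠ α ∧ par u ≠ α ∧ par' u = par u) := by
    intro u hu
    by_cases h1 : u = b
    · exact Or.inl h1
    by_cases h2 : u = t
    · exact Or.inr (Or.inl h2)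
    have h3 : u ≠ α ∧ u ≠ g := by
      rcases htb with ⟨ht, hb⟩ | ⟨ht, hb⟩
      · exact ⟨ht ▸ h2, hb ▸ h1⟩
      · exact ⟨hb ▸ h1, ht ▸ h2⟩
    have huN := Finset.mem_of_mem_insert_of_ne hu h3.2
    by_cases h4 : par u = α
    · rcases hD u huN h4 with h5 | h5
      · exact Or.inr (Or.inr (Or.inl ⟨huN, h1, h2, h4, h5⟩))
      · exact Or.inr (Or.inr (Or.inr (Or.inl ⟨huN, h1, h2, h4, h5⟩)))
    · exact Or.inr (Or.inr (Or.inr (Or.inr ⟨huN, h1, h2, h3.1, h4, hpo u huN h3.1 h4⟩)))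
  have hlbS : S ≠ Λ α → lab' b = lab α ∧ lab' t = lab α := by
    intro hne
    have h1 : lab' g = lab α := by
      rcases hlg with h | h
      · exact h.1
      · exact absurd h.1 hne
    rcases htb with ⟨rfl, rfl⟩ | ⟨rfl, rfl⟩
    · exact ⟨h1, hlab _ hα⟩
    · exact ⟨hlab _ hα, h1⟩
  have hlbD : α ∉ X → lab' b = lab α := by
    intro hαX
    rcases htb with ⟨rfl, rfl⟩ | ⟨rfl, rfl⟩
    · rcases hlg with h | h
      · exact h.1
      · exact absurd h.2.1.symm hgα
    · exact hlab _ hα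
  have hΛpar : ∀ u ∈ N, par u = α → Λ u ⊆ Λ α := fun u hu h =>
    h ▸ T.par_sub u hu (h ▸ hα0)
  have hpar_t : par α ≠ b ∧ par α ≠ t := hold' α hα hαα
  refine
    { zero := by simp [T.zero, hg0.symm]
      par_zero := hp0
      leaf_mem := T.leaf_mem.trans (Finset.subset_insert _ _)
      leaf := ?_, lab_leaf := ?_, lab_node := ?_, sub := ?_, nonempty := ?_, par_mem := ?_,
      par_leaf := ?_, par_sub := ?_, root := ?_, child := ?_, sib := ?_ }
  · intro v hv
    have hvt : v ≠ t := fun h => htX (h ▸ hv)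
    have hvg : v ≠ g := fun h => hgX (h ▸ hv)
    by_cases hvα : v = α
    · subst hvα
      obtain ⟨rfl, rfl⟩ := hleaf hv
      simpa using T.leaf _ hv
    · have := hold v (Or.inr hvα) hvg
      simp [this, T.leaf v hv]
  · intro v hv
    rw [hlab v (T.leaf_mem hv)]; exact T.lab_leaf v hv
  · intro u hu huX
    rcases cls u hu with rfl | rfl | h | h | h
    · exact hlb huX
    · exact hlt
    all_goals rw [hlab u h.1]; exact T.lab_node u h.1 huX
  · intro u hu
    rcases cls u hu with rfl | rfl | h | h | h
    · simpa using hS.trans (T.sub α hα)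
    · simpa [hbt.symm] using T.sub α hα
    all_goals simpa [h.2.1, h.2.2.1] using T.sub u h.1
  · intro u hu
    rcases cls u hu with rfl | rfl | h | h | h
    · simpa using hSne
    · simpa [hbt.symm] using T.nonempty α hα
    all_goals simpa [h.2.1, h.2.2.1] using T.nonempty u h.1
  · intro u hu h0
    rcases cls u hu with rfl | rfl | h | h | h
    · rw [hpb]; exact htN
    · rw [hpt] at h0 ⊢; exact Finset.mem_insert_of_mem (T.par_mem α hα h0)
    · rw [h.2.2.2.2.2]; exact hbN
    · rw [h.2.2.2.2.2]; exact htN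
    · rw [h.2.2.2.2.2] at h0 ⊢; exact Finset.mem_insert_of_mem (T.par_mem u h.1 h0)
  · intro u hu
    rcases cls u hu with rfl | rfl | h | h | h
    · rw [hpb]; exact htX
    · rw [hpt]; exact T.par_leaf α hα
    · rw [h.2.2.2.2.2]; intro hbX
      have hαX := T.notMem_of_par h.1 h.2.2.2.1
      rcases htb with ⟨rfl, rfl⟩ | ⟨rfl, rfl⟩
      · exact hgX hbX
      · exact hαX hbX
    · rw [h.2.2.2.2.2]; exact htX
    · rw [h.2.2.2.2.2]; exact T.par_leaf u h.1
  · intro u hu h0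
    rcases cls u hu with rfl | rfl | h | h | h
    · simpa [hpb, hbt.symm] using hS
    · rw [hpt] at h0 ⊢
      simpa [hbt.symm, hpar_t] using T.par_sub α hα h0
    · simpa [h.2.2.2.2.2, h.2.1, h.2.2.1] using h.2.2.2.2.1
    · simpa [h.2.2.2.2.2, h.2.1, h.2.2.1, hbt.symm] using hΛpar u h.1 h.2.2.2.1
    · have h' := hold' u h.1 h.2.2.2.2.1
      rw [h.2.2.2.2.2] at h0 ⊢
      simpa [h.2.1, h.2.2.1, h'] using T.par_sub u h.1 h0
  · intro u hu h0
    rcases cls u hu with rfl | rfl | h | h | h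
    · exact absurd (hpb ▸ h0) ht0
    · simpa [hbt.symm] using T.root α hα (hpt ▸ h0)
    · exact absurd (h.2.2.2.2.2 ▸ h0) hb0
    · exact absurd (h.2.2.2.2.2 ▸ h0) ht0
    · simpa [h.2.1, h.2.2.1] using T.root u h.1 (h.2.2.2.2.2 ▸ h0)
  · intro p hp hpX v hv
    -- an old child, under its new parent
    have old : ∀ u ∈ N, u ≠ α → v ∈ Λ u → ∀ p, par' u = p → ∃ u ∈ insert g N, par' u = p ∧
        v ∈ (if u = b then S else if u = t then Λ α else Λ u) := by
      intro u hu huα hv p hpu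
      have := hold u (Or.inr huα) (fun h => hg (h ▸ hu))
      exact ⟨u, Finset.mem_insert_of_mem hu, hpu, by simpa [this] using hv⟩
    have self : ∀ u, par u = α → u ≠ α := by rintro u h rfl; exact hαα h
    rcases cls p hp with rfl | rfl | h | h | h
    · simp only [if_true] at hv
      have hαX : α ∉ X := fun h => hpX (by rw [(hleaf h).1]; exact h)
      obtain ⟨u, hu, hpu, hvu⟩ := T.child α hα hαX v (hS hv)
      rcases hD u hu hpu with h | h
      · exact old u hu (self u hpu) hvu _ h.2
      · exact absurd hv (Finset.disjoint_left.1 h.1 hvu)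
    · simp only [hbt.symm, if_false, if_true] at hv
      by_cases hvS : v ∈ S
      · exact ⟨b, hbN, hpb, by simpa using hvS⟩
      · have hαX : α ∉ X := fun h => hvS ((hleaf h).2 ▸ hv)
        obtain ⟨u, hu, hpu, hvu⟩ := T.child α hα hαX v hv
        rcases hD u hu hpu with h | h
        · exact absurd (h.1 hvu) hvS
        · exact old u hu (self u hpu) hvu _ h.2
    all_goals
      simp only [h.2.1, h.2.2.1, if_false] at hv
      obtain ⟨u, hu, hpu, hvu⟩ := T.child p h.1 hpX v hv
      have hpα : p ≠ α := by
        rcases htb with ⟨ht, -⟩ | ⟨-, hb⟩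
        · exact ht ▸ h.2.2.1
        · exact hb ▸ h.2.1
      by_cases huα : u = α
      · exact ⟨t, htN, by rw [hpt, ← hpu, huα], by simpa [hbt.symm] using huα ▸ hvu⟩
      · exact old u hu huα hvu p ((hpo u hu huα (hpu ▸ hpα)).trans hpu)
  · -- the two siblings are compared in all combinations that can occur, up to symmetry
    have bU : ∀ u ∈ N, par u = α → Disjoint (Λ u) S → ∀ v ∈ S, ∀ v' ∈ Λ u,
        v ≠ v' ∧ (H.Adj v v' ↔ lab' t = 2) := by
      intro u hu hpu hd v hv v' hv'
      have hαX := T.notMem_of_par hu hpu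
      obtain ⟨w, hw, hpw, hvw⟩ := T.child α hα hαX v (hS hv)
      have hne : w ≠ u := by rintro rfl; exact Finset.disjoint_left.1 hd hvw hv
      have hSne : S ≠ Λ α := fun h =>
        Finset.disjoint_left.1 hd hv' (h ▸ hΛpar u hu hpu hv')
      have := T.sib w hw u hu hne (hpw.trans hpu.symm) v hvw v' hv'
      rwa [hpw, ← (hlbS hSne).2] at this
    have tO : ∀ u ∈ N, u ≠ α → par u = par α → ∀ v ∈ Λ α, ∀ v' ∈ Λ u,
        v ≠ v' ∧ (H.Adj v v' ↔ lab' (par α) = 2) := by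
      intro u hu hne hpu v hv v' hv'
      have h0 : par α ≠ 0 := by
        intro h0
        have h1 := T.root α hα h0
        have h2 := T.root u hu (hpu.trans h0)
        rw [h2, ← h1] at hv'
        exact (T.sib α hα u hu hne.symm hpu.symm v' hv' v' (by rw [h2, ← h1]; exact hv')).1 rfl
      have := T.sib α hα u hu hne.symm hpu.symm v hv v' hv'
      rwa [← hlab _ (T.par_mem α hα h0)] at this
    have symm' : ∀ {a b l : ℕ}, (a ≠ b ∧ (H.Adj a b ↔ l = 2)) → (b ≠ a ∧ (H.Adj b a ↔ l = 2)) :=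
      fun h => ⟨h.1.symm, by rw [H.adj_comm]; exact h.2⟩
    intro u hu u' hu' hne hpp v hv v' hv'
    rcases cls u hu with rfl | rfl | h | h | h <;> rcases cls u' hu' with rfl | rfl | h' | h' | h'
    · exact absurd rfl hne
    · exact absurd (hpt.symm.trans (hpp.symm.trans hpb)) hpar_t.2
    · exact absurd (h'.2.2.2.2.2.symm.trans (hpp.symm.trans hpb)) hbt
    · simp only [if_true, h'.2.1, h'.2.2.1, if_false] at hv hv'
      rw [hpb]; exact bU u' h'.1 h'.2.2.2.1 h'.2.2.2.2.1 v hv v' hv'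
    · exact absurd (h'.2.2.2.2.2.symm.trans (hpp.symm.trans hpb)) (hold' u' h'.1 h'.2.2.2.2.1).2
    · exact absurd (hpt.symm.trans (hpp.trans hpb)) hpar_t.2
    · exact absurd rfl hne
    · exact absurd (hpt.symm.trans (hpp.trans h'.2.2.2.2.2)) hpar_t.1
    · exact absurd (hpt.symm.trans (hpp.trans h'.2.2.2.2.2)) hpar_t.2
    · simp only [if_true, hbt.symm, h'.2.1, h'.2.2.1, if_false] at hv hv'
      rw [hpt]
      exact tO u' h'.1 h'.2.2.2.1 (h'.2.2.2.2.2.symm.trans (hpp.symm.trans hpt)) v hv v' hv'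
    · exact absurd (h.2.2.2.2.2.symm.trans (hpp.trans hpb)) hbt
    · exact absurd (hpt.symm.trans (hpp.symm.trans h.2.2.2.2.2)) hpar_t.1
    · simp only [h.2.1, h.2.2.1, h'.2.1, h'.2.2.1, if_false] at hv hv'
      have := T.sib u h.1 u' h'.1 hne (h.2.2.2.1.trans h'.2.2.2.1.symm) v hv v' hv'
      rw [h.2.2.2.2.2, hlbD (T.notMem_of_par h.1 h.2.2.2.1)]
      rwa [h.2.2.2.1] at this
    · exact absurd (h.2.2.2.2.2.symm.trans (hpp.trans h'.2.2.2.2.2)) hbt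
    · exact absurd (h'.2.2.2.2.2.symm.trans (hpp.symm.trans h.2.2.2.2.2))
        (hold' u' h'.1 h'.2.2.2.2.1).1
    · simp only [if_true, h.2.1, h.2.2.1, if_false] at hv hv'
      rw [hpp, hpb]; exact symm' (bU u h.1 h.2.2.2.1 h.2.2.2.2.1 v' hv' v hv)
    · exact absurd (hpt.symm.trans (hpp.symm.trans h.2.2.2.2.2)) hpar_t.2
    · exact absurd (h'.2.2.2.2.2.symm.trans (hpp.symm.trans h.2.2.2.2.2)) hbt
    · simp only [h.2.1, h.2.2.1, h'.2.1, h'.2.2.1, if_false] at hv hv'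
      have := T.sib u h.1 u' h'.1 hne (h.2.2.2.1.trans h'.2.2.2.1.symm) v hv v' hv'
      have hSne : S ≠ Λ α := fun h'' =>
        Finset.disjoint_left.1 h.2.2.2.2.1 hv (h'' ▸ hΛpar u h.1 h.2.2.2.1 hv)
      rw [h.2.2.2.2.2, (hlbS hSne).2]
      rwa [h.2.2.2.1] at this
    · exact absurd (h'.2.2.2.2.2.symm.trans (hpp.symm.trans h.2.2.2.2.2))
        (hold' u' h'.1 h'.2.2.2.2.1).2
    · exact absurd (h.2.2.2.2.2.symm.trans (hpp.trans hpb)) (hold' u h.1 h.2.2.2.2.1).2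
    · simp only [if_true, hbt.symm, h.2.1, h.2.2.1, if_false] at hv hv'
      rw [hpp, hpt]
      exact symm' (tO u h.1 h.2.2.2.1 (h.2.2.2.2.2.symm.trans (hpp.trans hpt)) v' hv' v hv)
    · exact absurd (h.2.2.2.2.2.symm.trans (hpp.trans h'.2.2.2.2.2)) (hold' u h.1 h.2.2.2.2.1).1
    · exact absurd (h.2.2.2.2.2.symm.trans (hpp.trans h'.2.2.2.2.2)) (hold' u h.1 h.2.2.2.2.1).2
    · simp only [h.2.1, h.2.2.1, h'.2.1, h'.2.2.1, if_false] at hv hv'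
      have := T.sib u h.1 u' h'.1 hne (h.2.2.2.2.2.symm.trans (hpp.trans h'.2.2.2.2.2)) v hv v' hv'
      have h0 : par u ≠ 0 := by
        intro h0
        have h1 := T.root u h.1 h0
        have h2 := T.root u' h'.1 (h'.2.2.2.2.2.symm.trans (hpp.symm.trans (h.2.2.2.2.2.trans h0)))
        exact (T.sib u h.1 u' h'.1 hne (h.2.2.2.2.2.symm.trans (hpp.trans h'.2.2.2.2.2)) v hv v
          (by rw [h2, ← h1]; exact hv)).1 rfl
      rw [h.2.2.2.2.2, hlab _ (T.par_mem u h.1 h0)]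
      exact this

open Classical in
/-- The new leaf `x` becomes a child of the inner node `c`. The predicate `P` holds for the nodes
from `c` to the root. -/
lemma attach (T : Cotree H X N Λ par lab) {c : ℕ} {par' lab' : ℕ → ℕ} (P : ℕ → Prop)
    (hx : x ∉ N) (hx0 : x ≠ 0) (hc : c ∈ N) (hcX : c ∉ X) (hPc : P c)
    (hPup : ∀ u ∈ N, P u → par u ≠ 0 → P (par u))
    (hPdn : ∀ p ∈ N, P p → p ≠ c → ∃ u ∈ N, par u = p ∧ P u)
    (hPch : ∀ u ∈ N, par u = c → ¬ P u)
    (hPsub : ∀ u ∈ N, P u → Λ c ⊆ Λ u) (hProot : ∀ u ∈ N, par u = 0 → P u)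
    (htw : ∀ v ∈ Λ c, H.Adj x v ↔ lab c = 2)
    (htw' : ∀ w ∈ Λ c, ∀ v ∈ X, v ∉ Λ c → (H.Adj x v ↔ H.Adj w v))
    (hpx : par' x = c) (hpo : ∀ u ∈ N, par' u = par u) (hp0 : par' 0 = 0)
    (hlx : lab' x = 0) (hlo : ∀ u ∈ N, lab' u = lab u) :
    Cotree H (insert x X) (insert x N)
      (fun u => if u = x then {x} else if P u then insert x (Λ u) else Λ u) par' lab' := by
  have hxX : x ∉ X := fun h => hx (T.leaf_mem h)
  have hne : ∀ u ∈ N, u ≠ x := by rintro u hu rfl; exact hx hu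
  have hc0 : c ≠ 0 := fun h => T.zero (h ▸ hc)
  have hPX : ∀ u ∈ N, P u → u ∉ X := by
    intro u hu hPu huX
    obtain ⟨w, hw, hpw, -⟩ | rfl := (Classical.em (u = c)).symm.imp (hPdn u hu hPu) id
    · exact T.par_leaf w hw (hpw ▸ huX)
    · exact hcX huX
  have hxΛ : ∀ u ∈ N, x ∉ Λ u := fun u hu h => hxX (T.sub u hu h)
  have hmono : ∀ u ∈ N, ∀ v ∈ Λ u, v ∈ (if u = x then {x} else if P u then insert x (Λ u) else Λ u) := by
    intro u hu v hv
    rw [if_neg (hne u hu)]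
    split_ifs
    · exact Finset.mem_insert_of_mem hv
    · exact hv
  refine
    { zero := by simp [T.zero, hx0.symm]
      par_zero := hp0
      leaf_mem := Finset.insert_subset_insert _ T.leaf_mem
      leaf := ?_, lab_leaf := ?_, lab_node := ?_, sub := ?_, nonempty := ?_, par_mem := ?_,
      par_leaf := ?_, par_sub := ?_, root := ?_, child := ?_, sib := ?_ }
  · intro v hv
    rcases Finset.mem_insert.1 hv with rfl | hv
    · simp
    · have hvN := T.leaf_mem hv
      have : ¬ P v := fun h => hPX v hvN h hv
      simp [hne v hvN, this, T.leaf v hv]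
  · intro v hv
    rcases Finset.mem_insert.1 hv with rfl | hv
    · exact hlx
    · rw [hlo v (T.leaf_mem hv)]; exact T.lab_leaf v hv
  · intro u hu huX
    rw [Finset.mem_insert, not_or] at huX
    have huN := Finset.mem_of_mem_insert_of_ne hu huX.1
    rw [hlo u huN]; exact T.lab_node u huN huX.2
  · intro u hu
    rcases Finset.mem_insert.1 hu with rfl | hu
    · simp
    · have := T.sub u hu
      rw [if_neg (hne u hu)]
      split_ifs
      · exact Finset.insert_subset_insert _ this
      · exact this.trans (Finset.subset_insert _ _)
  · intro u hu
    rcases Finset.mem_insert.1 hu with rfl | hu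
    · simp
    · obtain ⟨v, hv⟩ := T.nonempty u hu
      exact ⟨v, hmono u hu v hv⟩
  · intro u hu h0
    rcases Finset.mem_insert.1 hu with rfl | hu
    · rw [hpx]; exact Finset.mem_insert_of_mem hc
    · rw [hpo u hu] at h0 ⊢; exact Finset.mem_insert_of_mem (T.par_mem u hu h0)
  · intro u hu
    rcases Finset.mem_insert.1 hu with rfl | hu
    · rw [hpx, Finset.mem_insert, not_or]; exact ⟨hne c hc, hcX⟩
    · rw [hpo u hu, Finset.mem_insert, not_or]
      refine ⟨fun h => ?_, T.par_leaf u hu⟩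
      exact T.par_notMem_of_notMem hx hx0 hu h
  · intro u hu h0
    rcases Finset.mem_insert.1 hu with rfl | hu
    · simp [hpx, hne c hc, hPc]
    · rw [hpo u hu] at h0 ⊢
      have hsub := T.par_sub u hu h0
      rw [if_neg (hne u hu), if_neg (hne _ (T.par_mem u hu h0))]
      by_cases hP : P u
      · rw [if_pos hP, if_pos (hPup u hu hP h0)]
        exact Finset.insert_subset_insert _ hsub
      · rw [if_neg hP]
        split_ifs
        · exact hsub.trans (Finset.subset_insert _ _)
        · exact hsub
  · intro u hu h0
    rcases Finset.mem_insert.1 hu with rfl | hu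
    · exact absurd (hpx ▸ h0) hc0
    · rw [hpo u hu] at h0
      rw [if_neg (hne u hu), if_pos (hProot u hu h0), T.root u hu h0]
  · intro p hp hpX v hv
    rw [Finset.mem_insert, not_or] at hpX
    have hpN := Finset.mem_of_mem_insert_of_ne hp hpX.1
    have old : v ∈ Λ p → ∃ u ∈ insert x N, par' u = p ∧
        v ∈ (if u = x then {x} else if P u then insert x (Λ u) else Λ u) := by
      intro hv
      obtain ⟨u, hu, hpu, hvu⟩ := T.child p hpN hpX.2 v hv
      exact ⟨u, Finset.mem_insert_of_mem hu, (hpo u hu).trans hpu, hmono u hu v hvu⟩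
    simp only [if_neg hpX.1] at hv
    split_ifs at hv with hP
    · rcases Finset.mem_insert.1 hv with rfl | hv
      · by_cases hpc : p = c
        · exact ⟨v, Finset.mem_insert_self _ _, by rw [hpx, hpc], by simp⟩
        · obtain ⟨u, hu, hpu, hPu⟩ := hPdn p hpN hP hpc
          exact ⟨u, Finset.mem_insert_of_mem hu, (hpo u hu).trans hpu, by simp [hne u hu, hPu]⟩
      · exact old hv
    · exact old hv
  · -- a new vertex on one side sees what the leaves below `c` see
    have key : ∀ u ∈ N, P u → ∀ u' ∈ N, u ≠ u' → par u = par u' → ∀ v' ∈ Λ u',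
        x ≠ v' ∧ (H.Adj x v' ↔ lab (par u) = 2) := by
      intro u hu hP u' hu' hne' hpp v' hv'
      obtain ⟨w, hw⟩ := T.nonempty c hc
      have hwu := hPsub u hu hP hw
      have h1 := T.sib u hu u' hu' hne' hpp w hwu v' hv'
      have hv'c : v' ∉ Λ c := fun h =>
        (T.sib u hu u' hu' hne' hpp v' (hPsub u hu hP h) v' hv').1 rfl
      refine ⟨?_, (htw' w hw v' (T.sub u' hu' hv') hv'c).trans h1.2⟩
      rintro rfl; exact hxΛ u' hu' hv'
    have hroot : ∀ u ∈ N, ∀ u' ∈ N, u ≠ u' → par u = par u' → par u ≠ 0 := by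
      intro u hu u' hu' hne' hpp h0
      obtain ⟨v, hv⟩ := T.nonempty u hu
      exact (T.sib u hu u' hu' hne' hpp v hv v
        (by rw [T.root u' hu' (hpp ▸ h0), ← T.root u hu h0]; exact hv)).1 rfl
    have cx : ∀ u' ∈ N, par u' = c → ∀ v' ∈ (if u' = x then {x} else if P u' then
        insert x (Λ u') else Λ u'), x ≠ v' ∧ (H.Adj x v' ↔ lab' c = 2) := by
      intro u' hu' hpu' v' hv'
      have hsub := T.par_sub u' hu' (hpu' ▸ hc0)
      rw [hpu'] at hsub
      rw [if_neg (hne u' hu'), if_neg (hPch u' hu' hpu')] at hv'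
      rw [hlo c hc]
      exact ⟨fun h => hxΛ u' hu' (h ▸ hv'), htw v' (hsub hv')⟩
    have symm' : ∀ {a b l : ℕ}, (a ≠ b ∧ (H.Adj a b ↔ l = 2)) → (b ≠ a ∧ (H.Adj b a ↔ l = 2)) :=
      fun h => ⟨h.1.symm, by rw [H.adj_comm]; exact h.2⟩
    have split : ∀ u ∈ N, ∀ v, v ∈ (if u = x then {x} else if P u then insert x (Λ u) else Λ u) →
        (v = x ∧ P u) ∨ v ∈ Λ u := by
      intro u hu v hv
      rw [if_neg (hne u hu)] at hv
      split_ifs at hv with hP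
      · rcases Finset.mem_insert.1 hv with h | h
        · exact Or.inl ⟨h, hP⟩
        · exact Or.inr h
      · exact Or.inr hv
    intro u hu u' hu' hne' hpp v hv v' hv'
    rcases Finset.mem_insert.1 hu with rfl | hu₁ <;> rcases Finset.mem_insert.1 hu' with rfl | hu₂
    · exact absurd rfl hne'
    · rw [if_pos rfl, Finset.mem_singleton] at hv
      subst hv
      rw [hpx]
      exact cx u' hu₂ (by rw [← hpo u' hu₂, ← hpp, hpx]) v' hv'
    · rw [if_pos rfl, Finset.mem_singleton] at hv'
      subst hv'
      rw [hpp, hpx]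
      exact symm' (cx u hu₁ (by rw [← hpo u hu₁, hpp, hpx]) v hv)
    · rw [hpo u hu₁, hpo u' hu₂] at hpp
      have h0 := hroot u hu₁ u' hu₂ hne' hpp
      rw [hpo u hu₁, hlo _ (T.par_mem u hu₁ h0)]
      rcases split u hu₁ v hv with ⟨rfl, hP⟩ | hv₁ <;>
        rcases split u' hu₂ v' hv' with ⟨rfl, hP'⟩ | hv₂
      · obtain ⟨w, hw⟩ := T.nonempty c hc
        exact absurd rfl (T.sib u hu₁ u' hu₂ hne' hpp w (hPsub u hu₁ hP hw) w (hPsub u' hu₂ hP' hw)).1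
      · exact key u hu₁ hP u' hu₂ hne' hpp v' hv₂
      · rw [hpp]; exact symm' (key u' hu₂ hP' u hu₁ hne'.symm hpp.symm v hv₁)
      · exact T.sib u hu₁ u' hu₂ hne' hpp v hv₁ v' hv₂

end Cotree

/-! ### Registers and arrays -/

/-!
Constants: `rN` is the number `n` of vertices, `rEnd` is `n + 1`, `rM` is the modulus `3 n + 6`,
`rZero`, `rOne` and `rTwo` are `0`, `1` and `2`. While the tree is built, `rX` is the new vertex and
`rNx` the next unused name of an inner node; `rA` is the pivot, `rLg` its label, `rD` the number of
its children on the side of `x`; `rK` children, with sum of names `rS`, and `rF` among them, move to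
the node `rG`; `rT` and `rB` are the upper and the lower node on an edge that is divided; `rC` and
`rL` are the place of `x` and the label of its parent. The queue has length `rQn`, the list of
touched nodes has length `rTn`; `rI` is the counter of the inner loops, and `rHi` is the end of the
list that is read or written. The names `rU`, `rP`, `rV`, `rW` are for temporary use, as are, in the
evaluation of the tree, those that only concern its construction.
-/

notation "rN" => (0 : ℕ)
notation "rOne" => (1 : ℕ)
notation "rM" => (2 : ℕ)
notation "rNx" => (3 : ℕ)
notation "rX" => (4 : ℕ)
notation "rI" => (5 : ℕ)
notation "rHi" => (6 : ℕ)
notation "rU" => (7 : ℕ)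
notation "rP" => (8 : ℕ)
notation "rQn" => (9 : ℕ)
notation "rTn" => (10 : ℕ)
notation "rA" => (11 : ℕ)
notation "rK" => (12 : ℕ)
notation "rS" => (13 : ℕ)
notation "rF" => (14 : ℕ)
notation "rG" => (15 : ℕ)
notation "rT" => (16 : ℕ)
notation "rB" => (17 : ℕ)
notation "rC" => (18 : ℕ)
notation "rL" => (19 : ℕ)
notation "rV" => (20 : ℕ)
notation "rW" => (21 : ℕ)
notation "rD" => (22 : ℕ)
notation "rZero" => (23 : ℕ)
notation "rTwo" => (24 : ℕ)
notation "rEnd" => (25 : ℕ)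
notation "rLg" => (26 : ℕ)

/-!
The input is in `aOff` and `aAdj`, the output in `aOut`. For a node of the cotree, `aPar` is its
parent, `aLab` its label, `aNch` the number of its children, `aSum` the sum of their names modulo
`rM`. In `aCnt` the full children of a node are counted; the count is valid in the rounds `x` in
which `aSt` holds `x`, and a flag in `aMk` is valid likewise, so that nothing has to be cleared.
The queue is `aQ`, and `aT` lists the nodes with a full child. In the evaluation, every node has a
list of vertices of length `aLen` from `aHd` to `aTl`, with successors in `aNe`, and `aIso` tells
whether there is an isolated vertex.
-/

notation "aOff" => (0 : ℕ)
notation "aAdj" => (1 : ℕ)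
notation "aOut" => (2 : ℕ)
notation "aPar" => (3 : ℕ)
notation "aLab" => (4 : ℕ)
notation "aNch" => (5 : ℕ)
notation "aSum" => (6 : ℕ)
notation "aSt" => (7 : ℕ)
notation "aCnt" => (8 : ℕ)
notation "aMk" => (9 : ℕ)
notation "aQ" => (10 : ℕ)
notation "aT" => (11 : ℕ)
notation "aLen" => (12 : ℕ)
notation "aIso" => (13 : ℕ)
notation "aHd" => (14 : ℕ)
notation "aTl" => (15 : ℕ)
notation "aNe" => (16 : ℕ)

attribute [simp] block Program.run Program.ok run_ifEq ok_ifEq run_addMod run_subMod ok_addMod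
  ok_subMod

/-! ### Enumerations and child sums -/

/-- The first `k` values of `q` enumerate `F` without repetition. -/
def Enumerates (q : ℕ → ℕ) (k : ℕ) (F : Finset ℕ) : Prop :=
  (Finset.range k).image q = F ∧ F.card = k

namespace Enumerates

variable {q : ℕ → ℕ} {k : ℕ} {F : Finset ℕ}

lemma empty (q : ℕ → ℕ) : Enumerates q 0 ∅ := by simp [Enumerates]

lemma mem (h : Enumerates q k F) {i : ℕ} (hi : i < k) : q i ∈ F :=
  h.1 ▸ Finset.mem_image_of_mem q (Finset.mem_range.2 hi)

lemma exists_of_mem (h : Enumerates q k F) {u : ℕ} (hu : u ∈ F) : ∃ i < k, q i = u := by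
  rw [← h.1] at hu; simpa using hu

lemma inj (h : Enumerates q k F) {i j : ℕ} (hi : i < k) (hj : j < k) (he : q i = q j) : i = j := by
  have : Set.InjOn q (Finset.range k) := by
    rw [← Finset.card_image_iff, h.1, h.2, Finset.card_range]
  exact this (by simpa using hi) (by simpa using hj) he

lemma notMem_image (h : Enumerates q k F) {i : ℕ} (hi : i < k) :
    q i ∉ (Finset.range i).image q := by
  intro h'
  obtain ⟨j, hj, he⟩ := Finset.mem_image.1 h'
  rw [Finset.mem_range] at hj
  have := h.inj (hj.trans hi) hi he
  omega

lemma image_subset (h : Enumerates q k F) {i : ℕ} (hi : i ≤ k) : (Finset.range i).image q ⊆ F := by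
  rw [← h.1]
  exact Finset.image_subset_image (Finset.range_subset_range.2 hi)

lemma push (h : Enumerates q k F) {v : ℕ} (hv : v ∉ F) :
    Enumerates (Function.update q k v) (k + 1) (insert v F) := by
  refine ⟨?_, by rw [Finset.card_insert_of_notMem hv, h.2]⟩
  rw [Finset.range_add_one, Finset.image_insert, Function.update_self, ← h.1]
  congr 1
  refine Finset.image_congr fun i hi => Function.update_of_ne ?_ _ _
  have : i < k := by simpa using hi
  omega

end Enumerates

lemma image_range_succ (q : ℕ → ℕ) (i : ℕ) :
    (Finset.range (i + 1)).image q = insert (q i) ((Finset.range i).image q) := by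
  rw [Finset.range_add_one, Finset.image_insert]

/-- The sum of `f` over the children of `p`. -/
def childSum {R : Type*} [AddCommGroup R] (N : Finset ℕ) (par : ℕ → ℕ) (f : ℕ → R) (p : ℕ) : R :=
  ∑ u ∈ N with par u = p, f u

/-- The arrays `nch` and `csum` hold, for every node, the number of its children and the sum
modulo `M` of their names; for this the number `0` counts as the parent of the root. -/
structure Counted (M : ℕ) (N : Finset ℕ) (par nch csum : ℕ → ℕ) : Prop where
  nch : ∀ p ∈ N, (nch p : ℤ) = childSum N par (fun _ => 1) p
  csum_lt : ∀ p, p = 0 ∨ p ∈ N → csum p < M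
  csum : ∀ p, p = 0 ∨ p ∈ N → (csum p : ZMod M) = childSum N par (fun u => (u : ZMod M)) p
  lt : ∀ u ∈ N, u < M

lemma Counted.nch_eq {M : ℕ} {N : Finset ℕ} {par nch csum : ℕ → ℕ} (h : Counted M N par nch csum)
    {p : ℕ} (hp : p ∈ N) : nch p = (N.filter fun u => par u = p).card := by
  have := h.nch p hp
  simpa [childSum] using this

lemma childSum_attach {R : Type*} [AddCommGroup R] {N : Finset ℕ} {par par' : ℕ → ℕ} (f : ℕ → R)
    {x : ℕ} (hx : x ∉ N) (hpo : ∀ u ∈ N, par' u = par u) (p : ℕ) :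
    childSum (insert x N) par' f p = childSum N par f p + if par' x = p then f x else 0 := by
  unfold childSum
  rw [Finset.sum_filter, Finset.sum_filter, Finset.sum_insert hx, add_comm]
  congr 1
  exact Finset.sum_congr rfl fun u hu => by rw [hpo u hu]

lemma childSum_split {R : Type*} [AddCommGroup R] {N A : Finset ℕ} {par par' : ℕ → ℕ} (f : ℕ → R)
    {g α : ℕ} (hg : g ∉ N) (hα : α ∈ N) (hA : A ⊆ N) (hαA : α ∉ A) (hpA : ∀ u ∈ A, par u = α)
    (hpA' : ∀ u ∈ A, par' u = g) (hpo : ∀ u ∈ N, u ∉ A → u ≠ α → par' u = par u) (p : ℕ) :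
    childSum (insert g N) par' f p = childSum N par f p + (if par' g = p then f g else 0)
      + ((if par' α = p then f α else 0) - if par α = p then f α else 0)
      + ((if g = p then ∑ u ∈ A, f u else 0) - if α = p then ∑ u ∈ A, f u else 0) := by
  unfold childSum
  rw [Finset.sum_filter, Finset.sum_filter, Finset.sum_insert hg]
  have key : ∑ u ∈ N, (if par' u = p then f u else 0) = ∑ u ∈ N, ((if par u = p then f u else 0)
      + (if u = α then (if par' α = p then f α else 0) - if par α = p then f α else 0 else 0)
      + (if u ∈ A then (if g = p then f u else 0) - if α = p then f u else 0 else 0)) := by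
    refine Finset.sum_congr rfl fun u hu => ?_
    by_cases h1 : u = α
    · subst h1; simp [hαA]
    · by_cases h2 : u ∈ A
      · simp [h1, h2, hpA u h2, hpA' u h2]
      · simp [h1, h2, hpo u hu h2 h1]
  rw [key, Finset.sum_add_distrib, Finset.sum_add_distrib, Finset.sum_ite_eq' N α, if_pos hα]
  have h2 : ∑ u ∈ N, (if u ∈ A then (if g = p then f u else 0) - if α = p then f u else 0 else 0)
      = (if g = p then ∑ u ∈ A, f u else 0) - if α = p then ∑ u ∈ A, f u else 0 := by
    rw [← Finset.sum_filter, Finset.filter_mem_eq_inter, Finset.inter_eq_right.2 hA,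
      Finset.sum_sub_distrib]
    split_ifs <;> simp
  rw [h2]
  abel

/-! ### Reading an adjacency list -/

/-- The earlier neighbours of the leaf `x` are written into the queue. -/
def gatherBody : Program :=
  block [.load rU aAdj rI, .add rU rU rOne,
    .ifLt rU rX (block [.store aQ rQn rU, .add rQn rQn rOne]) .skip, .add rI rI rOne]

/-- The part of the adjacency list from `rI` to `rHi` is read, one entry per round. -/
def gather : Program := .whileLt rI rHi gatherBody

lemma runs_gather {B lo hi x : ℕ} {s : Memory} (hI : s.reg rI = lo) (hHi : s.reg rHi = hi)
    (hX : s.reg rX = x) (hQ : s.reg rQn = 0) (hOne : s.reg rOne = 1) (hle : lo ≤ hi)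
    (hB : hi + 1 ≤ B) (hadj : ∀ i, lo ≤ i → i < hi → s.arr aAdj i + 1 ≤ B)
    (hinj : ∀ i j, lo ≤ i → i < hi → lo ≤ j → j < hi → s.arr aAdj i = s.arr aAdj j → i = j) :
    Runs B gather s (7 * (hi - lo) + 1) fun s' => s'.reg rQn ≤ hi - lo ∧
      Enumerates (s'.arr aQ) (s'.reg rQn)
        (((Finset.Ico lo hi).image fun i => s.arr aAdj i + 1).filter (· < x)) := by
  refine (Runs.for (I := fun i s' => s'.reg rI = i ∧ lo ≤ i ∧ i ≤ hi ∧ s'.reg rQn ≤ i - lo ∧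
      Enumerates (s'.arr aQ) (s'.reg rQn)
        (((Finset.Ico lo i).image fun i => s.arr aAdj i + 1).filter (· < x))) hi lo rfl ?_
      ⟨hI, le_rfl, hle, by omega, by simpa [hQ] using Enumerates.empty _⟩ le_rfl).mono
      (by simp [gatherBody, Program.cost]) ?_
  · rintro i s' ha ⟨hi', h1, h2, h3, h4⟩ hlt
    have eHi : s'.reg rHi = hi := (ha.1 rHi (by decide)).trans hHi
    have eX : s'.reg rX = x := (ha.1 rX (by decide)).trans hX
    have eOne : s'.reg rOne = 1 := (ha.1 rOne (by decide)).trans hOne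
    have eAdj : s'.arr aAdj = s.arr aAdj := ha.2 aAdj (by decide)
    rw [hi', eHi] at hlt
    have hB' := hadj i h1 hlt
    have hins : Finset.Ico lo (i + 1) = insert i (Finset.Ico lo i) := by
      ext j; simp only [Finset.mem_insert, Finset.mem_Ico]; omega
    have hnot : s.arr aAdj i + 1 ∉
        ((Finset.Ico lo i).image fun i => s.arr aAdj i + 1).filter (· < x) := by
      intro h
      obtain ⟨j, hj, he⟩ := Finset.mem_image.1 (Finset.mem_filter.1 h).1
      rw [Finset.mem_Ico] at hj
      have := hinj j i hj.1 (by omega) h1 hlt (by omega)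
      omega
    refine ⟨hlt, ?_, ?_⟩
    · simp [gatherBody, hi', eX, eOne, eAdj, hB']
      split_ifs <;> simp [hi', eOne] <;> omega
    · rw [hins, Finset.image_insert]
      by_cases hx : s.arr aAdj i + 1 < x
      · rw [Finset.filter_insert, if_pos hx]
        simp [gatherBody, hi', eX, eOne, eAdj, hx]
        exact ⟨by omega, by omega, by omega, h4.push hnot⟩
      · rw [Finset.filter_insert, if_neg hx]
        simp [gatherBody, hi', eX, eOne, eAdj, hx]
        exact ⟨by omega, by omega, by omega, h4⟩
  · rintro s' ha ⟨hge, i, hi', h1, h2, h3, h4⟩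
    rw [hi', ha.1 rHi (by decide), hHi] at hge
    obtain rfl : i = hi := by omega
    exact ⟨h3, h4⟩

/-! ### Marking the nodes all of whose leaves are chosen -/

/-- The children of `p` that belong to `D`. -/
def childrenIn (par : ℕ → ℕ) (D : Finset ℕ) (p : ℕ) : Finset ℕ := D.filter fun u => par u = p

/-- The nodes all of whose leaves belong to `F`. -/
def fullNodes (N : Finset ℕ) (Λ : ℕ → Finset ℕ) (F : Finset ℕ) : Finset ℕ :=
  N.filter fun u => Λ u ⊆ F

section

variable {H : SimpleGraph ℕ} {X N F D : Finset ℕ} {Λ : ℕ → Finset ℕ} {par lab : ℕ → ℕ}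

lemma mem_fullNodes {u : ℕ} : u ∈ fullNodes N Λ F ↔ u ∈ N ∧ Λ u ⊆ F := Finset.mem_filter

lemma mem_childrenIn {u p : ℕ} : u ∈ childrenIn par D p ↔ u ∈ D ∧ par u = p := Finset.mem_filter

lemma childrenIn_insert {u p : ℕ} (hu : u ∉ D) :
    (childrenIn par (insert u D) p).card = (childrenIn par D p).card + if par u = p then 1 else 0 := by
  unfold childrenIn
  rw [Finset.filter_insert]
  split_ifs
  · rw [Finset.card_insert_of_notMem fun h => hu (Finset.mem_filter.1 h).1]
  · rfl

lemma Cotree.subset_of_children (T : Cotree H X N Λ par lab) {p : ℕ} (hp : p ∈ N) (hpX : p ∉ X)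
    {S : Finset ℕ} (h : ∀ u ∈ N, par u = p → Λ u ⊆ S) : Λ p ⊆ S := by
  intro v hv
  obtain ⟨u, hu, hpu, hvu⟩ := T.child p hp hpX v hv
  exact h u hu hpu hvu

/-- At most as many inner nodes are full as leaves, since each has two children, which are full. -/
lemma Cotree.card_fullNodes_le (T : Cotree H X N Λ par lab)
    (h2 : ∀ p ∈ N, p ∉ X → 2 ≤ (childrenIn par N p).card) :
    (fullNodes N Λ F).card ≤ 2 * F.card := by
  set A := fullNodes N Λ F with hA
  have h3 : (A.filter (· ∈ X)).card ≤ F.card := by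
    refine Finset.card_le_card fun v hv => ?_
    obtain ⟨hv, hvX⟩ := Finset.mem_filter.1 hv
    have := (mem_fullNodes.1 hv).2
    rw [T.leaf v hvX] at this
    exact Finset.singleton_subset_iff.1 this
  have h4 : (A.filter (· ∈ X)).card + (A.filter (· ∉ X)).card = A.card :=
    Finset.card_filter_add_card_filter_not _
  have h5 : (A.filter (· ∉ X)).card * 2 ≤ A.card := by
    have hsub : ∀ p ∈ A.filter (· ∉ X), 2 ≤ (A.filter fun u => par u = p).card := by
      intro p hp
      obtain ⟨hp, hpX⟩ := Finset.mem_filter.1 hp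
      obtain ⟨hpN, hpF⟩ := mem_fullNodes.1 hp
      refine (h2 p hpN hpX).trans (Finset.card_le_card fun u hu => ?_)
      obtain ⟨huN, rfl⟩ := mem_childrenIn.1 hu
      have h0 : par u ≠ 0 := fun h0 => T.zero (h0 ▸ hpN)
      exact Finset.mem_filter.2 ⟨mem_fullNodes.2 ⟨huN, (T.par_sub u huN h0).trans hpF⟩, rfl⟩
    calc (A.filter (· ∉ X)).card * 2 = ∑ p ∈ A.filter (· ∉ X), 2 := by simp
      _ ≤ ∑ p ∈ A.filter (· ∉ X), (A.filter fun u => par u = p).card := Finset.sum_le_sum hsub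
      _ = ((A.filter (· ∉ X)).biUnion fun p => A.filter fun u => par u = p).card := by
        refine (Finset.card_biUnion fun p _ p' _ hne => ?_).symm
        rw [Function.onFun, Finset.disjoint_left]
        intro u hu hu'
        exact hne ((Finset.mem_filter.1 hu).2.symm.trans (Finset.mem_filter.1 hu').2)
      _ ≤ A.card := Finset.card_le_card (by
        intro u hu
        obtain ⟨p, -, hu⟩ := Finset.mem_biUnion.1 hu
        exact (Finset.mem_filter.1 hu).1)
  omega

end

/-- Every node in the queue counts for its parent; a node for which all children have been counted
enters the queue. Array `aSt` tells in which round a node was counted for last. -/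
def markBody : Program :=
  block [.load rU aQ rI, .load rP aPar rU, .load rV aSt rP,
    .ifLt rV rX
      (block [.store aSt rP rX, .copy rV rOne, .store aT rTn rP, .add rTn rTn rOne])
      (block [.load rV aCnt rP, .add rV rV rOne]),
    .store aCnt rP rV, .load rW aNch rP,
    ifEq rV rW (block [.store aQ rQn rP, .add rQn rQn rOne]) .skip, .add rI rI rOne]

/-- The queue is worked off, while new nodes enter it; at the end it consists of all full nodes. -/
def mark : Program := .whileLt rI rQn markBody

/-- What holds after `D` has been counted, where `D` are the first `i` nodes in the queue. -/
structure Marked (X N : Finset ℕ) (par : ℕ → ℕ) (x : ℕ) (s : Memory) (D Fq : Finset ℕ) : Prop where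
  queue : Enumerates (s.arr aQ) (s.reg rQn) Fq
  stamp_zero : ∀ p, (childrenIn par D p).card = 0 → s.arr aSt p < x
  stamp_pos : ∀ p, 0 < (childrenIn par D p).card → s.arr aSt p = x
  cnt : ∀ p, 0 < (childrenIn par D p).card → s.arr aCnt p = (childrenIn par D p).card
  touched : Enumerates (s.arr aT) (s.reg rTn) (D.image par)
  order : ∀ j < s.reg rQn, ∀ u ∈ N, par u = s.arr aQ j → ∃ j' < j, s.arr aQ j' = u

section

variable {H : SimpleGraph ℕ} {X N F : Finset ℕ} {Λ : ℕ → Finset ℕ} {par lab : ℕ → ℕ}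

/-- If all nodes that had to enter the queue have entered it and have been counted, then they are
all full nodes. -/
lemma Cotree.fullNodes_subset (T : Cotree H X N Λ par lab) {D : Finset ℕ}
    (hs : Strict N Λ par) (hF : F ⊆ D)
    (hD : ∀ p ∈ N, p ∉ X → (childrenIn par D p).card = (childrenIn par N p).card → p ∈ D)
    (hDN : D ⊆ N) : fullNodes N Λ F ⊆ D := by
  intro p
  induction h : (Λ p).card using Nat.strong_induction_on generalizing p with
  | _ m ih =>
    intro hp
    obtain ⟨hpN, hpF⟩ := mem_fullNodes.1 hp
    by_cases hpX : p ∈ X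
    · rw [T.leaf p hpX] at hpF
      exact hF (Finset.singleton_subset_iff.1 hpF)
    · refine hD p hpN hpX (congrArg Finset.card (Finset.Subset.antisymm ?_ ?_))
      · exact Finset.filter_subset_filter _ hDN
      · intro u hu
        obtain ⟨huN, rfl⟩ := mem_childrenIn.1 hu
        have h0 : par u ≠ 0 := fun h0 => T.zero (h0 ▸ hpN)
        exact mem_childrenIn.2 ⟨ih _ (h ▸ Finset.card_lt_card (hs u huN h0)) rfl
          (mem_fullNodes.2 ⟨huN, (T.par_sub u huN h0).trans hpF⟩), rfl⟩

/-- Given the vertices of `F` in the queue, marking fills the queue with all nodes that are full for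
`F`, children before parents, in time proportional to the size of `F`. -/
lemma runs_mark {B x : ℕ} {s : Memory} (T : Cotree H X N Λ (s.arr aPar) lab)
    (hs : Strict N Λ (s.arr aPar)) (hnch : ∀ p ∈ N, s.arr aNch p = (childrenIn (s.arr aPar) N p).card)
    (hnch0 : s.arr aNch 0 = 0) (h2 : ∀ p ∈ N, p ∉ X → 2 ≤ s.arr aNch p) (hFX : F ⊆ X)
    (hQ : Enumerates (s.arr aQ) (s.reg rQn) F) (hX : s.reg rX = x) (hOne : s.reg rOne = 1)
    (hI : s.reg rI = 0) (hTn : s.reg rTn = 0) (hst : ∀ p, s.arr aSt p < x)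
    (hB : 2 * F.card + 2 ≤ B) :
    Runs B mark s (40 * F.card + 1) fun s' =>
      Marked X N (s.arr aPar) x s' (fullNodes N Λ F) (fullNodes N Λ F) := by
  set par := s.arr aPar with hpar
  have hcard : (fullNodes N Λ F).card ≤ 2 * F.card :=
    T.card_fullNodes_le fun p hp hpX => hnch p hp ▸ h2 p hp hpX
  have hleaf : ∀ u ∈ X, ∀ w ∈ N, par w ≠ u := by
    rintro u hu w hw rfl; exact T.par_leaf w hw hu
  have hFfull : F ⊆ fullNodes N Λ F := fun v hv =>
    mem_fullNodes.2 ⟨T.leaf_mem (hFX hv), by rw [T.leaf v (hFX hv)]; simpa using hv⟩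
  refine (Runs.for (I := fun i s' => s'.reg rI = i ∧ i ≤ s'.reg rQn ∧
      ∃ Fq, Marked X N par x s' ((Finset.range i).image (s'.arr aQ)) Fq ∧ F ⊆ Fq ∧
        Fq ⊆ fullNodes N Λ F ∧ ∀ p ∈ N, p ∉ X → (p ∈ Fq ↔
          (childrenIn par ((Finset.range i).image (s'.arr aQ)) p).card = s.arr aNch p))
      (2 * F.card) 0 rfl ?_ ⟨hI, Nat.zero_le _, F, ⟨hQ, ?_, ?_, ?_, ?_, ?_⟩, subset_rfl, hFfull, ?_⟩
      le_rfl).mono (by simp [markBody, Program.cost, ifEq]; omega) ?_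
  · rintro i s' ha ⟨hi', hle, Fq, hM, hFq, hfull, hpush⟩ hlt
    have eX : s'.reg rX = x := (ha.1 rX (by decide)).trans hX
    have eOne : s'.reg rOne = 1 := (ha.1 rOne (by decide)).trans hOne
    have ePar : s'.arr aPar = par := ha.2 aPar (by decide)
    have eNch : s'.arr aNch = s.arr aNch := ha.2 aNch (by decide)
    rw [hi'] at hlt
    set q := s'.arr aQ with hq
    set D := (Finset.range i).image q with hD
    set u := q i with hu
    set p := par u with hp
    have huq : u ∈ Fq := hM.queue.mem hlt
    have huD : u ∉ D := hM.queue.notMem_image hlt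
    have hDq : D ⊆ Fq := hM.queue.image_subset hle
    have huN : u ∈ N := (mem_fullNodes.1 (hfull huq)).1
    have hDN : insert u D ⊆ N := by
      intro w hw
      rcases Finset.mem_insert.1 hw with rfl | hw
      · exact huN
      · exact (mem_fullNodes.1 (hfull (hDq hw))).1
    have hqn : s'.reg rQn ≤ 2 * F.card := by
      rw [← hM.queue.2]; exact (Finset.card_le_card hfull).trans hcard
    have htn : s'.reg rTn ≤ i := by
      rw [← hM.touched.2]
      exact Finset.card_image_le.trans (Finset.card_image_le.trans (by simp))
    set m := (childrenIn par D p).card with hm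
    have hmi : m ≤ i :=
      (Finset.card_filter_le _ _).trans (Finset.card_image_le.trans (by simp))
    have hm' : ∀ r, (childrenIn par (insert u D) r).card =
        (childrenIn par D r).card + if p = r then 1 else 0 := fun r => childrenIn_insert huD
    -- the counter of `p` after this round
    have hv : (if s'.arr aSt p < x then 1 else s'.arr aCnt p + 1) = m + 1 := by
      rcases Nat.eq_zero_or_pos m with h0 | h0
      · rw [if_pos (hM.stamp_zero p h0), h0]
      · rw [if_neg (by rw [hM.stamp_pos p h0]; exact lt_irrefl _), hM.cnt p h0]
    have hpD : s'.arr aSt p < x ↔ p ∉ D.image par := by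
      constructor
      · intro h h'
        obtain ⟨w, hw, hpw⟩ := Finset.mem_image.1 h'
        have := hM.stamp_pos p (Finset.card_pos.2 ⟨w, mem_childrenIn.2 ⟨hw, hpw⟩⟩)
        omega
      · intro h
        refine hM.stamp_zero p (Finset.card_eq_zero.2 (Finset.eq_empty_of_forall_notMem ?_))
        intro w hw
        obtain ⟨hw, hpw⟩ := mem_childrenIn.1 hw
        exact h (Finset.mem_image.2 ⟨w, hw, hpw⟩)
    have hrun : (markBody.run s').reg rI = i + 1 ∧
        (markBody.run s').reg rQn = (if m + 1 = s.arr aNch p then s'.reg rQn + 1 else s'.reg rQn) ∧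
        (markBody.run s').reg rTn = (if s'.arr aSt p < x then s'.reg rTn + 1 else s'.reg rTn) ∧
        (markBody.run s').arr aQ =
          (if m + 1 = s.arr aNch p then Function.update q (s'.reg rQn) p else q) ∧
        (markBody.run s').arr aSt = Function.update (s'.arr aSt) p x ∧
        (markBody.run s').arr aCnt = Function.update (s'.arr aCnt) p (m + 1) ∧
        (markBody.run s').arr aT =
          (if s'.arr aSt p < x then Function.update (s'.arr aT) (s'.reg rTn) p else s'.arr aT) := by
      by_cases h1 : s'.arr aSt p < x
      · rw [if_pos h1] at hv
        by_cases h2 : m + 1 = s.arr aNch p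
        · have h2' : 1 = s.arr aNch p := by omega
          simp [markBody, hi', eX, eOne, ePar, eNch, h1, ← hq, ← hu, ← hp, ← hv, ← h2']
        · have h2' : ¬ 1 = s.arr aNch p := by omega
          simp [markBody, hi', eX, eOne, ePar, eNch, h1, ← hq, ← hu, ← hp, ← hv, h2']
      · rw [if_neg h1] at hv
        have h3 : s'.arr aSt p = x := by
          by_contra h
          rcases Nat.eq_zero_or_pos m with h0 | h0
          · exact h1 (hM.stamp_zero p h0)
          · exact h (hM.stamp_pos p h0)
        by_cases h2 : m + 1 = s.arr aNch p
        · simp [markBody, hi', eX, eOne, ePar, eNch, h3, ← hq, ← hu, ← hp, hv, h2]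
        · simp [markBody, hi', eX, eOne, ePar, eNch, h3, ← hq, ← hu, ← hp, hv, h2]
    refine ⟨by omega, ?_, ?_⟩
    · by_cases h1 : s'.arr aSt p < x
      · simp [markBody, hi', eX, eOne, ePar, ← hq, ← hu, ← hp, h1]
        split_ifs <;> simp [hi', eOne] <;> omega
      · have hc : s'.arr aCnt p = m := by rw [if_neg h1] at hv; omega
        simp [markBody, hi', eX, eOne, ePar, ← hq, ← hu, ← hp, h1, hc]
        split_ifs <;> simp [hi', eOne] <;> omega
    · obtain ⟨e1, e2, e3, e4, e5, e6, e7⟩ := hrun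
      have hq' : ∀ j < s'.reg rQn, (markBody.run s').arr aQ j = q j := by
        intro j hj
        rw [e4]
        split_ifs
        · exact Function.update_of_ne (by omega) _ _
        · rfl
      have hD' : (Finset.range (i + 1)).image ((markBody.run s').arr aQ) = insert u D := by
        rw [image_range_succ, hq' i hlt]
        congr 1
        refine Finset.image_congr fun j hj => hq' j ?_
        have : j < i := by simpa using hj
        omega
      have hpos : 0 < (childrenIn par (insert u D) p).card := by rw [hm' p]; simp
      have hstamp : ∀ r, s'.arr aSt r < x ∨ s'.arr aSt r = x := fun r => by
        rcases Nat.eq_zero_or_pos (childrenIn par D r).card with h | h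
        · exact Or.inl (hM.stamp_zero r h)
        · exact Or.inr (hM.stamp_pos r h)
      -- a node that enters the queue is full, since all its children are
      have hnew : m + 1 = s.arr aNch p → p ∈ N ∧ p ∉ X ∧ p ∉ Fq ∧ p ∈ fullNodes N Λ F ∧
          ∀ w ∈ N, par w = p → w ∈ insert u D := by
        intro h
        have hp0 : par u ≠ 0 := by
          intro h0; rw [← hp] at h0; rw [h0, hnch0] at h; omega
        have hpN : p ∈ N := T.par_mem u huN hp0
        have hpX : p ∉ X := T.par_leaf u huN
        have hch : childrenIn par (insert u D) p = childrenIn par N p := by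
          refine Finset.eq_of_subset_of_card_le (Finset.filter_subset_filter _ hDN) ?_
          rw [← hnch p hpN, hm' p, if_pos rfl, ← h]
        have hall : ∀ w ∈ N, par w = p → w ∈ insert u D := fun w hw hpw =>
          (mem_childrenIn.1 (hch ▸ mem_childrenIn.2 ⟨hw, hpw⟩ : w ∈ childrenIn par (insert u D) p)).1
        refine ⟨hpN, hpX, fun h' => ?_, mem_fullNodes.2 ⟨hpN, ?_⟩, hall⟩
        · have := (hpush p hpN hpX).1 h'; omega
        · refine T.subset_of_children hpN hpX fun w hw hpw => ?_
          have : w ∈ Fq := by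
            rcases Finset.mem_insert.1 (hall w hw hpw) with rfl | h'
            · exact huq
            · exact hDq h'
          exact (mem_fullNodes.1 (hfull this)).2
      have hT' : Enumerates ((markBody.run s').arr aT) ((markBody.run s').reg rTn)
          ((insert u D).image par) := by
        rw [e3, e7, Finset.image_insert, ← hp]
        by_cases h1 : s'.arr aSt p < x
        · rw [if_pos h1, if_pos h1]
          exact hM.touched.push (hpD.1 h1)
        · rw [if_neg h1, if_neg h1, Finset.insert_eq_self.2 (not_not.1 fun h => h1 (hpD.2 h))]
          exact hM.touched
      have hother : ∀ r, r ≠ p → (childrenIn par (insert u D) r).card = (childrenIn par D r).card :=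
        fun r hr => by rw [hm' r, if_neg hr.symm, Nat.add_zero]
      refine ⟨e1, ?_, if m + 1 = s.arr aNch p then insert p Fq else Fq, ?_, ?_, ?_, ?_⟩
      · rw [e2]; split_ifs <;> omega
      · rw [hD']
        refine ⟨?_, ?_, ?_, ?_, hT', ?_⟩
        · rw [e2, e4]
          split_ifs with h
          · exact hM.queue.push (hnew h).2.2.1
          · exact hM.queue
        · intro r hr
          have hrp : r ≠ p := by rintro rfl; omega
          rw [e5, Function.update_of_ne hrp]
          exact hM.stamp_zero r (hother r hrp ▸ hr)
        · intro r hr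
          rw [e5]
          by_cases hrp : r = p
          · rw [hrp, Function.update_self]
          · rw [Function.update_of_ne hrp]
            exact hM.stamp_pos r (hother r hrp ▸ hr)
        · intro r hr
          rw [e6]
          by_cases hrp : r = p
          · rw [hrp, Function.update_self, hm' p, if_pos rfl]
          · rw [Function.update_of_ne hrp, hother r hrp]
            exact hM.cnt r (hother r hrp ▸ hr)
        · intro j hj w hw hpw
          have hold : ∀ j < s'.reg rQn, par w = q j → ∃ j' < j, (markBody.run s').arr aQ j' = w := by
            intro j hj hpw
            obtain ⟨j', hj', he⟩ := hM.order j hj w hw hpw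
            exact ⟨j', hj', by rw [hq' j' (hj'.trans hj)]; exact he⟩
          rcases Nat.lt_or_ge j (s'.reg rQn) with hj' | hj'
          · exact hold j hj' (hq' j hj' ▸ hpw)
          · rw [e2] at hj
            split_ifs at hj with h
            · obtain rfl : j = s'.reg rQn := by omega
              rw [e4, if_pos h, Function.update_self] at hpw
              have h3 := (hnew h).2.2.2.2 w hw hpw
              rw [← hD'] at h3
              obtain ⟨k, hk, he⟩ := Finset.mem_image.1 h3
              exact ⟨k, by have := Finset.mem_range.1 hk; omega, he⟩
            · omega
      · split_ifs
        · exact hFq.trans (Finset.subset_insert _ _)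
        · exact hFq
      · split_ifs with h
        · exact Finset.insert_subset (hnew h).2.2.2.1 hfull
        · exact hfull
      · intro r hr hrX
        rw [hD']
        by_cases hrp : r = p
        · rw [hrp, hm' p, if_pos rfl]
          split_ifs with h
          · simpa using h
          · refine ⟨fun h' => ?_, fun h' => absurd h' h⟩
            -- the children of a node in the queue have been counted, and `u` has not
            obtain ⟨j, hj, he⟩ := hM.queue.exists_of_mem h'
            have h4 := (hpush p (hrp ▸ hr) (hrp ▸ hrX)).1 h'
            rw [hnch p (hrp ▸ hr)] at h4
            have h5 : childrenIn par D p = childrenIn par N p :=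
              Finset.eq_of_subset_of_card_le (Finset.filter_subset_filter _
                ((Finset.subset_insert _ _).trans hDN)) h4.ge
            exact absurd (mem_childrenIn.1 (h5 ▸ mem_childrenIn.2 ⟨huN, rfl⟩ :
              u ∈ childrenIn par D p)).1 huD
        · rw [hother r hrp, ← hpush r hr hrX]
          split_ifs
          · simp [hrp]
          · rfl
  · intro p _; exact hst p
  · intro p h; simp [childrenIn] at h
  · intro p h; simp [childrenIn] at h
  · simpa [hTn] using Enumerates.empty _
  · intro j hj w hw hpw
    exact absurd hpw (hleaf _ (hFX (hQ.mem hj)) w hw)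
  · intro p hp hpX
    have := h2 p hp hpX
    have : p ∉ F := fun h => hpX (hFX h)
    simp [childrenIn, this]; omega
  · rintro s' ha ⟨hge, i, hi', hle, Fq, hM, hFq, hfull, hpush⟩
    rw [hi'] at hge
    obtain rfl : i = s'.reg rQn := by omega
    rw [hM.queue.1] at hM hpush
    obtain rfl : Fq = fullNodes N Λ F := by
      refine hfull.antisymm (T.fullNodes_subset hs hFq (fun p hp hpX h => ?_)
        fun w hw => (mem_fullNodes.1 (hfull hw)).1)
      exact (hpush p hp hpX).2 (h.trans (hnch p hp).symm)
    exact hM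

end

/-! ### Finding the pivot -/

/-- The parents and grandparents of all candidates are flagged. -/
def flagBody : Program :=
  block [.load rU aT rI, .load rV aCnt rU, .load rW aNch rU,
    .ifLt rV rW
      (block [.load rP aPar rU, .store aMk rP rX, .load rP aPar rP, .store aMk rP rX]) .skip,
    .add rI rI rOne]

/-- `flagBody` for all touched nodes. -/
def flag : Program := .whileLt rI rTn flagBody

/-- A candidate that has not been flagged is selected. -/
def pickBody : Program :=
  block [.load rU aT rI, .load rV aCnt rU, .load rW aNch rU,
    .ifLt rV rW (block [.load rP aMk rU, .ifLt rP rX (.copy rA rU) .skip]) .skip,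
    .add rI rI rOne]

/-- `pickBody` for all touched nodes. -/
def pick : Program := .whileLt rI rTn pickBody

lemma runs_flag {B x : ℕ} {s : Memory} (hX : s.reg rX = x) (hOne : s.reg rOne = 1)
    (hI : s.reg rI = 0) (hmk : ∀ p, s.arr aMk p < x) (hB : s.reg rTn + 1 ≤ B) :
    Runs B flag s (10 * s.reg rTn + 1) fun s' =>
      ∀ v, s'.arr aMk v ≤ x ∧ (s'.arr aMk v = x ↔ ∃ j < s.reg rTn,
        s.arr aCnt (s.arr aT j) < s.arr aNch (s.arr aT j) ∧
        (s.arr aPar (s.arr aT j) = v ∨ s.arr aPar (s.arr aPar (s.arr aT j)) = v)) := by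
  refine (Runs.for (I := fun i s' => s'.reg rI = i ∧ i ≤ s.reg rTn ∧
      ∀ v, s'.arr aMk v ≤ x ∧ (s'.arr aMk v = x ↔ ∃ j < i,
        s.arr aCnt (s.arr aT j) < s.arr aNch (s.arr aT j) ∧
        (s.arr aPar (s.arr aT j) = v ∨ s.arr aPar (s.arr aPar (s.arr aT j)) = v)))
      (s.reg rTn) 0 rfl ?_ ⟨hI, Nat.zero_le _, ?_⟩ le_rfl).mono
      (by simp [flagBody, Program.cost]) ?_
  · rintro i s' ha ⟨hi', hle, hv⟩ hlt
    have eX : s'.reg rX = x := (ha.1 rX (by decide)).trans hX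
    have eOne : s'.reg rOne = 1 := (ha.1 rOne (by decide)).trans hOne
    have ePar : s'.arr aPar = s.arr aPar := ha.2 aPar (by decide)
    have eNch : s'.arr aNch = s.arr aNch := ha.2 aNch (by decide)
    have eCnt : s'.arr aCnt = s.arr aCnt := ha.2 aCnt (by decide)
    have eT : s'.arr aT = s.arr aT := ha.2 aT (by decide)
    rw [hi', ha.1 rTn (by decide)] at hlt
    have hex : ∀ Q : ℕ → Prop, (∃ j < i + 1, Q j) ↔ (∃ j < i, Q j) ∨ Q i := by
      intro Q
      constructor
      · rintro ⟨j, hj, h⟩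
        rcases Nat.lt_succ_iff_lt_or_eq.1 hj with hj | rfl
        · exact Or.inl ⟨j, hj, h⟩
        · exact Or.inr h
      · rintro (⟨j, hj, h⟩ | h)
        · exact ⟨j, by omega, h⟩
        · exact ⟨i, by omega, h⟩
    refine ⟨hlt, ?_, ?_, hlt, ?_⟩
    · simp [flagBody, hi', eNch, eCnt, eT]
      split_ifs <;> simp [hi', eOne] <;> omega
    · simp [flagBody, hi', eNch, eCnt, eT]
      split_ifs <;> simp [hi', eOne]
    · intro v
      rw [hex]
      by_cases hc : s.arr aCnt (s.arr aT i) < s.arr aNch (s.arr aT i)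
      · simp only [hc, true_and]
        simp [flagBody, hi', eNch, eCnt, eT, ePar, eX, hc, Function.update_apply]
        obtain ⟨h1, h2⟩ := hv v
        by_cases ha1 : v = s.arr aPar (s.arr aPar (s.arr aT i))
        · simp [ha1]
        · by_cases ha2 : v = s.arr aPar (s.arr aT i)
          · simp [ha2]
          · simp only [ha1, ha2, if_false, not_false_eq_true, forall_const]
            refine ⟨h1, h2.trans (or_iff_left ?_).symm⟩
            rintro (h | h)
            · exact ha2 h.symm
            · exact ha1 h.symm
      · simp [flagBody, hi', eNch, eCnt, eT, hc]
        simpa using hv v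
  · intro v
    have := hmk v
    simp; omega
  · rintro s' ha ⟨hge, i, hi', hle, hv⟩
    rw [hi', ha.1 rTn (by decide)] at hge
    obtain rfl : i = s.reg rTn := by omega
    exact hv

lemma runs_pick {B x : ℕ} {s : Memory} (hX : s.reg rX = x) (hOne : s.reg rOne = 1)
    (hI : s.reg rI = 0) (hA : s.reg rA = 0) (hB : s.reg rTn + 1 ≤ B) :
    Runs B pick s (10 * s.reg rTn + 1) fun s' =>
      (s'.reg rA = 0 ∧ ∀ j < s.reg rTn, s.arr aT j ≠ 0 →
        ¬ (s.arr aCnt (s.arr aT j) < s.arr aNch (s.arr aT j) ∧ s.arr aMk (s.arr aT j) < x)) ∨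
      ∃ j < s.reg rTn, s'.reg rA = s.arr aT j ∧
        s.arr aCnt (s.arr aT j) < s.arr aNch (s.arr aT j) ∧ s.arr aMk (s.arr aT j) < x := by
  refine (Runs.for (I := fun i s' => s'.reg rI = i ∧ i ≤ s.reg rTn ∧
      ((s'.reg rA = 0 ∧ ∀ j < i, s.arr aT j ≠ 0 →
        ¬ (s.arr aCnt (s.arr aT j) < s.arr aNch (s.arr aT j) ∧ s.arr aMk (s.arr aT j) < x)) ∨
      ∃ j < i, s'.reg rA = s.arr aT j ∧
        s.arr aCnt (s.arr aT j) < s.arr aNch (s.arr aT j) ∧ s.arr aMk (s.arr aT j) < x))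
      (s.reg rTn) 0 rfl ?_ ⟨hI, Nat.zero_le _, Or.inl ⟨hA, by simp⟩⟩ le_rfl).mono
      (by simp [pickBody, Program.cost]; omega) ?_
  · rintro i s' ha ⟨hi', hle, hv⟩ hlt
    have eX : s'.reg rX = x := (ha.1 rX (by decide)).trans hX
    have eOne : s'.reg rOne = 1 := (ha.1 rOne (by decide)).trans hOne
    have eNch : s'.arr aNch = s.arr aNch := ha.2 aNch (by decide)
    have eCnt : s'.arr aCnt = s.arr aCnt := ha.2 aCnt (by decide)
    have eMk : s'.arr aMk = s.arr aMk := ha.2 aMk (by decide)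
    have eT : s'.arr aT = s.arr aT := ha.2 aT (by decide)
    rw [hi', ha.1 rTn (by decide)] at hlt
    refine ⟨hlt, ?_, ?_, hlt, ?_⟩
    · simp [pickBody, hi', eNch, eCnt, eT, eMk, eX]
      split_ifs <;> simp [hi', eOne] <;> omega
    · simp [pickBody, hi', eNch, eCnt, eT, eMk, eX]
      split_ifs <;> simp [hi', eOne]
    · by_cases hc : s.arr aCnt (s.arr aT i) < s.arr aNch (s.arr aT i) ∧ s.arr aMk (s.arr aT i) < x
      · refine Or.inr ⟨i, by omega, ?_, hc⟩
        simp [pickBody, hi', eNch, eCnt, eT, eMk, eX, hc]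
      · have hr : (pickBody.run s').reg rA = s'.reg rA := by
          simp [pickBody, hi', eNch, eCnt, eT, eMk, eX]
          split_ifs with h1 h2
          · exact absurd ⟨h1, h2⟩ hc
          · simp
          · simp
        rw [hr]
        rcases hv with ⟨h0, h⟩ | ⟨j, hj, h⟩
        · refine Or.inl ⟨h0, fun j hj hne => ?_⟩
          rcases Nat.lt_succ_iff_lt_or_eq.1 hj with hj | rfl
          · exact h j hj hne
          · exact hc
        · exact Or.inr ⟨j, by omega, h⟩
  · rintro s' ha ⟨hge, i, hi', hle, hv⟩
    rw [hi', ha.1 rTn (by decide)] at hge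
    obtain rfl : i = s.reg rTn := by omega
    exact hv

/-- The full nodes are put into the queue, and register `rA` receives the pivot, or `0` if there is
none. -/
def locate : Program :=
  .seq (block [.copy rI rZero, .copy rTn rZero]) (.seq mark (.seq (.copy rI rZero) (.seq flag
    (.seq (block [.copy rI rZero, .copy rA rZero]) pick))))

section

variable {H : SimpleGraph ℕ} {X N : Finset ℕ} {Λ : ℕ → Finset ℕ} {lab : ℕ → ℕ}

open Classical in
/-- The neighbours of `x` in `X`. -/
noncomputable def nbrs (H : SimpleGraph ℕ) (X : Finset ℕ) (x : ℕ) : Finset ℕ :=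
  X.filter fun v => H.Adj x v

lemma mem_nbrs {x v : ℕ} : v ∈ nbrs H X x ↔ v ∈ X ∧ H.Adj x v := by
  classical exact Finset.mem_filter

lemma Cotree.subset_nbrs {par : ℕ → ℕ} (T : Cotree H X N Λ par lab) {x u : ℕ} (hu : u ∈ N) :
    Λ u ⊆ nbrs H X x ↔ ∀ v ∈ Λ u, H.Adj x v :=
  ⟨fun h _ hv => (mem_nbrs.1 (h hv)).2, fun h v hv => mem_nbrs.2 ⟨T.sub u hu hv, h v hv⟩⟩

/-- The candidates are the touched nodes with fewer full children than children. The number `0` is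
ruled out because its cell of `nch` is `0`. -/
lemma Marked.candidate_iff {par nch : ℕ → ℕ} {x : ℕ} {s : Memory} (T : Cotree H X N Λ par lab)
    (hnch : ∀ p ∈ N, nch p = (childrenIn par N p).card) (hnch0 : nch 0 = 0)
    (hM : Marked X N par x s (fullNodes N Λ (nbrs H X x)) (fullNodes N Λ (nbrs H X x))) {p : ℕ} :
    (p ∈ (fullNodes N Λ (nbrs H X x)).image par ∧ s.arr aCnt p < nch p) ↔
      Cotree.Candidate H N Λ par x p := by
  set A := fullNodes N Λ (nbrs H X x)
  have hAN : A ⊆ N := Finset.filter_subset _ _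
  have hsub : childrenIn par A p ⊆ childrenIn par N p := Finset.filter_subset_filter _ hAN
  constructor
  · rintro ⟨hp, hlt⟩
    obtain ⟨u, hu, rfl⟩ := Finset.mem_image.1 hp
    obtain ⟨huN, huF⟩ := mem_fullNodes.1 hu
    have h0 : par u ≠ 0 := by intro h0; rw [h0, hnch0] at hlt; omega
    have hpN := T.par_mem u huN h0
    refine ⟨hpN, ⟨u, huN, rfl, (T.subset_nbrs huN).1 huF⟩, ?_⟩
    by_contra hcon
    push Not at hcon
    have hpF := (T.subset_nbrs hpN).2 hcon
    have : childrenIn par A (par u) = childrenIn par N (par u) := by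
      refine hsub.antisymm fun w hw => ?_
      obtain ⟨hw, hpw⟩ := mem_childrenIn.1 hw
      exact mem_childrenIn.2 ⟨mem_fullNodes.2
        ⟨hw, (hpw ▸ T.par_sub w hw (hpw ▸ h0)).trans hpF⟩, hpw⟩
    rw [hM.cnt _ (Finset.card_pos.2 ⟨u, mem_childrenIn.2 ⟨hu, rfl⟩⟩), this, hnch _ hpN] at hlt
    exact lt_irrefl _ hlt
  · rintro ⟨hpN, ⟨u, hu, rfl, hfull⟩, v, hv, hxv⟩
    have huA : u ∈ A := mem_fullNodes.2 ⟨hu, (T.subset_nbrs hu).2 hfull⟩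
    refine ⟨Finset.mem_image_of_mem _ huA, ?_⟩
    rw [hM.cnt _ (Finset.card_pos.2 ⟨u, mem_childrenIn.2 ⟨huA, rfl⟩⟩), hnch _ hpN]
    refine Finset.card_lt_card (hsub.ssubset_of_ne fun he => hxv ?_)
    refine (T.subset_nbrs hpN).1 (T.subset_of_children hpN (T.par_leaf u hu) fun w hw hpw => ?_) v hv
    exact (mem_fullNodes.1 (mem_childrenIn.1 (he ▸ mem_childrenIn.2 ⟨hw, hpw⟩ :
      w ∈ childrenIn par A (par u))).1).2

/-- The pivot is found in time proportional to the number of neighbours of `x`: a candidate without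
flag is a pivot by `Cotree.exists_candidate_below`, and a pivot is a candidate without flag. -/
lemma runs_locate {B x : ℕ} {s : Memory} (T : Cotree H X N Λ (s.arr aPar) lab)
    (hs : Strict N Λ (s.arr aPar)) (hal : Alternating N (s.arr aPar) lab) (hH : P4Free H)
    (hnch : ∀ p ∈ N, s.arr aNch p = (childrenIn (s.arr aPar) N p).card)
    (hnch0 : s.arr aNch 0 = 0) (h2 : ∀ p ∈ N, p ∉ X → 2 ≤ s.arr aNch p)
    (hQ : Enumerates (s.arr aQ) (s.reg rQn) (nbrs H X x)) (hX : s.reg rX = x)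
    (hOne : s.reg rOne = 1) (hZ : s.reg rZero = 0)
    (hst : ∀ p, s.arr aSt p < x) (hmk : ∀ p, s.arr aMk p < x)
    (hB : 2 * (nbrs H X x).card + 2 ≤ B) :
    Runs B locate s (80 * (nbrs H X x).card + 8) fun s' =>
      Marked X N (s.arr aPar) x s' (fullNodes N Λ (nbrs H X x)) (fullNodes N Λ (nbrs H X x)) ∧
      (∀ v, s'.arr aMk v ≤ x) ∧
      ((s'.reg rA = 0 ∧ ∀ α, ¬ Cotree.Pivot H N Λ (s.arr aPar) x α) ∨
        Cotree.Pivot H N Λ (s.arr aPar) x (s'.reg rA)) := by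
  set F := nbrs H X x with hF
  set par := s.arr aPar with hpar
  set A := fullNodes N Λ F with hA
  have hcard : A.card ≤ 2 * F.card :=
    T.card_fullNodes_le fun p hp hpX => hnch p hp ▸ h2 p hp hpX
  have hFX : F ⊆ X := fun v hv => (mem_nbrs.1 hv).1
  refine Runs.seq (T₁ := 2) (T₂ := 80 * F.card + 6)
    (R := fun s₁ => s₁.reg rI = 0 ∧ s₁.reg rTn = 0)
    (.straight rfl (by simp) (by simp [Program.cost]) (by simp [hZ])) ?_ (by omega)
  intro s₁ a₁ ⟨hI₁, hTn₁⟩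
  have r₁ : ∀ r, r ≠ rI → r ≠ rTn → s₁.reg r = s.reg r := fun r h h' =>
    a₁.1 r (by simpa [Program.regs, block] using ⟨h, h'⟩)
  have q₁ : ∀ a, s₁.arr a = s.arr a := fun a => a₁.2 a (by simp [Program.arrs, block])
  have hmark := runs_mark (B := B) (F := F) (x := x) (s := s₁) (X := X) (N := N) (Λ := Λ)
    (lab := lab) (H := H) (by rwa [q₁]) (by rwa [q₁]) (by simpa only [q₁] using hnch) (by rwa [q₁])
    (by simpa only [q₁] using h2) hFX (by rw [q₁, r₁ rQn (by decide) (by decide)]; exact hQ)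
    (by rw [r₁ rX (by decide) (by decide), hX]) (by rw [r₁ rOne (by decide) (by decide), hOne])
    hI₁ hTn₁ (by simpa only [q₁] using hst) hB
  refine hmark.seq (T₂ := 40 * F.card + 5) ?_ (by omega)
  intro s₂ a₂ hM₂
  rw [q₁] at hM₂
  have htn : s₂.reg rTn ≤ 2 * F.card := by
    rw [← hM₂.touched.2]; exact Finset.card_image_le.trans hcard
  refine Runs.seq (T₁ := 1) (T₂ := 40 * F.card + 4) (R := fun s₃ => s₃ = s₂.setReg rI 0)
    (.straight rfl (by simp) (by simp [Program.cost]) ?_) ?_ (by omega)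
  · have : s₂.reg rZero = 0 := by
      rw [a₂.1 rZero (by decide), r₁ rZero (by decide) (by decide), hZ]
    simp [this]
  intro s₃ _ h₃
  have e₂ : ∀ r, r ∉ mark.regs → r ≠ rI → r ≠ rTn → s₃.reg r = s.reg r := fun r h h' h'' => by
    rw [h₃, reg_setReg, if_neg h', a₂.1 r h, r₁ r h' h'']
  have hTn₃ : s₃.reg rTn = s₂.reg rTn := by rw [h₃]; simp
  have hflag := runs_flag (B := B) (s := s₃) (x := x) (by rw [e₂ rX (by decide) (by decide) (by decide), hX])
    (by rw [e₂ rOne (by decide) (by decide) (by decide), hOne]) (by rw [h₃]; simp)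
    (by rw [h₃, arr_setReg, a₂.2 aMk (by decide), q₁]; exact hmk) (by rw [hTn₃]; omega)
  rw [hTn₃] at hflag
  refine hflag.seq (T₂ := 10 * s₂.reg rTn + 3) ?_ (by omega)
  intro s₄ a₄ hmk₄
  rw [h₃, arr_setReg] at hmk₄
  have ePar₂ : s₂.arr aPar = par := by rw [a₂.2 aPar (by decide), q₁]
  have eNch₂ : s₂.arr aNch = s.arr aNch := by rw [a₂.2 aNch (by decide), q₁]
  have s₄a : ∀ a, a ≠ aMk → s₄.arr a = s₂.arr a := fun a h => by
    rw [a₄.2 a (by simpa [Program.arrs, flag, flagBody, block] using h), h₃, arr_setReg]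
  have s₄r : ∀ r, r ∉ flag.regs → r ≠ rI → s₄.reg r = s₂.reg r := fun r h h' => by
    rw [a₄.1 r h, h₃, reg_setReg, if_neg h']
  refine Runs.seq (T₁ := 2) (T₂ := 10 * s₂.reg rTn + 1)
    (R := fun s₅ => s₅ = (s₄.setReg rI 0).setReg rA 0)
    (.straight rfl (by simp) (by simp [Program.cost]) ?_) ?_ (by omega)
  · have : s₄.reg rZero = 0 := by
      rw [s₄r rZero (by decide) (by decide), a₂.1 rZero (by decide),
        r₁ rZero (by decide) (by decide), hZ]
    simp [this]
  intro s₅ _ h₅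
  have hTn₅ : s₅.reg rTn = s₂.reg rTn := by
    rw [h₅]; simpa using s₄r rTn (by decide) (by decide)
  have s₅a : ∀ a, s₅.arr a = s₄.arr a := fun a => by rw [h₅]; rfl
  have hpick := runs_pick (B := B) (s := s₅) (x := x)
    (by rw [h₅]; simp only [reg_setReg]; norm_num
        rw [a₄.1 rX (by decide), e₂ rX (by decide) (by decide) (by decide), hX])
    (by rw [h₅]; simp only [reg_setReg]; norm_num
        rw [a₄.1 rOne (by decide), e₂ rOne (by decide) (by decide) (by decide), hOne])
    (by rw [h₅]; simp) (by rw [h₅]; simp) (by rw [hTn₅]; omega)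
  rw [hTn₅] at hpick
  refine hpick.mono le_rfl ?_
  intro s₆ a₆ hA₆
  simp only [s₅a] at hA₆
  rw [s₄a aT (by decide), s₄a aCnt (by decide), s₄a aNch (by decide), eNch₂] at hA₆
  rw [ePar₂, eNch₂] at hmk₄
  have s₆a : ∀ a, a ≠ aMk → s₆.arr a = s₂.arr a := fun a h => by
    rw [a₆.2 a (by simp [Program.arrs, pick, pickBody, block]), s₅a, s₄a a h]
  have s₆r : ∀ r, r ∉ flag.regs → r ≠ rI → r ≠ rA → r ∉ pick.regs → s₆.reg r = s₂.reg r := by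
    intro r h h' h'' h3
    rw [a₆.1 r h3, h₅, reg_setReg, if_neg h'', reg_setReg, if_neg h', s₄r r h h']
  have hM₆ : Marked X N par x s₆ A A := by
    refine ⟨?_, ?_, ?_, ?_, ?_, ?_⟩
    · rw [s₆a aQ (by decide), s₆r rQn (by decide) (by decide) (by decide) (by decide)]; exact hM₂.queue
    · rw [s₆a aSt (by decide)]; exact hM₂.stamp_zero
    · rw [s₆a aSt (by decide)]; exact hM₂.stamp_pos
    · rw [s₆a aCnt (by decide)]; exact hM₂.cnt
    · rw [s₆a aT (by decide), s₆r rTn (by decide) (by decide) (by decide) (by decide)]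
      exact hM₂.touched
    · rw [s₆a aQ (by decide), s₆r rQn (by decide) (by decide) (by decide) (by decide)]; exact hM₂.order
  have hcand : ∀ p, (∃ j < s₂.reg rTn, s₂.arr aT j = p ∧ s₂.arr aCnt p < s.arr aNch p) ↔
      Cotree.Candidate H N Λ par x p := by
    intro p
    rw [← hM₂.candidate_iff T hnch hnch0]
    constructor
    · rintro ⟨j, hj, rfl, h⟩; exact ⟨hM₂.touched.mem hj, h⟩
    · rintro ⟨hp, h⟩
      obtain ⟨j, hj, he⟩ := hM₂.touched.exists_of_mem hp
      exact ⟨j, hj, he, h⟩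
  have hflagged : ∀ v, ¬ s₄.arr aMk v < x ↔
      ∃ q, Cotree.Candidate H N Λ par x q ∧ (par q = v ∨ par (par q) = v) := by
    intro v
    have := (hmk₄ v).1
    rw [show ¬ s₄.arr aMk v < x ↔ s₄.arr aMk v = x by omega, (hmk₄ v).2]
    constructor
    · rintro ⟨j, hj, h, h'⟩; exact ⟨_, (hcand _).1 ⟨j, hj, rfl, h⟩, h'⟩
    · rintro ⟨q, hq, h⟩
      obtain ⟨j, hj, rfl, h'⟩ := (hcand q).2 hq
      exact ⟨j, hj, h', h⟩
  refine ⟨hM₆, fun v => ?_, ?_⟩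
  · rw [a₆.2 aMk (by decide), s₅a]; exact (hmk₄ v).1
  · rcases hA₆ with ⟨h0, hno⟩ | ⟨j, hj, he, hlt, hmk'⟩
    · refine Or.inl ⟨h0, fun α hα => ?_⟩
      obtain ⟨j, hj, rfl, hlt⟩ := (hcand α).2 (hα.candidate T)
      have hα0 : s₂.arr aT j ≠ 0 := fun h => T.zero (h ▸ hα.mem)
      refine hno j hj hα0 ⟨hlt, ?_⟩
      by_contra hcon
      obtain ⟨q, hq, h⟩ := (hflagged _).1 hcon
      have := hα.not_candidate T hq
      tauto
    · refine Or.inr ?_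
      rw [he]
      have hq := (hcand (s₂.arr aT j)).1 ⟨j, hj, rfl, hlt⟩
      obtain ⟨h1, h2⟩ := hq.mixed T
      obtain ⟨α, hα⟩ := T.exists_pivot hq.1 h1 h2 hs
      by_cases hne : s₂.arr aT j = α
      · rw [hne]; exact hα
      · exact absurd hmk' ((hflagged _).2 (T.exists_candidate_below hs hal hH hα hq hne))

end

/-! ### Moving children and putting a node on an edge -/

lemma agree_run : ∀ (P : Program) (s : Memory), Agree P s (P.run s)
  | .skip, s => .refl _ _
  | .const x k, s =>
    ⟨fun r hr => Function.update_of_ne (by simpa [Program.regs] using hr) _ _, fun _ _ => rfl⟩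
  | .copy x y, s =>
    ⟨fun r hr => Function.update_of_ne (by simpa [Program.regs] using hr) _ _, fun _ _ => rfl⟩
  | .add x y z, s =>
    ⟨fun r hr => Function.update_of_ne (by simpa [Program.regs] using hr) _ _, fun _ _ => rfl⟩
  | .sub x y z, s =>
    ⟨fun r hr => Function.update_of_ne (by simpa [Program.regs] using hr) _ _, fun _ _ => rfl⟩
  | .load x a i, s =>
    ⟨fun r hr => Function.update_of_ne (by simpa [Program.regs] using hr) _ _, fun _ _ => rfl⟩
  | .store a i y, s =>
    ⟨fun _ _ => rfl, fun b hb => Function.update_of_ne (by simpa [Program.arrs] using hb) _ _⟩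
  | .seq P Q, s =>
    ((agree_run P s).of_subset (by simp [Program.regs]) (by simp [Program.arrs])).trans
      ((agree_run Q _).of_subset (by simp [Program.regs]) (by simp [Program.arrs]))
  | .ifLt x y P Q, s => by
    simp only [Program.run]
    split_ifs
    · exact (agree_run P s).of_subset (by simp [Program.regs]) (by simp [Program.arrs])
    · exact (agree_run Q s).of_subset (by simp [Program.regs]) (by simp [Program.arrs])
  | .whileLt x y P, s => .refl _ _

/-- The nodes in the queue that are children of `rA` become children of `rG`; the sum of their
names is `rS`, and `rF` is one of them. -/
def moveBody : Program :=
  block [.load rU aQ rI, .load rP aPar rU,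
    ifEq rP rA (block [.store aPar rU rG, addMod rM rS rS rU, .copy rF rU]) .skip,
    .add rI rI rOne]

/-- `moveBody` for all nodes in the queue. -/
def move : Program := .whileLt rI rQn moveBody

lemma runs_move {B M : ℕ} {A : Finset ℕ} {s : Memory} (hQ : Enumerates (s.arr aQ) (s.reg rQn) A)
    (hI : s.reg rI = 0) (hS : s.reg rS = 0) (hOne : s.reg rOne = 1) (hM : s.reg rM = M)
    (hA : ∀ u ∈ A, u < M) (hM0 : 0 < M) (hB : 2 * M ≤ B) (hB' : s.reg rQn + 1 ≤ B) :
    Runs B move s (12 * s.reg rQn + 1) fun s' =>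
      (s'.arr aPar = fun u => if u ∈ childrenIn (s.arr aPar) A (s.reg rA) then s.reg rG
        else s.arr aPar u) ∧
      s'.reg rS < M ∧
      (s'.reg rS : ZMod M) = ∑ u ∈ childrenIn (s.arr aPar) A (s.reg rA), (u : ZMod M) ∧
      ((childrenIn (s.arr aPar) A (s.reg rA)).Nonempty →
        s'.reg rF ∈ childrenIn (s.arr aPar) A (s.reg rA)) := by
  set par := s.arr aPar with hpar
  set α := s.reg rA with hα
  set q := s.arr aQ with hq
  refine (Runs.for (I := fun i s' => s'.reg rI = i ∧ i ≤ s.reg rQn ∧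
      (s'.arr aPar = fun u => if u ∈ childrenIn par ((Finset.range i).image q) α then s.reg rG
        else par u) ∧ s'.reg rS < M ∧
      (s'.reg rS : ZMod M) = ∑ u ∈ childrenIn par ((Finset.range i).image q) α, (u : ZMod M) ∧
      ((childrenIn par ((Finset.range i).image q) α).Nonempty →
        s'.reg rF ∈ childrenIn par ((Finset.range i).image q) α))
      (s.reg rQn) 0 rfl ?_ ⟨hI, Nat.zero_le _, ?_, ?_, ?_, ?_⟩ le_rfl).mono
      (by simp [moveBody, Program.cost, ifEq, addMod]; omega) ?_
  · rintro i s' ha ⟨hi', hle, h1, h2, h3, h4⟩ hlt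
    have eOne : s'.reg rOne = 1 := (ha.1 rOne (by decide)).trans hOne
    have eM : s'.reg rM = M := (ha.1 rM (by decide)).trans hM
    have eA : s'.reg rA = α := ha.1 rA (by decide)
    have eG : s'.reg rG = s.reg rG := ha.1 rG (by decide)
    have eQ : s'.arr aQ = q := ha.2 aQ (by decide)
    rw [hi', ha.1 rQn (by decide)] at hlt
    have huA : q i < M := hA _ (hQ.mem hlt)
    have hnot := hQ.notMem_image hlt
    set D := (Finset.range i).image q with hD
    have hpu : s'.arr aPar (q i) = par (q i) := by
      rw [h1]; simp only [mem_childrenIn]; rw [if_neg fun h => hnot h.1]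
    have hins : childrenIn par (insert (q i) D) α =
        if par (q i) = α then insert (q i) (childrenIn par D α) else childrenIn par D α := by
      unfold childrenIn; exact Finset.filter_insert _ _ _
    refine ⟨hlt, ?_, ?_⟩
    · simp [moveBody, hi', eQ, hpu, eA]
      split_ifs <;> simp [hi', eOne] <;> omega
    · rw [image_range_succ, ← hD, hins]
      by_cases hc : par (q i) = α
      · have hnot' : q i ∉ childrenIn par D α := fun h => hnot (mem_childrenIn.1 h).1
        simp only [if_pos hc]
        refine ⟨by simp [moveBody, hi', eQ, hpu, eA, hc, eOne], hlt, ?_, ?_, ?_, ?_⟩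
        · have : (moveBody.run s').arr aPar = Function.update (s'.arr aPar) (q i) (s.reg rG) := by
            simp [moveBody, hi', eQ, hpu, eA, hc, eG]
          rw [this, h1]
          funext u
          by_cases hu : u = q i
          · subst hu; simp
          · rw [Function.update_of_ne hu]; simp [hu]
        · have : (moveBody.run s').reg rS = addm M (s'.reg rS) (q i) := by
            simp [moveBody, hi', eQ, hpu, eA, hc, eM]
          rw [this]; exact addm_lt h2 huA
        · have : (moveBody.run s').reg rS = addm M (s'.reg rS) (q i) := by
            simp [moveBody, hi', eQ, hpu, eA, hc, eM]
          rw [this, cast_addm, h3, Finset.sum_insert hnot', add_comm]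
        · intro _
          have : (moveBody.run s').reg rF = q i := by
            simp [moveBody, hi', eQ, hpu, eA, hc]
          rw [this]; exact Finset.mem_insert_self _ _
      · simp only [if_neg hc]
        refine ⟨by simp [moveBody, hi', eQ, hpu, eA, hc, eOne], hlt, ?_, ?_, ?_, ?_⟩
        · simpa [moveBody, hi', eQ, hpu, eA, hc] using h1
        · simpa [moveBody, hi', eQ, hpu, eA, hc] using h2
        · simpa [moveBody, hi', eQ, hpu, eA, hc] using h3
        · simpa [moveBody, hi', eQ, hpu, eA, hc] using h4
  · funext u; simp [childrenIn, hpar]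
  · omega
  · simp [childrenIn, hS]
  · simp [childrenIn]
  · rintro s' ha ⟨hge, i, hi', hle, h⟩
    rw [hi', ha.1 rQn (by decide)] at hge
    obtain rfl : i = s.reg rQn := by omega
    rwa [hQ.1] at h

/-- The new node `rNx`, with label `rLg`, is connected to the node `rA`: of these two nodes, `rT`
becomes the parent of `rB` and takes the old place of `rA`. The `rK` nodes that have been moved from
`rA` to the new node have the sum `rS`. -/
def splitNode : Program :=
  block [.store aLab rNx rLg, .store aNch rNx rK, .store aSum rNx rS,
    .load rV aNch rA, .sub rV rV rK, .store aNch rA rV,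
    .load rV aSum rA, subMod rM rV rV rS, .store aSum rA rV,
    .load rP aPar rA, .load rV aSum rP, subMod rM rV rV rA, addMod rM rV rV rT, .store aSum rP rV,
    .store aPar rT rP, .store aPar rB rT,
    .load rV aNch rT, .add rV rV rOne, .store aNch rT rV,
    .load rV aSum rT, addMod rM rV rV rB, .store aSum rT rV, .add rNx rNx rOne]

section

variable {H : SimpleGraph ℕ} {X N : Finset ℕ} {Λ : ℕ → Finset ℕ} {par lab : ℕ → ℕ}

/-- The effect of `splitNode`, when the `rK` nodes have been moved by a change of their parents. The
numbers and sums of children stay correct, for the parent of `α` too, which may be `0`. -/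
lemma splitNode_spec {B M α g t b : ℕ} {A : Finset ℕ} {s : Memory} (T : Cotree H X N Λ par lab)
    (C : Counted M N par (s.arr aNch) (s.arr aSum)) (hA : A ⊆ childrenIn par N α)
    (hαN : α ∈ N) (hαα : par α ≠ α) (hgN : g ∉ N) (hg0 : g ≠ 0) (hgM : g < M)
    (hpar : s.arr aPar = fun u => if u ∈ A then g else par u)
    (rα : s.reg rA = α) (rg : s.reg rNx = g) (rk : s.reg rK = A.card) (rs : s.reg rS < M)
    (rs' : (s.reg rS : ZMod M) = ∑ u ∈ A, (u : ZMod M)) (rt : s.reg rT = t) (rb : s.reg rB = b)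
    (r1 : s.reg rOne = 1) (rm : s.reg rM = M) (htb : (t = α ∧ b = g) ∨ (t = g ∧ b = α))
    (hB : 2 * M ≤ B) (hB' : ∀ u ∈ N, s.arr aNch u + 1 ≤ B) :
    splitNode.ok B s ∧ (splitNode.run s).reg rNx = g + 1 ∧
    (splitNode.run s).arr aLab = Function.update (s.arr aLab) g (s.reg rLg) ∧
    (splitNode.run s).arr aPar = Function.update (Function.update (s.arr aPar) t (par α)) b t ∧
    (splitNode.run s).arr aNch = (fun u => if u = g then A.card + (if t = g then 1 else 0) else
      if u = α then s.arr aNch α - A.card + (if t = α then 1 else 0) else s.arr aNch u) ∧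
    (∀ u, u ≠ 0 → u ∉ N → u ≠ g → (splitNode.run s).arr aSum u = s.arr aSum u) ∧
    Counted M (insert g N) ((splitNode.run s).arr aPar) ((splitNode.run s).arr aNch)
      ((splitNode.run s).arr aSum) := by
  have hgα : g ≠ α := by rintro rfl; exact hgN hαN
  have hαA : α ∉ A := fun h => hαα (mem_childrenIn.1 (hA h)).2
  set p := par α with hp
  have hpg : p ≠ g := T.par_notMem_of_notMem hgN hg0 hαN
  have hpN : p = 0 ∨ p ∈ N := or_iff_not_imp_left.2 (T.par_mem α hαN)
  have hα0 : α ≠ 0 := by rintro rfl; exact T.zero hαN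
  have hαM := C.lt α hαN
  have hkc : A.card ≤ s.arr aNch α := C.nch_eq hαN ▸ Finset.card_le_card hA
  have epα : s.arr aPar α = p := by rw [hpar]; simp only [if_neg hαA]; exact hp.symm
  have cα := C.csum_lt α (Or.inr hαN)
  have cp := C.csum_lt p hpN
  have hnα := hB' α hαN
  have hAα : A.card + 1 ≤ B := by omega
  have hAN : A ⊆ N := hA.trans (Finset.filter_subset _ _)
  -- the new values of the sums
  set cα' := subm M (s.arr aSum α) (s.reg rS) with hcα'
  have hcα : cα' < M := subm_lt cα
  set cp' := addm M (subm M (s.arr aSum p) α) t with hcp'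
  have htM : t < M := by rcases htb with ⟨rfl, -⟩ | ⟨rfl, -⟩ <;> assumption
  have hbM : b < M := by rcases htb with ⟨-, rfl⟩ | ⟨-, rfl⟩ <;> assumption
  have hcp : cp' < M := addm_lt (subm_lt cp) htM
  have hcs : subm M (s.arr aSum p) α < M := subm_lt cp
  have hrun : splitNode.ok B s ∧ (splitNode.run s).reg rNx = g + 1 ∧
    (splitNode.run s).arr aLab = Function.update (s.arr aLab) g (s.reg rLg) ∧
    (splitNode.run s).arr aPar = Function.update (Function.update (s.arr aPar) t p) b t ∧
    (splitNode.run s).arr aNch = (fun u => if u = g then A.card + (if t = g then 1 else 0) else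
      if u = α then s.arr aNch α - A.card + (if t = α then 1 else 0) else s.arr aNch u) ∧
    (splitNode.run s).arr aSum = (fun u =>
      if u = g then (if t = g then addm M (s.reg rS) b else s.reg rS) else
      if u = α then (if t = α then addm M cα' b else cα') else
      if u = p then cp' else s.arr aSum u) := by
    rcases htb with ⟨rfl, rfl⟩ | ⟨rfl, rfl⟩
    · refine ⟨?_, ?_, ?_, ?_, ?_, ?_⟩
      · simp [splitNode, rα, rg, rk, rt, rb, r1, rm, hgα, hgα.symm, epα, hαα, hαα.symm, hpg,
          hpg.symm, ← hcα']
        omega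
      · simp [splitNode, rg, r1]
      · simp [splitNode, rg]
      · simp [splitNode, rα, rg, rt, rb, epα]
      · simp [splitNode, rα, rg, rk, rt, rb, r1, hgα, hgα.symm]
        funext u
        by_cases h1 : u = t
        · subst h1; simp [hgα.symm]
        · by_cases h2 : u = b
          · subst h2; simp [h1]
          · simp [h1, h2]
      · simp [splitNode, rα, rg, rt, rb, rm, hgα, hgα.symm, epα, hαα, hαα.symm, hpg,
          hpg.symm, ← hcα', ← hcp']
        funext u
        by_cases h1 : u = t
        · subst h1; simp [hgα.symm]
        · by_cases h2 : u = b
          · subst h2; simp [h1, hpg.symm]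
          · by_cases h3 : u = p
            · subst h3; simp [h1, h2]
            · simp [h1, h2, h3]
    · refine ⟨?_, ?_, ?_, ?_, ?_, ?_⟩
      · simp [splitNode, rα, rg, rk, rt, rb, r1, rm, hgα, hgα.symm, epα, hαα, hαα.symm, hpg,
          hpg.symm, ← hcα']
        omega
      · simp [splitNode, rg, r1]
      · simp [splitNode, rg]
      · simp [splitNode, rα, rg, rt, rb, epα]
      · simp [splitNode, rα, rg, rk, rt, rb, r1, hgα, hgα.symm]
        funext u
        by_cases h1 : u = t
        · subst h1; simp
        · by_cases h2 : u = b
          · subst h2; simp [h1]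
          · simp [h1, h2]
      · simp [splitNode, rα, rg, rt, rb, rm, hgα, hgα.symm, epα, hαα, hαα.symm, hpg,
          hpg.symm, ← hcα', ← hcp']
        funext u
        by_cases h1 : u = t
        · subst h1; simp
        · by_cases h2 : u = b
          · subst h2; simp [h1, hαα.symm]
          · by_cases h3 : u = p
            · subst h3; simp [h1, h2]
            · simp [h1, h2, h3]
  obtain ⟨h1, h2, h3, h4, h5, h6⟩ := hrun
  refine ⟨h1, h2, h3, h4, h5, ?_, ?_⟩
  · intro u hu0 huN hug
    have e1 : u ≠ α := by rintro rfl; exact huN hαN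
    have e2 : u ≠ p := by rintro rfl; exact huN (hpN.resolve_left hu0)
    rw [h6]; simp [hug, e1, e2]
  · -- the parents after the change
    have qA : ∀ u ∈ A, (splitNode.run s).arr aPar u = g := by
      intro u hu
      have e1 : u ≠ α := by rintro rfl; exact hαA hu
      have e2 : u ≠ g := by rintro rfl; exact hgN (hAN hu)
      have e3 : u ≠ t := by rcases htb with ⟨rfl, -⟩ | ⟨rfl, -⟩ <;> assumption
      have e4 : u ≠ b := by rcases htb with ⟨-, rfl⟩ | ⟨-, rfl⟩ <;> assumption
      rw [h4, Function.update_of_ne e4, Function.update_of_ne e3, hpar]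
      simp [hu]
    have qo : ∀ u ∈ N, u ∉ A → u ≠ α → (splitNode.run s).arr aPar u = par u := by
      intro u hu huA e1
      have e2 : u ≠ g := by rintro rfl; exact hgN hu
      have e3 : u ≠ t := by rcases htb with ⟨rfl, -⟩ | ⟨rfl, -⟩ <;> assumption
      have e4 : u ≠ b := by rcases htb with ⟨-, rfl⟩ | ⟨-, rfl⟩ <;> assumption
      rw [h4, Function.update_of_ne e4, Function.update_of_ne e3, hpar]
      simp [huA]
    have hsum : ∀ {R : Type} [AddCommGroup R] (f : ℕ → R) (r : ℕ), _ := fun {R} _ f r =>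
      childSum_split (par := par) (par' := (splitNode.run s).arr aPar) f hgN hαN hAN hαA
        (fun u hu => (mem_childrenIn.1 (hA hu)).2) qA qo r
    have hg_no : ∀ {R : Type} [AddCommGroup R] (f : ℕ → R), childSum N par f g = 0 := by
      intro R _ f
      unfold childSum
      refine Finset.sum_eq_zero fun u hu => ?_
      obtain ⟨hu, hpu⟩ := Finset.mem_filter.1 hu
      exact absurd hpu (T.par_notMem_of_notMem hgN hg0 hu)
    have qt : (splitNode.run s).arr aPar t = p := by
      have : t ≠ b := by rcases htb with ⟨rfl, rfl⟩ | ⟨rfl, rfl⟩; exacts [hgα.symm, hgα]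
      rw [h4, Function.update_of_ne this, Function.update_self]
    have qb : (splitNode.run s).arr aPar b = t := by rw [h4, Function.update_self]
    refine ⟨?_, ?_, ?_, ?_⟩
    · intro r hr
      rw [hsum, h5]
      rcases Finset.mem_insert.1 hr with rfl | hrN
      · rw [hg_no]
        rcases htb with ⟨rfl, rfl⟩ | ⟨rfl, rfl⟩
        · simp [qt, qb, hgα, hgα.symm, hpg, hαα, ← hp]
        · simp [qt, qb, hgα, hgα.symm, hpg, hαα, ← hp]; ring
      · have hrg : r ≠ g := by rintro rfl; exact hgN hrN
        have hn := C.nch r hrN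
        rcases htb with ⟨rfl, rfl⟩ | ⟨rfl, rfl⟩
        · rw [qt, qb]
          by_cases hrα : r = t
          · subst hrα
            simp [hgα, hgα.symm, hαα, ← hp]
            rw [Nat.cast_sub hkc, hn]; ring
          · simp [hrg, hrα, hrg.symm, Ne.symm hrα, ← hp, hn]
        · rw [qt, qb]
          by_cases hrα : r = b
          · subst hrα
            simp [hgα, hgα.symm, hαα, ← hp]
            rw [Nat.cast_sub hkc, hn]; ring
          · simp [hrg, hrα, hrg.symm, Ne.symm hrα, ← hp, hn]
    · intro r hr
      rw [h6]
      simp only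
      split_ifs
      · exact addm_lt rs hbM
      · exact rs
      · exact addm_lt hcα hbM
      · exact hcα
      · exact hcp
      · refine C.csum_lt r ?_
        rcases hr with hr | hr
        · exact Or.inl hr
        · exact Or.inr (Finset.mem_of_mem_insert_of_ne hr (by assumption))
    · intro r hr
      rw [hsum, h6]
      by_cases hrg : r = g
      · subst hrg
        rw [hg_no]
        rcases htb with ⟨rfl, rfl⟩ | ⟨rfl, rfl⟩
        · simp [qt, qb, hgα, hgα.symm, hpg, hαα, ← hp, rs']
        · simp [qt, qb, hgα, hgα.symm, hpg, hαα, ← hp, rs', cast_addm]; ring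
      · have hrN : r = 0 ∨ r ∈ N := hr.imp id fun h => Finset.mem_of_mem_insert_of_ne h hrg
        have hn := C.csum r hrN
        have hcast : (cα' : ZMod M) = (s.arr aSum α : ZMod M) - ∑ u ∈ A, (u : ZMod M) := by
          rw [hcα', cast_subm rs, rs']
        have hcast' : (cp' : ZMod M) = (s.arr aSum p : ZMod M) - α + t := by
          rw [hcp', cast_addm, cast_subm hαM]
        rcases htb with ⟨rfl, rfl⟩ | ⟨rfl, rfl⟩
        · rw [qt, qb]
          by_cases hrα : r = t
          · subst hrα
            simp [hgα, hgα.symm, hαα, ← hp, cast_addm, hcast, hn]; ring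
          · by_cases hrp : r = p
            · subst hrp
              simp [hrg, hrα, Ne.symm hrg, Ne.symm hrα, ← hp, hn, hcast']
            · simp [hrg, hrα, Ne.symm hrg, Ne.symm hrα, ← hp, hn, hrp, Ne.symm hrp]
        · rw [qt, qb]
          by_cases hrα : r = b
          · subst hrα
            simp [hgα, hgα.symm, hαα, ← hp, hcast, hn]; ring
          · by_cases hrp : r = p
            · subst hrp
              simp [hrg, hrα, Ne.symm hrg, Ne.symm hrα, ← hp, hn, hcast']; ring
            · simp [hrg, hrα, Ne.symm hrg, Ne.symm hrα, ← hp, hn, hrp, Ne.symm hrp]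
    · intro u hu
      rcases Finset.mem_insert.1 hu with rfl | hu
      · exact hgM
      · exact C.lt u hu

end

/-! ### Where to insert a vertex -/

/-- The arrays of `s` hold a cotree without inner nodes of only one child, and all cells of other
nodes still hold `0`. -/
structure Tree (H : SimpleGraph ℕ) (M : ℕ) (X N : Finset ℕ) (Λ : ℕ → Finset ℕ) (s : Memory) :
    Prop where
  cotree : Cotree H X N Λ (s.arr aPar) (s.arr aLab)
  counted : Counted M N (s.arr aPar) (s.arr aNch) (s.arr aSum)
  two : ∀ p ∈ N, p ∉ X → 2 ≤ s.arr aNch p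
  fresh : ∀ u, u ∉ N → s.arr aLab u = 0 ∧ s.arr aNch u = 0 ∧ (u ≠ 0 → s.arr aSum u = 0)

/-- The new vertex `x` is to be inserted next to the node `c`, under a common parent with
label `l`. The label of `c` may be that of its parent, as it is after the children of a pivot have
been divided; the insertion of a node with label `l` in between repairs this. -/
structure Place (H : SimpleGraph ℕ) (X N : Finset ℕ) (Λ : ℕ → Finset ℕ) (par lab : ℕ → ℕ)
    (x c l : ℕ) : Prop where
  mem : c ∈ N
  label : l = 1 ∨ l = 2
  adj : ∀ v ∈ Λ c, H.Adj x v ↔ l = 2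
  twin : ∀ w ∈ Λ c, ∀ v ∈ X, v ∉ Λ c → (H.Adj x v ↔ H.Adj w v)
  alt : ∀ u ∈ N, u ≠ c → par u ≠ 0 → lab u ≠ lab (par u)
  par_ne : par c ≠ 0 → lab (par c) ≠ l

section

variable {H : SimpleGraph ℕ} {M : ℕ} {X N : Finset ℕ} {Λ : ℕ → Finset ℕ} {par lab : ℕ → ℕ}

lemma Tree.nch_eq {s : Memory} (h : Tree H M X N Λ s) : ∀ p ∈ N,
    s.arr aNch p = (childrenIn (s.arr aPar) N p).card := fun _ hp => h.counted.nch_eq hp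

lemma Tree.strict {s : Memory} (h : Tree H M X N Λ s) : Strict N Λ (s.arr aPar) := by
  refine h.cotree.strict_of_two fun u hu h0 => ?_
  have hp := h.cotree.par_mem u hu h0
  have h2 := h.two _ hp (h.cotree.par_leaf u hu)
  rw [h.nch_eq _ hp] at h2
  obtain ⟨w, hw, hne⟩ := Finset.exists_mem_ne h2 u
  obtain ⟨hw, hpw⟩ := mem_childrenIn.1 hw
  exact ⟨w, hw, hne, hpw⟩

lemma Strict.par_ne {u : ℕ} (hs : Strict N Λ par) (h0 : 0 ∉ N) (hu : u ∈ N) : par u ≠ u := by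
  intro h
  have := hs u hu (by rw [h]; rintro rfl; exact h0 hu)
  rw [h] at this
  exact ssubset_irrefl _ this

lemma Tree.nch_le {s : Memory} (h : Tree H M X N Λ s) : ∀ p ∈ N, s.arr aNch p ≤ M := by
  intro p hp
  rw [h.nch_eq p hp]
  refine (Finset.card_filter_le _ _).trans ?_
  have : N ⊆ Finset.range M := fun u hu => Finset.mem_range.2 (h.counted.lt u hu)
  simpa using Finset.card_le_card this

/-- A child of the pivot lies on the side of `x` if it is full below a union, or empty below
a join. -/
def OnSide (H : SimpleGraph ℕ) (Λ : ℕ → Finset ℕ) (lab : ℕ → ℕ) (x α u : ℕ) : Prop :=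
  (∀ v ∈ Λ u, H.Adj x v) ↔ lab α = 1

lemma Cotree.Pivot.onSide {x α u : ℕ}
    (h : Cotree.Pivot H N Λ par x α) (hu : u ∈ N) (hpu : par u = α) (ho : OnSide H Λ lab x α u) :
    ∀ v ∈ Λ u, H.Adj x v ↔ lab α = 1 := by
  intro v hv
  rcases h.children u hu hpu with h' | h'
  · exact ⟨fun _ => ho.1 h', fun _ => h' v hv⟩
  · refine ⟨fun h'' => absurd h'' (h' v hv), fun hl => ho.2 hl v hv⟩

lemma Cotree.Pivot.not_onSide {x α u : ℕ}
    (h : Cotree.Pivot H N Λ par x α) (hu : u ∈ N) (hpu : par u = α)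
    (ho : ¬ OnSide H Λ lab x α u) : ∀ v ∈ Λ u, ¬ (H.Adj x v ↔ lab α = 1) := by
  intro v hv hiff
  refine ho ?_
  rcases h.children u hu hpu with h' | h'
  · exact ⟨fun _ => hiff.1 (h' v hv), fun _ => h'⟩
  · exact ⟨fun h'' => hiff.1 (h'' v hv), fun hl => absurd (hiff.2 hl) (h' v hv)⟩

/-- If only one child of the pivot is on the side of `x`, then `x` is placed next to it. -/
lemma Cotree.Pivot.place_child (T : Cotree H X N Λ par lab) (hs : Strict N Λ par)
    (hal : Alternating N par lab) (hH : P4Free H) {x α c l : ℕ} (h : Cotree.Pivot H N Λ par x α)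
    (hc : c ∈ N) (hpc : par c = α) (ho : OnSide H Λ lab x α c)
    (huniq : ∀ u ∈ N, par u = α → OnSide H Λ lab x α u → u = c)
    (hl : l = if lab α < 2 then 2 else 1) : Place H X N Λ par lab x c l := by
  have hlα := T.lab_node α h.mem (h.notMem T)
  have hcα : Λ c ⊆ Λ α := hpc ▸ T.par_sub c hc (fun h0 => T.zero (h0 ▸ hpc ▸ h.mem))
  have hside := h.onSide hc hpc ho
  refine ⟨hc, by split_ifs at hl <;> omega, fun v hv => ?_, fun w hw v hv hvc => ?_,
    fun u hu _ => hal u hu, fun _ => by rw [hpc]; split_ifs at hl <;> omega⟩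
  · rw [hside v hv]; split_ifs at hl <;> omega
  · refine T.pivot_part_twin hs hal hH h hv ?_ (hcα hw) (hside w hw)
    rintro ⟨hvα, hiff⟩
    obtain ⟨u, hu, hpu, hvu⟩ := T.child α h.mem (h.notMem T) v hvα
    by_cases hou : OnSide H Λ lab x α u
    · exact hvc (huniq u hu hpu hou ▸ hvu)
    · exact h.not_onSide hu hpu hou v hvu hiff

open Classical in
/-- The leaves below the pivot that are on the side of `x`. -/
noncomputable def sideLeaves (H : SimpleGraph ℕ) (Λ : ℕ → Finset ℕ) (lab : ℕ → ℕ) (x α : ℕ) :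
    Finset ℕ := (Λ α).filter fun v => (H.Adj x v ↔ lab α = 1)

lemma mem_sideLeaves {x α v : ℕ} :
    v ∈ sideLeaves H Λ lab x α ↔ v ∈ Λ α ∧ (H.Adj x v ↔ lab α = 1) := by
  classical exact Finset.mem_filter

/-- Otherwise the children on the side of `x` get a parent `b` of their own, with the label of the
pivot, and `x` is placed next to `b`. -/
lemma Cotree.Pivot.place_split (T : Cotree H X N Λ par lab) (hs : Strict N Λ par)
    (hal : Alternating N par lab) (hH : P4Free H) {x α l g t b : ℕ} {par' lab' : ℕ → ℕ}
    (h : Cotree.Pivot H N Λ par x α) (hg : g ∉ N) (hg0 : g ≠ 0)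
    (htb : (t = α ∧ b = g) ∨ (t = g ∧ b = α))
    (hside : ∀ u ∈ N, par u = α → OnSide H Λ lab x α u → par' u = b)
    (hside' : ∀ u ∈ N, par u = α → ¬ OnSide H Λ lab x α u → par' u = t)
    (hne : ∃ u ∈ N, par u = α ∧ OnSide H Λ lab x α u)
    (hpt : par' t = par α) (hpb : par' b = t)
    (hpo : ∀ u ∈ N, u ≠ α → par u ≠ α → par' u = par u) (hp0 : par' 0 = 0)
    (hlab : ∀ u ∈ N, lab' u = lab u) (hlg : lab' g = lab α)
    (hl : l = if lab α < 2 then 2 else 1) :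
    ∃ Λ', Cotree H X (insert g N) Λ' par' lab' ∧ Place H X (insert g N) Λ' par' lab' x b l := by
  have hαN := h.mem
  have hαX := h.notMem T
  have hα0 : α ≠ 0 := fun h0 => T.zero (h0 ▸ hαN)
  have hgα : g ≠ α := fun h' => hg (h' ▸ hαN)
  have hlα := T.lab_node α hαN hαX
  have hsub : ∀ u ∈ N, par u = α → Λ u ⊆ Λ α := fun u hu hpu => hpu ▸ T.par_sub u hu (hpu ▸ hα0)
  obtain ⟨u₀, hu₀, hpu₀, ho₀⟩ := hne
  obtain ⟨v₀, hv₀⟩ := T.nonempty u₀ hu₀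
  have hαα := hs.par_ne T.zero hαN
  have T' := T.split (S := sideLeaves H Λ lab x α) hαN hαα hg hg0 htb
    (fun v hv => (mem_sideLeaves.1 hv).1)
    ⟨v₀, mem_sideLeaves.2 ⟨hsub u₀ hu₀ hpu₀ hv₀, h.onSide hu₀ hpu₀ ho₀ v₀ hv₀⟩⟩ (by
      intro u hu hpu
      by_cases ho : OnSide H Λ lab x α u
      · exact Or.inl ⟨fun v hv => mem_sideLeaves.2 ⟨hsub u hu hpu hv, h.onSide hu hpu ho v hv⟩,
          hside u hu hpu ho⟩
      · refine Or.inr ⟨Finset.disjoint_left.2 fun v hv hv' => ?_, hside' u hu hpu ho⟩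
        exact h.not_onSide hu hpu ho v hv (mem_sideLeaves.1 hv').2)
    (fun h => absurd h hαX) hpt hpb hpo hp0 hlab (Or.inl ⟨hlg, hαX⟩)
  refine ⟨_, T', ?_⟩
  have hbt : b ≠ t := by rcases htb with ⟨rfl, rfl⟩ | ⟨rfl, rfl⟩; exacts [hgα, hgα.symm]
  have hlt : lab' t = lab α := by
    rcases htb with ⟨rfl, rfl⟩ | ⟨rfl, rfl⟩; exacts [hlab _ hαN, hlg]
  have hlb : lab' b = lab α := by
    rcases htb with ⟨rfl, rfl⟩ | ⟨rfl, rfl⟩; exacts [hlg, hlab _ hαN]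
  refine ⟨?_, by split_ifs at hl <;> omega, fun v hv => ?_, fun w hw v hv hvc => ?_,
    fun u hu hub h0 => ?_, fun _ => by rw [hpb, hlt]; split_ifs at hl <;> omega⟩
  · rcases htb with ⟨-, rfl⟩ | ⟨-, rfl⟩ <;> simp [hαN]
  · simp only [if_true] at hv
    rw [(mem_sideLeaves.1 hv).2]; split_ifs at hl <;> omega
  · simp only [if_true] at hw hvc
    obtain ⟨hwα, hwx⟩ := mem_sideLeaves.1 hw
    exact T.pivot_part_twin hs hal hH h hv (fun h' => hvc (mem_sideLeaves.2 h')) hwα hwx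
  · by_cases hut : u = t
    · subst hut
      rw [hpt] at h0 ⊢
      rw [hlt, hlab _ (T.par_mem α hαN h0)]
      exact hal α hαN h0
    · have hug : u ≠ α ∧ u ≠ g := by
        rcases htb with ⟨rfl, rfl⟩ | ⟨rfl, rfl⟩
        · exact ⟨hut, hub⟩
        · exact ⟨hub, hut⟩
      have huN := Finset.mem_of_mem_insert_of_ne hu hug.2
      by_cases hpu : par u = α
      · have h1 := hal u huN (hpu ▸ hα0)
        rw [hpu] at h1
        have h2 : lab' (par' u) = lab α := by
          by_cases ho : OnSide H Λ lab x α u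
          · rw [hside u huN hpu ho, hlb]
          · rw [hside' u huN hpu ho, hlt]
        rwa [h2, hlab u huN]
      · rw [hpo u huN hug.1 hpu] at h0 ⊢
        rw [hlab u huN, hlab _ (T.par_mem u huN h0)]
        exact hal u huN h0

end

/-! ### Programs for the insertion -/

/-- Preparation of the move: `rK` children of the pivot are full, and `rD` are on the side of `x`. If
the latter is only one, no new node is needed, and the move does not move anything. -/
def chooseInit : Program :=
  block [.load rK aCnt rA, .load rLg aLab rA,
    .ifLt rLg rTwo (.copy rD rK) (block [.load rD aNch rA, .sub rD rD rK]),
    .ifLt rD rTwo (.copy rG rA) (.copy rG rNx), .copy rS rZero, .copy rI rZero]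

/-- The place is the only child on the side of `x`, or the lower one of the two nodes between which
the children of the pivot have been divided. The full children have moved to the new node, so that
this is the lower node below a union, and the upper one below a join. -/
def chooseEnd : Program :=
  block [
    .ifLt rD rTwo
      (.ifLt rLg rTwo (.copy rC rF) (block [.load rC aSum rA, subMod rM rC rC rS]))
      (block [
        .ifLt rLg rTwo (block [.copy rT rA, .copy rB rNx]) (block [.copy rT rNx, .copy rB rA]),
        splitNode, .copy rC rB]),
    .ifLt rLg rTwo (.copy rL rTwo) (.copy rL rOne)]

/-- If there is no pivot, then the root, which is the only child of `0`, either is full, and then it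
has touched `0`, or has no neighbour of `x` below it. -/
def chooseRoot : Program :=
  block [.load rC aSum rZero, .load rV aSt rZero, .ifLt rV rX (.copy rL rOne) (.copy rL rTwo)]

/-- The place of the new vertex is computed from the pivot, or from the root if there is no pivot:
it is next to node `rC`, below a node with label `rL`. -/
def choosePlace : Program :=
  .ifLt rZero rA (.seq chooseInit (.seq move chooseEnd)) chooseRoot

/-- A new node `rNx` with label `rL` is put on the edge above the node `rC`, and is called `rC`. -/
def raise : Program :=
  block [.copy rA rC, .copy rK rZero, .copy rS rZero, .copy rLg rL, .copy rT rNx, .copy rB rC,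
    splitNode, .copy rC rT]

/-- The leaf `rX` becomes a child of the node `rC`. -/
def hang : Program :=
  block [.store aPar rX rC, .load rV aNch rC, .add rV rV rOne, .store aNch rC rV,
    .load rV aSum rC, addMod rM rV rV rX, .store aSum rC rV]

/-- The new leaf `rX` is inserted next to the node `rC`: it becomes a child of the node with
label `rL` that is `rC` or has to be put above `rC`. -/
def attachLeaf : Program :=
  .seq (.load rV aLab rC) (.seq (ifEq rV rL .skip raise) hang)

section

variable {H : SimpleGraph ℕ} {M : ℕ} {X N : Finset ℕ} {Λ : ℕ → Finset ℕ}

/-- The registers that stay fixed while the vertex `x` is inserted. -/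
structure Consts (M x : ℕ) (s : Memory) : Prop where
  one : s.reg rOne = 1
  two : s.reg rTwo = 2
  zero : s.reg rZero = 0
  mod : s.reg rM = M
  cur : s.reg rX = x

lemma Consts.of_agree {P : Program} {x : ℕ} {s s' : Memory} (h : Consts M x s) (ha : Agree P s s')
    (hP : rOne ∉ P.regs ∧ rTwo ∉ P.regs ∧ rZero ∉ P.regs ∧ rM ∉ P.regs ∧ rX ∉ P.regs) :
    Consts M x s' :=
  ⟨(ha.1 _ hP.1).trans h.one, (ha.1 _ hP.2.1).trans h.two, (ha.1 _ hP.2.2.1).trans h.zero,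
    (ha.1 _ hP.2.2.2.1).trans h.mod, (ha.1 _ hP.2.2.2.2).trans h.cur⟩

/-- The result of `choosePlace`. -/
def Placed (H : SimpleGraph ℕ) (M : ℕ) (X N : Finset ℕ) (x nx : ℕ) (s : Memory) : Prop :=
  ∃ N' Λ', Tree H M X N' Λ' s ∧
    Place H X N' Λ' (s.arr aPar) (s.arr aLab) x (s.reg rC) (s.reg rL) ∧
    ((N' = N ∧ s.reg rNx = nx) ∨ (N' = insert nx N ∧ s.reg rNx = nx + 1))

lemma runs_chooseRoot {B x nx : ℕ} {s : Memory} (h : Tree H M X N Λ s)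
    (hal : Alternating N (s.arr aPar) (s.arr aLab)) (hX : X.Nonempty) (hc : Consts M x s)
    (hM : Marked X N (s.arr aPar) x s (fullNodes N Λ (nbrs H X x)) (fullNodes N Λ (nbrs H X x)))
    (hno : ∀ α, ¬ Cotree.Pivot H N Λ (s.arr aPar) x α) (hnx : s.reg rNx = nx) :
    Runs B chooseRoot s 5 (Placed H M X N x nx) := by
  have T := h.cotree
  obtain ⟨r, hr, hr0, hru⟩ := T.exists_root h.strict hX
  have hch : N.filter (fun u => s.arr aPar u = 0) = {r} := by
    ext u
    simp only [Finset.mem_filter, Finset.mem_singleton]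
    exact ⟨fun hu => hru u hu.1 hu.2, fun hu => hu ▸ ⟨hr, hr0⟩⟩
  have hsum : s.arr aSum 0 = r := by
    refine eq_of_cast_eq (h.counted.csum_lt 0 (Or.inl rfl)) (h.counted.lt r hr) ?_
    rw [h.counted.csum 0 (Or.inl rfl)]
    unfold childSum
    rw [hch, Finset.sum_singleton]
  have hΛ : Λ r = X := T.root r hr hr0
  refine .straight rfl ?_ (by simp [chooseRoot, Program.cost]) ⟨N, Λ, ?_, ?_, Or.inl ⟨rfl, ?_⟩⟩
  · simp [chooseRoot]
  · have ha := agree_run chooseRoot s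
    have q : ∀ a, (chooseRoot.run s).arr a = s.arr a := fun a =>
      ha.2 a (by simp [chooseRoot, Program.arrs])
    exact ⟨by rw [q, q]; exact T, by rw [q, q, q]; exact h.counted, by rw [q]; exact h.two,
      by rw [q, q, q]; exact h.fresh⟩
  · have ha := agree_run chooseRoot s
    have q : ∀ a, (chooseRoot.run s).arr a = s.arr a := fun a =>
      ha.2 a (by simp [chooseRoot, Program.arrs])
    have e1 : (chooseRoot.run s).reg rC = r := by
      simp [chooseRoot, hc.zero, hsum]
      split_ifs <;> simp
    have e2 : (chooseRoot.run s).reg rL = if s.arr aSt 0 < x then 1 else 2 := by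
      simp [chooseRoot, hc.zero, hc.one, hc.two, hc.cur]
      split_ifs <;> simp
    rw [q, q, e1, e2]
    refine ⟨hr, by split_ifs <;> simp, fun v hv => ?_, fun w _ v hv hvr => absurd (hΛ ▸ hv) hvr,
      fun u hu _ => hal u hu, fun h0 => absurd hr0 h0⟩
    have hiff : s.arr aSt 0 < x ↔ r ∉ fullNodes N Λ (nbrs H X x) := by
      constructor
      · intro hlt hrf
        have := hM.stamp_pos 0 (Finset.card_pos.2 ⟨r, mem_childrenIn.2 ⟨hrf, hr0⟩⟩)
        omega
      · intro hrf
        refine hM.stamp_zero 0 (Finset.card_eq_zero.2 (Finset.eq_empty_of_forall_notMem ?_))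
        intro w hw
        obtain ⟨hw, hpw⟩ := mem_childrenIn.1 hw
        exact hrf (hru w (mem_fullNodes.1 hw).1 hpw ▸ hw)
    by_cases hfull : r ∈ fullNodes N Λ (nbrs H X x)
    · rw [if_neg fun h' => hiff.1 h' hfull]
      simpa using (T.subset_nbrs hr).1 (mem_fullNodes.1 hfull).2 v hv
    · rw [if_pos (hiff.2 hfull)]
      have h2 : ∃ v ∈ Λ r, ¬ H.Adj x v := by
        by_contra hcon
        push Not at hcon
        exact hfull (mem_fullNodes.2 ⟨hr, (T.subset_nbrs hr).2 hcon⟩)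
      simp only [show ¬ (1 = 2) by decide, iff_false]
      intro hxv
      obtain ⟨α, hα⟩ := T.exists_pivot hr ⟨v, hv, hxv⟩ h2 h.strict
      exact hno α hα
  · simp [chooseRoot]
    split_ifs <;> simp [hnx]

end

section

variable {H : SimpleGraph ℕ} {M : ℕ} {X N : Finset ℕ} {Λ : ℕ → Finset ℕ}

/-- From the pivot to the place of `x`, by `Cotree.Pivot.place_child` if only one child of the pivot
is on the side of `x`, and by `Cotree.Pivot.place_split` otherwise. -/
lemma runs_choosePivot {B x nx : ℕ} {s : Memory} (h : Tree H M X N Λ s)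
    (hal : Alternating N (s.arr aPar) (s.arr aLab)) (hH : P4Free H) (hc : Consts M x s)
    (hM : Marked X N (s.arr aPar) x s (fullNodes N Λ (nbrs H X x)) (fullNodes N Λ (nbrs H X x)))
    (hp : Cotree.Pivot H N Λ (s.arr aPar) x (s.reg rA)) (hnx : s.reg rNx = nx) (hnxN : nx ∉ N)
    (hnx0 : nx ≠ 0) (hnxM : nx < M) (hB : 2 * M + 2 ≤ B) (hNM : N.card < M) :
    Runs B (.seq chooseInit (.seq move chooseEnd)) s (12 * s.reg rQn + 60)
      (Placed H M X N x nx) := by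
  have T := h.cotree
  set par := s.arr aPar with hpar
  set lab := s.arr aLab with hlab
  set α := s.reg rA with hα
  set F := fullNodes N Λ (nbrs H X x) with hF
  set A := childrenIn par F α with hA
  set ch := childrenIn par N α with hch
  have hαN := hp.mem
  have hαX := hp.notMem T
  have hα0 : α ≠ 0 := fun h0 => T.zero (h0 ▸ hαN)
  have hαM := h.counted.lt α hαN
  have hFN : F ⊆ N := Finset.filter_subset _ _
  have hAch : A ⊆ ch := Finset.filter_subset_filter _ hFN
  have hlα := T.lab_node α hαN hαX
  have hnα : s.arr aNch α = ch.card := h.nch_eq α hαN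
  have hαα := h.strict.par_ne T.zero hαN
  have mem_A : ∀ {u}, u ∈ A ↔ u ∈ N ∧ par u = α ∧ ∀ v ∈ Λ u, H.Adj x v := by
    intro u
    rw [hA, mem_childrenIn, hF, mem_fullNodes]
    constructor
    · rintro ⟨⟨h1, h2⟩, h3⟩; exact ⟨h1, h3, (T.subset_nbrs h1).1 h2⟩
    · rintro ⟨h1, h2, h3⟩; exact ⟨⟨h1, (T.subset_nbrs h1).2 h3⟩, h2⟩
  obtain ⟨uf, huf, hpuf, hfull⟩ := (hp.candidate T).2.1
  have hApos : 0 < A.card := Finset.card_pos.2 ⟨uf, mem_A.2 ⟨huf, hpuf, hfull⟩⟩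
  have hAlt : A.card < ch.card := by
    refine Finset.card_lt_card (hAch.ssubset_of_ne fun he => ?_)
    obtain ⟨e, he', hxe⟩ := hp.exists_not_adj
    obtain ⟨u, hu, hpu, heu⟩ := T.child α hαN hαX e he'
    exact hxe ((mem_A.1 (he ▸ mem_childrenIn.2 ⟨hu, hpu⟩ : u ∈ A)).2.2 e heu)
  have hk : s.arr aCnt α = A.card := hM.cnt α hApos
  have side_iff : ∀ u ∈ N, par u = α → (OnSide H Λ lab x α u ↔ (u ∈ A ↔ lab α = 1)) := by
    intro u hu hpu
    unfold OnSide
    rw [mem_A]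
    simp [hu, hpu]
  set d := if lab α < 2 then A.card else ch.card - A.card with hd
  have hd0 : 0 < d := by rw [hd]; split_ifs <;> omega
  -- before the children are moved
  have hs₁ : (chooseInit.run s).reg rK = A.card ∧ (chooseInit.run s).reg rLg = lab α ∧
      (chooseInit.run s).reg rD = d ∧ (chooseInit.run s).reg rG = (if d < 2 then α else nx) ∧
      (chooseInit.run s).reg rS = 0 ∧ (chooseInit.run s).reg rI = 0 := by
    rcases hlα with hl1 | hl2
    · have hdA : d = A.card := if_pos (by omega)
      have hrun : chooseInit.run s = (((((s.setReg rK A.card).setReg rLg 1).setReg rD A.card).setReg rG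
          (if d < 2 then α else nx)).setReg rS 0).setReg rI 0 := by
        by_cases hd2 : A.card < 2 <;>
          simp [chooseInit, ← hα, ← hlab, hc.two, hc.zero, hnx, hk, hl1, hdA, hd2]
      rw [hrun]; simp [hl1, hdA]
    · have hdA : d = ch.card - A.card := if_neg (by omega)
      have hrun : chooseInit.run s = ((((((s.setReg rK A.card).setReg rLg 2).setReg rD ch.card).setReg
          rD (ch.card - A.card)).setReg rG (if d < 2 then α else nx)).setReg rS 0).setReg rI 0 := by
        by_cases hd2 : ch.card - A.card < 2 <;>
          simp [chooseInit, ← hα, ← hlab, hc.two, hc.zero, hnx, hk, hnα, hl2, hdA, hd2]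
      rw [hrun]; simp [hl2, hdA]
  have hok₁ : chooseInit.ok B s := by
    simp [chooseInit]
  refine Runs.seq (T₁ := 15) (T₂ := 12 * s.reg rQn + 45) (R := fun s₁ => s₁ = chooseInit.run s)
    (.straight rfl hok₁ (by simp [chooseInit, Program.cost]) rfl) ?_ (by omega)
  rintro s₁ a₁ rfl
  set s₁ := chooseInit.run s with hs₁'
  obtain ⟨k₁, lg₁, d₁, g₁, S₁, I₁⟩ := hs₁
  have q₁ : ∀ a, s₁.arr a = s.arr a := fun a => a₁.2 a (by simp [chooseInit, Program.arrs])
  have hc₁ : Consts M x s₁ := hc.of_agree a₁ (by decide)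
  have A₁ : s₁.reg rA = α := a₁.1 rA (by decide)
  have nx₁ : s₁.reg rNx = nx := (a₁.1 rNx (by decide)).trans hnx
  have qn₁ : s₁.reg rQn = s.reg rQn := a₁.1 rQn (by decide)
  have hqn : s.reg rQn ≤ N.card := by
    rw [← hM.queue.2]; exact Finset.card_le_card hFN
  have hmove := runs_move (B := B) (M := M) (A := F) (s := s₁) (by rw [q₁, qn₁]; exact hM.queue) I₁ S₁
    hc₁.one hc₁.mod (fun u hu => h.counted.lt u (hFN hu)) (by omega) (by omega) (by rw [qn₁]; omega)
  rw [q₁, A₁, qn₁, g₁] at hmove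
  refine hmove.seq (T₂ := 44) ?_ (by omega)
  rintro s₂ a₂ ⟨par₂, S₂, S₂', F₂⟩
  rw [← hpar, ← hA] at par₂ S₂' F₂
  have q₂ : ∀ a, a ≠ aPar → s₂.arr a = s.arr a := fun a ha => by
    rw [a₂.2 a (by simpa [move, moveBody, Program.arrs, ifEq, addMod] using ha), q₁]
  have hc₂ : Consts M x s₂ := hc₁.of_agree a₂ (by decide)
  have A₂ : s₂.reg rA = α := (a₂.1 rA (by decide)).trans A₁
  have nx₂ : s₂.reg rNx = nx := (a₂.1 rNx (by decide)).trans nx₁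
  have k₂ : s₂.reg rK = A.card := (a₂.1 rK (by decide)).trans k₁
  have lg₂ : s₂.reg rLg = lab α := (a₂.1 rLg (by decide)).trans lg₁
  have d₂ : s₂.reg rD = d := (a₂.1 rD (by decide)).trans d₁
  have hαs : (s.arr aSum α) < M := h.counted.csum_lt α (Or.inr hαN)
  set l := if lab α < 2 then 2 else 1 with hl
  by_cases hd2 : d < 2
  · -- one child on the side of `x`
    have hpar₂ : s₂.arr aPar = par := by
      rw [par₂, if_pos hd2]
      funext u
      split_ifs with hu
      · exact (mem_A.1 hu).2.1.symm
      · rfl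
    have hd1 : d = 1 := by omega
    have hrun : ∃ c, (chooseEnd.run s₂).reg rC = c ∧ c ∈ N ∧ par c = α ∧ OnSide H Λ lab x α c ∧
        ∀ u ∈ N, par u = α → OnSide H Λ lab x α u → u = c := by
      rcases hlα with hl1 | hl2
      · have hA1 : A.card = 1 := by rw [hd, if_pos (by omega)] at hd1; exact hd1
        have hF := F₂ ⟨uf, mem_A.2 ⟨huf, hpuf, hfull⟩⟩
        obtain ⟨c, hcA⟩ := Finset.card_eq_one.1 hA1
        refine ⟨s₂.reg rF, ?_, (mem_A.1 hF).1, (mem_A.1 hF).2.1, ?_, ?_⟩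
        · simp [chooseEnd, d₂, hd1, lg₂, hc₂.two, hl1]
        · rw [side_iff _ (mem_A.1 hF).1 (mem_A.1 hF).2.1]
          exact ⟨fun _ => hl1, fun _ => hF⟩
        · intro u hu hpu ho
          have := ((side_iff u hu hpu).1 ho).2 hl1
          rw [hcA, Finset.mem_singleton] at this hF
          rw [this, hF]
      · have hB1 : (ch \ A).card = 1 := by
          rw [hd, if_neg (by omega)] at hd1
          rw [Finset.card_sdiff_of_subset hAch, hd1]
        obtain ⟨c, hcB⟩ := Finset.card_eq_one.1 hB1
        have hcm : c ∈ ch \ A := hcB ▸ Finset.mem_singleton_self c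
        obtain ⟨hcch, hcA⟩ := Finset.mem_sdiff.1 hcm
        obtain ⟨hcN, hpc⟩ := mem_childrenIn.1 hcch
        refine ⟨c, ?_, hcN, hpc, ?_, ?_⟩
        · have e : (chooseEnd.run s₂).reg rC = subm M (s.arr aSum α) (s₂.reg rS) := by
            simp [chooseEnd, d₂, hd1, lg₂, hc₂.two, hl2, A₂, hc₂.mod, q₂]
          rw [e]
          refine eq_of_cast_eq (subm_lt hαs) (h.counted.lt c hcN) ?_
          rw [cast_subm S₂, S₂', h.counted.csum α (Or.inr hαN)]
          have : childSum N par (fun u => (u : ZMod M)) α = ∑ u ∈ ch \ A, (u : ZMod M) +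
              ∑ u ∈ A, (u : ZMod M) := (Finset.sum_sdiff hAch).symm
          rw [this, hcB]; simp
        · rw [side_iff c hcN hpc]
          exact ⟨fun h' => absurd h' hcA, fun h' => by omega⟩
        · intro u hu hpu ho
          have huA : u ∉ A := fun h' => by
            have := ((side_iff u hu hpu).1 ho).1 h'; omega
          have : u ∈ ch \ A := Finset.mem_sdiff.2 ⟨mem_childrenIn.2 ⟨hu, hpu⟩, huA⟩
          rw [hcB, Finset.mem_singleton] at this
          exact this
    obtain ⟨c, ec, hcN, hpc, ho, huniq⟩ := hrun
    have ea : ∀ a, (chooseEnd.run s₂).arr a = s₂.arr a := by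
      intro a
      simp [chooseEnd, d₂, hd1, hc₂.two]
      split_ifs <;> simp
    have el : (chooseEnd.run s₂).reg rL = l := by
      rw [hl]
      rcases hlα with hl1 | hl2
      · simp [chooseEnd, d₂, hd1, lg₂, hc₂.two, hl1]
      · simp [chooseEnd, d₂, hd1, lg₂, hc₂.two, hl2, hc₂.one]
    have enx : (chooseEnd.run s₂).reg rNx = nx := by
      rw [← nx₂]
      rcases hlα with hl1 | hl2
      · simp [chooseEnd, d₂, hd1, lg₂, hc₂.two, hl1]
      · simp [chooseEnd, d₂, hd1, lg₂, hc₂.two, hl2]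
    have eq' : ∀ a, (chooseEnd.run s₂).arr a = s.arr a := by
      intro a
      rw [ea]
      by_cases ha : a = aPar
      · rw [ha, hpar₂]
      · exact q₂ a ha
    refine .straight rfl ?_ (by simp [chooseEnd, Program.cost, subMod, splitNode, addMod])
      ⟨N, Λ, ?_, ?_, Or.inl ⟨rfl, enx⟩⟩
    · rcases hlα with hl1 | hl2
      · simp [chooseEnd, d₂, hd1, lg₂, hc₂.two, hl1]
      · simp [chooseEnd, d₂, hd1, lg₂, hc₂.two, hl2, A₂, hc₂.mod, q₂]; omega
    · exact ⟨by rw [eq', eq']; exact T, by rw [eq', eq', eq']; exact h.counted,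
        by rw [eq']; exact h.two, by rw [eq', eq', eq']; exact h.fresh⟩
    · rw [eq', eq', ec, el]
      exact hp.place_child T h.strict hal hH hcN hpc ho huniq hl
  · -- several children on the side of `x`
    rw [if_neg hd2] at par₂
    set t := if lab α < 2 then α else nx with ht
    set b := if lab α < 2 then nx else α with hb
    have htb : (t = α ∧ b = nx) ∨ (t = nx ∧ b = α) := by
      rw [ht, hb]; split_ifs <;> simp
    set s₃ := (s₂.setReg rT t).setReg rB b with hs₃
    have hspec := splitNode_spec (B := B) (M := M) (α := α) (g := nx) (t := t) (b := b) (A := A)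
      (s := s₃) (par := par) (lab := lab) T
      (by rw [hs₃]; simpa [q₂] using h.counted) hAch hαN hαα hnxN hnx0 hnxM
      (by rw [hs₃]; simpa using par₂) (by rw [hs₃]; simpa using A₂) (by rw [hs₃]; simpa using nx₂)
      (by rw [hs₃]; simpa using k₂) (by rw [hs₃]; simpa using S₂) (by rw [hs₃]; simpa using S₂')
      (by rw [hs₃]; simp) (by rw [hs₃]; simp) (by rw [hs₃]; simpa using hc₂.one)
      (by rw [hs₃]; simpa using hc₂.mod) htb (by omega)
      (by intro u hu; rw [hs₃]; have := h.nch_le u hu; simp [q₂]; omega)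
    obtain ⟨ok₄, nx₄, lab₄, par₄, nch₄, sum₄, C₄⟩ := hspec
    set s₄ := splitNode.run s₃ with hs₄
    have a₄ : Agree splitNode s₃ s₄ := agree_run _ _
    have b₄ : s₄.reg rB = b := by rw [a₄.1 rB (by decide), hs₃]; simp
    have lg₄ : s₄.reg rLg = lab α := by rw [a₄.1 rLg (by decide), hs₃]; simpa using lg₂
    have hc₄ : Consts M x s₄ := (show Consts M x s₃ from ⟨by rw [hs₃]; simpa using hc₂.one,
      by rw [hs₃]; simpa using hc₂.two, by rw [hs₃]; simpa using hc₂.zero,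
      by rw [hs₃]; simpa using hc₂.mod, by rw [hs₃]; simpa using hc₂.cur⟩).of_agree a₄ (by decide)
    have hrun : chooseEnd.run s₂ = (s₄.setReg rC b).setReg rL l := by
      rcases hlα with hl1 | hl2
      · simp [chooseEnd, d₂, hd2, lg₂, hc₂.two, hl1, A₂, nx₂]
        have e : (s₂.setReg rT α).setReg rB nx = s₃ := by rw [hs₃, ht, hb]; simp [hl1]
        rw [e, ← hs₄, b₄, lg₄, hc₄.two, if_pos (by omega)]
        simp [hl, hl1]
      · simp [chooseEnd, d₂, hd2, lg₂, hc₂.two, hl2, A₂, nx₂]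
        have e : (s₂.setReg rT nx).setReg rB α = s₃ := by rw [hs₃, ht, hb]; simp [hl2]
        rw [e, ← hs₄, b₄, lg₄, hc₄.two, if_neg (by omega)]
        simp [hl, hl2, hc₄.one]
    have hok : chooseEnd.ok B s₂ := by
      rcases hlα with hl1 | hl2
      · simp [chooseEnd, d₂, hd2, lg₂, hc₂.two, hl1, A₂, nx₂]
        have e : (s₂.setReg rT α).setReg rB nx = s₃ := by rw [hs₃, ht, hb]; simp [hl1]
        rw [e]; exact ok₄
      · simp [chooseEnd, d₂, hd2, lg₂, hc₂.two, hl2, A₂, nx₂]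
        have e : (s₂.setReg rT nx).setReg rB α = s₃ := by rw [hs₃, ht, hb]; simp [hl2]
        rw [e]; exact ok₄
    refine .straight rfl hok (by simp [chooseEnd, Program.cost, subMod, splitNode, addMod]) ?_
    rw [hrun]
    have hbt : b ≠ t := by
      have : nx ≠ α := by rintro h'; exact hnxN (h' ▸ hαN)
      rcases htb with ⟨h1, h2⟩ | ⟨h1, h2⟩
      · rw [h1, h2]; exact this
      · rw [h1, h2]; exact this.symm
    have hne' : ∀ u ∈ N, u ≠ α → u ≠ t ∧ u ≠ b := by
      intro u hu hne
      have : u ≠ nx := by rintro rfl; exact hnxN hu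
      rcases htb with ⟨h1, h2⟩ | ⟨h1, h2⟩
      · exact ⟨h1 ▸ hne, h2 ▸ this⟩
      · exact ⟨h1 ▸ this, h2 ▸ hne⟩
    have lg₃ : s₃.reg rLg = lab α := by rw [hs₃]; simpa using lg₂
    have labN : ∀ u, u ≠ nx → s₄.arr aLab u = lab u := by
      intro u hu
      rw [lab₄, Function.update_of_ne hu, hs₃]
      simp [q₂, hlab]
    have parN : ∀ u ∈ N, u ≠ α → s₄.arr aPar u = if u ∈ A then nx else par u := by
      intro u hu hne
      have := hne' u hu hne
      rw [par₄, Function.update_of_ne this.2, Function.update_of_ne this.1, hs₃]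
      simp [par₂]
    have hpt : s₄.arr aPar t = par α := by
      rw [par₄, Function.update_of_ne hbt.symm, Function.update_self]
    have hpb : s₄.arr aPar b = t := by rw [par₄, Function.update_self]
    have hp0 : s₄.arr aPar 0 = 0 := by
      have h1 : 0 ≠ t := by rcases htb with ⟨h1, h2⟩ | ⟨h1, h2⟩ <;> rw [h1] <;> exact Ne.symm (by assumption)
      have h2 : 0 ≠ b := by rcases htb with ⟨h1, h2⟩ | ⟨h1, h2⟩ <;> rw [h2] <;> exact Ne.symm (by assumption)
      have h3 : (0 : ℕ) ∉ A := fun h' => T.zero (mem_A.1 h').1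
      rw [par₄, Function.update_of_ne h2, Function.update_of_ne h1, hs₃]
      simp [par₂, h3, T.par_zero]
    have hself : ∀ u, par u = α → u ≠ α := by rintro u hu rfl; exact hαα hu
    obtain ⟨Λ', T', P'⟩ := hp.place_split (par' := s₄.arr aPar) (lab' := s₄.arr aLab) (l := l)
      (g := nx) (t := t) (b := b) T h.strict hal hH hnxN hnx0 htb
      (by
        intro u hu hpu ho
        rw [parN u hu (hself u hpu)]
        have := (side_iff u hu hpu).1 ho
        rcases hlα with hl1 | hl2
        · rw [if_pos (this.2 hl1), hb, if_pos (by omega)]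
        · rw [if_neg (fun h' => by have := this.1 h'; omega), hb, if_neg (by omega), hpu])
      (by
        intro u hu hpu ho
        rw [parN u hu (hself u hpu)]
        rw [side_iff u hu hpu] at ho
        rcases hlα with hl1 | hl2
        · rw [if_neg (fun h' => ho ⟨fun _ => hl1, fun _ => h'⟩), ht, if_pos (by omega), hpu]
        · rw [if_pos (by by_contra h'; exact ho ⟨fun h'' => absurd h'' h', fun _ => by omega⟩), ht,
            if_neg (by omega)])
      (by
        rcases hlα with hl1 | hl2
        · exact ⟨uf, huf, hpuf, (side_iff uf huf hpuf).2
            ⟨fun _ => hl1, fun _ => mem_A.2 ⟨huf, hpuf, hfull⟩⟩⟩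
        · obtain ⟨u, hu, huA⟩ := Finset.exists_mem_notMem_of_card_lt_card hAlt
          obtain ⟨hu, hpu⟩ := mem_childrenIn.1 hu
          exact ⟨u, hu, hpu, (side_iff u hu hpu).2 ⟨fun h' => absurd h' huA, fun _ => by omega⟩⟩)
      hpt hpb
      (by
        intro u hu hne hpu
        rw [parN u hu hne, if_neg fun h' => hpu (mem_A.1 h').2.1])
      hp0 (by intro u hu; exact labN u (by rintro rfl; exact hnxN hu))
      (by rw [lab₄, Function.update_self, lg₃]) hl
    refine ⟨insert nx N, Λ', ⟨by simpa using T', by simpa using C₄, ?_, ?_⟩, by simpa using P',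
      Or.inr ⟨rfl, by simpa using nx₄⟩⟩
    · intro p hpN hpX
      simp only [arr_setReg]
      rw [nch₄]
      have n3 : s₃.arr aNch = s.arr aNch := by rw [hs₃]; simp [q₂]
      rw [n3, hnα]
      have hnxα : nx ≠ α := by rintro h'; exact hnxN (h' ▸ hαN)
      have hlt : 2 ≤ d := by omega
      rcases Finset.mem_insert.1 hpN with hpn | hpN'
      · simp only [if_pos hpn]
        rcases hlα with hl1 | hl2
        · have : d = A.card := if_pos (by omega)
          omega
        · have : t = nx := if_neg (by omega)
          rw [if_pos (by rw [this])]; omega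
      · have hpn : p ≠ nx := by rintro rfl; exact hnxN hpN'
        simp only [if_neg hpn]
        by_cases hpα : p = α
        · rw [if_pos hpα]
          rcases hlα with hl1 | hl2
          · have : t = α := if_pos (by omega)
            rw [if_pos this]; omega
          · have : d = ch.card - A.card := if_neg (by omega)
            omega
        · rw [if_neg hpα]; exact h.two p hpN' hpX
    · intro u hu
      rw [Finset.mem_insert, not_or] at hu
      have huα : u ≠ α := by rintro rfl; exact hu.2 hαN
      obtain ⟨f1, f2, f3⟩ := h.fresh u hu.2
      simp only [arr_setReg]
      refine ⟨by rw [labN u hu.1]; exact f1, ?_, fun h0 => ?_⟩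
      · rw [nch₄]; simp only [if_neg hu.1, if_neg huα]
        rw [hs₃]; simpa [q₂] using f2
      · rw [sum₄ u h0 hu.2 hu.1, hs₃]; simpa [q₂] using f3 h0

end

/-! ### Attaching the new leaf -/

section

variable {H : SimpleGraph ℕ} {M : ℕ} {X N : Finset ℕ} {Λ : ℕ → Finset ℕ} {par lab : ℕ → ℕ}

/-- The new leaf is attached to a node that already has the right label. -/
lemma Place.attach_same {x c l : ℕ} (T : Cotree H X N Λ par lab) (hs : Strict N Λ par)
    (h : Place H X N Λ par lab x c l) (hx : x ∉ N) (hx0 : x ≠ 0) (hl : lab c = l)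
    (hlx : lab x = 0) :
    ∃ Λ', Cotree H (insert x X) (insert x N) Λ' (Function.update par x c) lab ∧
      Alternating (insert x N) (Function.update par x c) lab := by
  have hne : ∀ u ∈ N, u ≠ x := by rintro u hu rfl; exact hx hu
  have hcN := h.mem
  have hc0 : c ≠ 0 := fun h => T.zero (h ▸ hcN)
  have hcX : c ∉ X := fun hcX => by have := T.lab_leaf c hcX; have := h.label; omega
  have hpo : ∀ u ∈ N, Function.update par x c u = par u := fun u hu =>
    Function.update_of_ne (hne u hu) _ _
  refine ⟨_, T.attach (c := c) (fun u => Λ c ⊆ Λ u) hx hx0 hcN hcX subset_rfl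
    (fun u hu hcu h0 => hcu.trans (T.par_sub u hu h0)) (fun p hp hcp hpc => ?_) (fun u hu hpu => ?_)
    (fun u _ => id) (fun u hu h0 => ?_) (fun v hv => ?_) h.twin (by simp) hpo
    (by rw [Function.update_of_ne hx0.symm, T.par_zero]) hlx (fun _ _ => rfl), ?_⟩
  · have hlt : Λ c ⊂ Λ p := hcp.ssubset_of_ne fun he => hpc (T.injective hs hp hcN he.symm)
    exact T.exists_child_above hs hp c hcN hlt
  · have := hs u hu (hpu ▸ hc0)
    rw [hpu] at this
    exact this.not_subset
  · rw [T.root u hu h0]; exact T.sub c hcN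
  · rw [h.adj v hv, hl]
  · intro u hu h0
    rcases Finset.mem_insert.1 hu with rfl | hu
    · rw [Function.update_self, hlx, hl]
      have := h.label; omega
    · rw [hpo u hu] at h0 ⊢
      by_cases huc : u = c
      · rw [huc, hl]; exact (h.par_ne (huc ▸ h0)).symm
      · exact h.alt u hu huc h0

/-- A node with the right label is put above `c`, and the new leaf is attached to it. -/
lemma Place.attach_above {x c l g : ℕ} (T : Cotree H X N Λ par lab) (hs : Strict N Λ par)
    (h : Place H X N Λ par lab x c l) (hx : x ∉ N) (hx0 : x ≠ 0) (hg : g ∉ N) (hg0 : g ≠ 0)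
    (hgx : g ≠ x) (hl : lab c ≠ l) (hlx : lab x = 0) {par' lab' par'' : ℕ → ℕ}
    (hlab' : lab' = Function.update lab g l)
    (hpar' : par' = Function.update (Function.update par g (par c)) c g)
    (hpar'' : par'' = Function.update par' x g) :
    ∃ Λ', Cotree H (insert x X) (insert x (insert g N)) Λ' par'' lab' ∧
      Alternating (insert x (insert g N)) par'' lab' := by
  have hcN := h.mem
  have hgc : g ≠ c := by rintro rfl; exact hg hcN
  have hgX : g ∉ X := fun h => hg (T.leaf_mem h)
  have hcc := hs.par_ne T.zero hcN
  have hc0 : c ≠ 0 := fun h => T.zero (h ▸ hcN)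
  have hNg : ∀ u ∈ N, u ≠ g := by rintro u hu rfl; exact hg hu
  have hpg : ∀ u ∈ N, par u ≠ g := fun u hu => T.par_notMem_of_notMem hg hg0 hu
  have pc : par' c = g := by rw [hpar', Function.update_self]
  have pg : par' g = par c := by rw [hpar', Function.update_of_ne hgc, Function.update_self]
  have po : ∀ u ∈ N, u ≠ c → par' u = par u := fun u hu huc => by
    rw [hpar', Function.update_of_ne huc, Function.update_of_ne (hNg u hu)]
  have lg : lab' g = l := by rw [hlab', Function.update_self]
  have lo : ∀ u ∈ N, lab' u = lab u := fun u hu => by rw [hlab', Function.update_of_ne (hNg u hu)]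
  have T' := T.split (α := c) (g := g) (t := g) (b := c) (S := Λ c) (par' := par') (lab' := lab')
    hcN hcc hg hg0 (Or.inr ⟨rfl, rfl⟩) subset_rfl (T.nonempty c hcN)
    (fun u hu hpu => Or.inl ⟨hpu ▸ T.par_sub u hu (hpu ▸ hc0), ?_⟩) (fun _ => ⟨rfl, rfl⟩) pg pc
    (fun u hu huc _ => po u hu huc)
    (by rw [hpar', Function.update_of_ne hc0.symm, Function.update_of_ne hg0.symm, T.par_zero]) lo
    (Or.inr ⟨rfl, rfl, lg ▸ h.label⟩)
  swap
  · rw [po u hu (by rintro rfl; exact hcc hpu), hpu]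
  have hx' : x ∉ insert g N := by simp [hx, hgx.symm]
  have hne : ∀ u ∈ insert g N, u ≠ x := by rintro u hu rfl; exact hx' hu
  have hpo : ∀ u ∈ insert g N, par'' u = par' u := fun u hu => by
    rw [hpar'', Function.update_of_ne (hne u hu)]
  have Λg : (if g = c then Λ c else if g = g then Λ c else Λ g) = Λ c := by simp
  refine ⟨_, T'.attach (c := g) (par' := par'') (lab' := lab')
    (fun u => u = g ∨ (u ≠ c ∧ u ∈ N ∧ Λ c ⊆ Λ u)) hx' hx0 (by simp) hgX
    (Or.inl rfl) (fun u hu hPu h0 => ?_) (fun p hp hPp hpg => ?_) (fun u hu hpu => ?_)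
    (fun u hu hPu => ?_) (fun u hu h0 => ?_) (fun v hv => ?_) (fun w hw v hv hvc => ?_)
    (by rw [hpar'', Function.update_self]) hpo
    (by rw [hpar'', Function.update_of_ne hx0.symm, T'.par_zero])
    (by rw [hlab', Function.update_of_ne hgx.symm, hlx]) (fun _ _ => rfl), ?_⟩
  · rcases hPu with rfl | ⟨huc, huN, hle⟩
    · rw [pg] at h0 ⊢
      exact Or.inr ⟨hcc, T.par_mem c hcN h0, T.par_sub c hcN h0⟩
    · rw [po u huN huc] at h0 ⊢
      have hlt := hs u huN h0
      refine Or.inr ⟨fun he => ?_, T.par_mem u huN h0, hle.trans hlt.subset⟩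
      rw [he] at hlt
      exact hlt.not_subset hle
  · obtain ⟨hpc, hpN, hle⟩ := hPp.resolve_left hpg
    have hlt : Λ c ⊂ Λ p := hle.ssubset_of_ne fun he => hpc (T.injective hs hpN hcN he.symm)
    obtain ⟨u, hu, hpu, hcu⟩ := T.exists_child_above hs hpN c hcN hlt
    by_cases huc : u = c
    · exact ⟨g, by simp, by rw [pg, ← huc, hpu], Or.inl rfl⟩
    · exact ⟨u, Finset.mem_insert_of_mem hu, by rw [po u hu huc, hpu], Or.inr ⟨huc, hu, hcu⟩⟩
  · rintro (rfl | ⟨huc, huN, -⟩)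
    · exact hpg c hcN (pg.symm.trans hpu)
    · exact hpg u huN ((po u huN huc).symm.trans hpu)
  · rw [Λg]
    rcases hPu with rfl | ⟨huc, huN, hle⟩
    · simp
    · simpa [huc, hNg u huN] using hle
  · rcases Finset.mem_insert.1 hu with rfl | huN
    · exact Or.inl rfl
    · by_cases huc : u = c
      · rw [huc, pc] at h0; exact absurd h0 hg0
      · rw [po u huN huc] at h0
        exact Or.inr ⟨huc, huN, by rw [T.root u huN h0]; exact T.sub c hcN⟩
  · rw [Λg] at hv
    rw [h.adj v hv, lg]
  · rw [Λg] at hw hvc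
    exact h.twin w hw v hv hvc
  · intro u hu h0
    rcases Finset.mem_insert.1 hu with rfl | hu'
    · have hpx : par'' u = g := by rw [hpar'', Function.update_self]
      rw [hpx, lg, hlab', Function.update_of_ne hgx.symm, hlx]
      have := h.label; omega
    · rw [hpo u hu'] at h0 ⊢
      rcases Finset.mem_insert.1 hu' with rfl | huN
      · rw [pg] at h0 ⊢
        rw [lg, lo _ (T.par_mem c hcN h0)]
        exact (h.par_ne h0).symm
      · by_cases huc : u = c
        · rw [huc, pc, lg, lo c hcN]; exact hl
        · rw [po u huN huc] at h0 ⊢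
          rw [lo u huN, lo _ (T.par_mem u huN h0)]
          exact h.alt u huN huc h0

lemma hang_spec {B c x : ℕ} {s : Memory} (hxp : ∀ u ∈ N, s.arr aPar u ≠ x)
    (C : Counted M N (s.arr aPar) (s.arr aNch) (s.arr aSum)) (hc : Consts M x s) (hx : x ∉ N)
    (hx0 : x ≠ 0) (hxM : x < M) (hcN : c ∈ N) (rc : s.reg rC = c) (hnx : s.arr aNch x = 0)
    (hsx : s.arr aSum x = 0) (hB : 2 * M ≤ B) (hB' : s.arr aNch c + 1 ≤ B) :
    hang.ok B s ∧ (hang.run s).arr aPar = Function.update (s.arr aPar) x c ∧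
    (hang.run s).arr aLab = s.arr aLab ∧
    (hang.run s).arr aNch = Function.update (s.arr aNch) c (s.arr aNch c + 1) ∧
    (∀ u, u ∉ N → (hang.run s).arr aSum u = s.arr aSum u) ∧
    Counted M (insert x N) ((hang.run s).arr aPar) ((hang.run s).arr aNch)
      ((hang.run s).arr aSum) := by
  have hxc : x ≠ c := by rintro rfl; exact hx hcN
  have csc := C.csum_lt c (Or.inr hcN)
  have e1 : (hang.run s).arr aPar = Function.update (s.arr aPar) x c := by
    simp [hang, rc, hc.cur]
  have e2 : (hang.run s).arr aNch = Function.update (s.arr aNch) c (s.arr aNch c + 1) := by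
    simp [hang, rc, hc.one]
  have e3 : (hang.run s).arr aSum = Function.update (s.arr aSum) c (addm M (s.arr aSum c) x) := by
    simp [hang, rc, hc.cur, hc.mod]
  have hno : ∀ {R : Type} [AddCommGroup R] (f : ℕ → R), childSum N (s.arr aPar) f x = 0 := by
    intro R _ f
    unfold childSum
    refine Finset.sum_eq_zero fun u hu => ?_
    obtain ⟨hu, hpu⟩ := Finset.mem_filter.1 hu
    exact absurd hpu (hxp u hu)
  have hpo : ∀ u ∈ N, (hang.run s).arr aPar u = s.arr aPar u := fun u hu => by
    rw [e1, Function.update_of_ne (by rintro rfl; exact hx hu)]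
  have hpx : (hang.run s).arr aPar x = c := by rw [e1, Function.update_self]
  refine ⟨?_, e1, by simp [hang], e2, fun u hu => ?_, ?_, ?_, ?_, ?_⟩
  · simp [hang, rc, hc.cur, hc.mod, hc.one]; omega
  · rw [e3, Function.update_of_ne (by rintro rfl; exact hu hcN)]
  · intro p hp
    rw [childSum_attach _ hx hpo, hpx, e2]
    rcases Finset.mem_insert.1 hp with rfl | hpN
    · rw [hno, Function.update_of_ne hxc, hnx]; simp [hxc.symm]
    · by_cases hpc : p = c
      · subst hpc; simp [C.nch p hpN]
      · simp [hpc, Ne.symm hpc, C.nch p hpN]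
  · intro p hp
    rw [e3]
    by_cases hpc : p = c
    · subst hpc; rw [Function.update_self]; exact addm_lt csc hxM
    · rw [Function.update_of_ne hpc]
      rcases hp with hp | hp
      · exact C.csum_lt p (Or.inl hp)
      · rcases Finset.mem_insert.1 hp with rfl | hpN
        · omega
        · exact C.csum_lt p (Or.inr hpN)
  · intro p hp
    rw [childSum_attach _ hx hpo, hpx, e3]
    by_cases hpx' : p = x
    · subst hpx'
      rw [hno, Function.update_of_ne hxc, hsx]; simp [hxc.symm]
    · have hpN : p = 0 ∨ p ∈ N := hp.imp id fun h => Finset.mem_of_mem_insert_of_ne h hpx'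
      by_cases hpc : p = c
      · subst hpc; simp [C.csum p hpN, cast_addm]
      · simp [hpc, Ne.symm hpc, C.csum p hpN]
  · intro u hu
    rcases Finset.mem_insert.1 hu with rfl | hu
    · exact hxM
    · exact C.lt u hu

lemma runs_attachLeaf {B x nx : ℕ} {s : Memory} (h : Tree H M X N Λ s) (hc : Consts M x s)
    (hp : Place H X N Λ (s.arr aPar) (s.arr aLab) x (s.reg rC) (s.reg rL)) (hx : x ∉ N)
    (hx0 : x ≠ 0) (hxM : x < M) (hnx : s.reg rNx = nx) (hnxN : nx ∉ N) (hnx0 : nx ≠ 0)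
    (hnxx : nx ≠ x) (hnxM : nx < M) (hB : 2 * M + 2 ≤ B) :
    Runs B attachLeaf s 60 fun s' => ∃ N' Λ', Tree H M (insert x X) N' Λ' s' ∧
      Alternating N' (s'.arr aPar) (s'.arr aLab) ∧
      ((N' = insert x N ∧ s'.reg rNx = nx) ∨
        (N' = insert x (insert nx N) ∧ s'.reg rNx = nx + 1)) := by
  have T := h.cotree
  set c := s.reg rC with hcdef
  set l := s.reg rL with hldef
  have hcN := hp.mem
  have hs := h.strict
  have hcM := h.counted.lt c hcN
  obtain ⟨fx1, fx2, fx3⟩ := h.fresh x hx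
  obtain ⟨fn1, fn2, fn3⟩ := h.fresh nx hnxN
  have hxc : x ≠ c := by rintro rfl; exact hx hcN
  set s₁ := s.setReg rV (s.arr aLab c) with hs₁
  have hc₁ : Consts M x s₁ := ⟨by simpa [hs₁] using hc.one, by simpa [hs₁] using hc.two,
    by simpa [hs₁] using hc.zero, by simpa [hs₁] using hc.mod, by simpa [hs₁] using hc.cur⟩
  refine Runs.seq (T₁ := 1) (T₂ := 59) (R := fun s' => s' = s₁)
    (.straight rfl trivial le_rfl (by simp [hs₁, ← hcdef])) ?_ le_rfl
  rintro _ - rfl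
  by_cases hl : s.arr aLab c = l
  · refine Runs.seq (T₁ := 49) (T₂ := 10) (R := fun s' => s' = s₁) (.straight rfl ?_ ?_ ?_) ?_ le_rfl
    · simp [hs₁, hl, ← hldef]
    · simp [Program.cost, ifEq, raise, splitNode, addMod, subMod]
    · simp [hs₁, hl, ← hldef]
    rintro _ - rfl
    have hB' : s₁.arr aNch c + 1 ≤ B := by
      have := h.nch_le c hcN; simp [hs₁]; omega
    obtain ⟨ok, e1, e2, e3, e4, C⟩ := hang_spec (B := B) (s := s₁) (c := c) (x := x)
      (by simpa [hs₁] using fun u hu => T.par_notMem_of_notMem hx hx0 hu)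
      (by simpa [hs₁] using h.counted) hc₁ hx hx0 hxM hcN (by simp [hs₁, ← hcdef])
      (by simpa [hs₁] using fx2) (by simpa [hs₁] using fx3 hx0) (by omega) hB'
    refine .straight rfl ok (by simp [hang, Program.cost, addMod]) ?_
    obtain ⟨Λ', T', al'⟩ := hp.attach_same T hs hx hx0 hl fx1
    have e1' : (hang.run s₁).arr aPar = Function.update (s.arr aPar) x c := by rw [e1]; simp [hs₁]
    have e2' : (hang.run s₁).arr aLab = s.arr aLab := by rw [e2]; simp [hs₁]
    have hnx' : (hang.run s₁).reg rNx = nx := by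
      rw [(agree_run hang s₁).1 rNx (by decide)]; simpa [hs₁] using hnx
    refine ⟨_, Λ', ⟨by rw [e1', e2']; exact T', C, fun p hp hpX => ?_, fun u hu => ?_⟩,
      by rw [e1', e2']; exact al', Or.inl ⟨rfl, hnx'⟩⟩
    · rw [Finset.mem_insert, not_or] at hpX
      have hpN := Finset.mem_of_mem_insert_of_ne hp hpX.1
      have := h.two p hpN hpX.2
      rw [e3]
      by_cases hpc : p = c
      · subst hpc; simp [hs₁]; omega
      · rw [Function.update_of_ne hpc]; simpa [hs₁] using this
    · rw [Finset.mem_insert, not_or] at hu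
      obtain ⟨f1, f2, f3⟩ := h.fresh u hu.2
      refine ⟨by rw [e2']; exact f1, ?_, fun h0 => ?_⟩
      · rw [e3, Function.update_of_ne (by rintro rfl; exact hu.2 hcN)]; simpa [hs₁] using f2
      · rw [e4 u hu.2]; simpa [hs₁] using f3 h0
  · set s₂ := (((((s₁.setReg rA c).setReg rK 0).setReg rS 0).setReg rLg l).setReg rT nx).setReg rB c
      with hs₂
    have ar₂ : ∀ a, s₂.arr a = s.arr a := by intro a; simp [hs₂, hs₁]
    have hspec := splitNode_spec (B := B) (M := M) (α := c) (g := nx) (t := nx) (b := c) (A := ∅)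
      (s := s₂) (par := s.arr aPar) (lab := s.arr aLab) T (by simpa [ar₂] using h.counted) (by simp) hcN
      (hs.par_ne T.zero hcN) hnxN hnx0 hnxM (by simp [ar₂]) (by simp [hs₂])
      (by simpa [hs₂, hs₁] using hnx) (by simp [hs₂]) (by simp [hs₂]; omega) (by simp [hs₂])
      (by simp [hs₂]) (by simp [hs₂]) (by simpa [hs₂] using hc₁.one) (by simpa [hs₂] using hc₁.mod)
      (Or.inr ⟨rfl, rfl⟩) (by omega)
      (by intro u hu; have := h.nch_le u hu; simp [ar₂]; omega)
    obtain ⟨ok₃, nx₃, lab₃, par₃, nch₃, sum₃, C₃⟩ := hspec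
    set s₃ := splitNode.run s₂ with hs₃
    have a₃ : Agree splitNode s₂ s₃ := agree_run _ _
    have t₃ : s₃.reg rT = nx := by rw [a₃.1 rT (by decide), hs₂]; simp
    set s₄ := s₃.setReg rC nx with hs₄
    have hrun : raise.run s₁ = s₄ := by
      have : (((((s₁.setReg rA c).setReg rK 0).setReg rS 0).setReg rLg l).setReg rT nx).setReg rB c
        = s₂ := rfl
      simp only [raise, block, Program.run]
      have e : s₁.reg rC = c := by simp [hs₁, ← hcdef]
      have e' : s₁.reg rL = l := by simp [hs₁, ← hldef]
      have e'' : s₁.reg rNx = nx := by simp [hs₁, hnx]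
      simp [e, e', e'', hc₁.zero, this, ← hs₃, t₃, hs₄]
    have hokr : raise.ok B s₁ := by
      have : (((((s₁.setReg rA c).setReg rK 0).setReg rS 0).setReg rLg l).setReg rT nx).setReg rB c
        = s₂ := rfl
      simp only [raise, block, Program.run, Program.ok]
      have e : s₁.reg rC = c := by simp [hs₁, ← hcdef]
      have e' : s₁.reg rL = l := by simp [hs₁, ← hldef]
      have e'' : s₁.reg rNx = nx := by simp [hs₁, hnx]
      simp [e, e', e'', hc₁.zero, this, ok₃]
    refine Runs.seq (T₁ := 49) (T₂ := 10) (R := fun s' => s' = s₄) (.straight rfl ?_ ?_ ?_) ?_ le_rfl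
    · rw [ok_ifEq, if_neg (by simpa [hs₁, ← hldef] using hl)]; exact hokr
    · simp [Program.cost, ifEq, raise, splitNode, addMod, subMod]
    · rw [run_ifEq, if_neg (by simpa [hs₁, ← hldef] using hl)]; exact hrun
    rintro _ - rfl
    have hc₃ : Consts M x s₃ := (show Consts M x s₂ from ⟨by simpa [hs₂] using hc₁.one,
      by simpa [hs₂] using hc₁.two, by simpa [hs₂] using hc₁.zero, by simpa [hs₂] using hc₁.mod,
      by simpa [hs₂] using hc₁.cur⟩).of_agree a₃ (by decide)
    have hc₄ : Consts M x s₄ := ⟨by simpa [hs₄] using hc₃.one, by simpa [hs₄] using hc₃.two,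
      by simpa [hs₄] using hc₃.zero, by simpa [hs₄] using hc₃.mod, by simpa [hs₄] using hc₃.cur⟩
    have ar₄ : ∀ a, s₄.arr a = s₃.arr a := by intro a; simp [hs₄]
    have hnxc : nx ≠ c := by rintro h'; exact hnxN (h' ▸ hcN)
    have hx' : x ∉ insert nx N := by simp [hx, hnxx.symm]
    have nch₃' : ∀ u, u ≠ nx → s₃.arr aNch u = s.arr aNch u := by
      intro u hu
      rw [nch₃]
      simp only [if_neg hu, ar₂]
      split_ifs with h1
      · rw [h1]; simp
      · rfl
    have nchx : s₃.arr aNch nx = 1 := by rw [nch₃]; simp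
    have par₃' : s₃.arr aPar = Function.update (Function.update (s.arr aPar) nx (s.arr aPar c)) c nx := by
      rw [par₃, ar₂]
    have lab₃' : s₃.arr aLab = Function.update (s.arr aLab) nx l := by
      rw [lab₃, ar₂]; simp [hs₂]
    have hxp : ∀ u ∈ insert nx N, s₃.arr aPar u ≠ x := by
      intro u hu
      rw [par₃']
      by_cases huc : u = c
      · rw [huc, Function.update_self]; exact hnxx
      · rw [Function.update_of_ne huc]
        rcases Finset.mem_insert.1 hu with hun | hu
        · rw [hun, Function.update_self]; exact T.par_notMem_of_notMem hx hx0 hcN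
        · rw [Function.update_of_ne (fun hun : u = nx => hnxN (hun ▸ hu))]
          exact T.par_notMem_of_notMem hx hx0 hu
    obtain ⟨ok, e1, e2, e3, e4, C⟩ := hang_spec (B := B) (s := s₄) (c := nx) (x := x)
      (N := insert nx N) hxp C₃ hc₄ hx' hx0 hxM (by simp) (by simp [hs₄])
      ((nch₃' x hnxx.symm).trans fx2)
      (by rw [ar₄, sum₃ x hx0 hx hnxx.symm, ar₂]; exact fx3 hx0) (by omega)
      (by rw [ar₄, nchx]; omega)
    refine .straight rfl ok (by simp [hang, Program.cost, addMod]) ?_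
    obtain ⟨Λ', T', al'⟩ := hp.attach_above T hs hx hx0 hnxN hnx0 hnxx hl fx1 lab₃' par₃' e1
    have hnx' : (hang.run s₄).reg rNx = nx + 1 := by
      rw [(agree_run hang s₄).1 rNx (by decide)]; simpa [hs₄] using nx₃
    refine ⟨_, Λ', ⟨by rw [e2]; exact T', C, fun p hp hpX => ?_, fun u hu => ?_⟩,
      by rw [e2]; exact al', Or.inr ⟨rfl, hnx'⟩⟩
    · rw [Finset.mem_insert, not_or] at hpX
      have hpN := Finset.mem_of_mem_insert_of_ne hp hpX.1
      rw [e3]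
      by_cases hpn : p = nx
      · rw [hpn, Function.update_self, ar₄, nchx]
      · rw [Function.update_of_ne hpn, ar₄, nch₃' p hpn]
        exact h.two p (Finset.mem_of_mem_insert_of_ne hpN hpn) hpX.2
    · simp only [Finset.mem_insert, not_or] at hu
      obtain ⟨hux, hun, huN⟩ := hu
      obtain ⟨f1, f2, f3⟩ := h.fresh u huN
      refine ⟨?_, ?_, fun h0 => ?_⟩
      · rw [e2, ar₄, lab₃', Function.update_of_ne hun]; exact f1
      · rw [e3, Function.update_of_ne hun, ar₄, nch₃' u hun]; exact f2
      · rw [e4 u (by simp [hun, huN]), ar₄, sum₃ u h0 huN hun, ar₂]; exact f3 h0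

end

/-! ### Construction of the cotree -/

/-- The queue is emptied, and the bounds of the list of the vertex `rX` are read. -/
def fetch : Program :=
  block [.sub rV rX rOne, .load rI aOff rV, .load rHi aOff rX, .copy rQn rZero]

/-- One round of the construction of the cotree. -/
def insertVertex : Program :=
  .seq fetch (.seq gather (.seq locate (.seq choosePlace (.seq attachLeaf (.add rX rX rOne)))))

/-- The construction of the cotree. -/
def build : Program := .whileLt rX rEnd insertVertex

/-- Adjacency lists, one after the other, of the graph `H` on `1, …, n`; the names in the lists are
smaller by `1` than those in `H`. -/
structure Lists (H : SimpleGraph ℕ) (n : ℕ) (off adj : ℕ → ℕ) : Prop where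
  mono : ∀ x, 1 ≤ x → x ≤ n → off (x - 1) ≤ off x
  mem : ∀ x, 1 ≤ x → x ≤ n → ∀ v,
    v ∈ (Finset.Ico (off (x - 1)) (off x)).image (fun i => adj i + 1) ↔ H.Adj x v
  inj : ∀ x, 1 ≤ x → x ≤ n → ∀ i j, off (x - 1) ≤ i → i < off x → off (x - 1) ≤ j → j < off x →
    adj i = adj j → i = j
  range : ∀ v w, H.Adj v w → 1 ≤ w ∧ w ≤ n

/-- The memory before the vertex `x` is inserted. -/
structure Grown (H : SimpleGraph ℕ) (M n : ℕ) (off adj : ℕ → ℕ) (x : ℕ) (N : Finset ℕ)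
    (Λ : ℕ → Finset ℕ) (s : Memory) : Prop where
  tree : Tree H M (Finset.Ico 1 x) N Λ s
  alt : Alternating N (s.arr aPar) (s.arr aLab)
  consts : Consts M x s
  next : n + 1 ≤ s.reg rNx
  next_le : s.reg rNx + 4 ≤ n + 1 + 2 * x
  nodes : ∀ u ∈ N, u < x ∨ (n + 1 ≤ u ∧ u < s.reg rNx)
  stamp : ∀ p, s.arr aSt p < x
  mark : ∀ p, s.arr aMk p < x
  off : s.arr aOff = off
  adj : s.arr aAdj = adj

section

variable {H : SimpleGraph ℕ} {M : ℕ} {X N : Finset ℕ} {Λ : ℕ → Finset ℕ}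

lemma Tree.of_agree {P : Program} {s s' : Memory} (h : Tree H M X N Λ s) (ha : Agree P s s')
    (hP : aPar ∉ P.arrs ∧ aLab ∉ P.arrs ∧ aNch ∉ P.arrs ∧ aSum ∉ P.arrs) : Tree H M X N Λ s' := by
  have e1 := ha.2 _ hP.1
  have e2 := ha.2 _ hP.2.1
  have e3 := ha.2 _ hP.2.2.1
  have e4 := ha.2 _ hP.2.2.2
  exact ⟨by rw [e1, e2]; exact h.cotree, by rw [e1, e3, e4]; exact h.counted, by rw [e3]; exact h.two,
    by rw [e2, e3, e4]; exact h.fresh⟩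

lemma runs_choosePlace {B x nx : ℕ} {s : Memory} (h : Tree H M X N Λ s)
    (hal : Alternating N (s.arr aPar) (s.arr aLab)) (hH : P4Free H) (hX : X.Nonempty)
    (hc : Consts M x s)
    (hM : Marked X N (s.arr aPar) x s (fullNodes N Λ (nbrs H X x)) (fullNodes N Λ (nbrs H X x)))
    (hp : (s.reg rA = 0 ∧ ∀ α, ¬ Cotree.Pivot H N Λ (s.arr aPar) x α) ∨
      Cotree.Pivot H N Λ (s.arr aPar) x (s.reg rA)) (hnx : s.reg rNx = nx) (hnxN : nx ∉ N)
    (hnx0 : nx ≠ 0) (hnxM : nx < M) (hB : 2 * M + 2 ≤ B) (hNM : N.card < M) :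
    Runs B choosePlace s (12 * s.reg rQn + 61) (Placed H M X N x nx) := by
  refine Runs.ifLt (fun hlt => ?_) (fun hlt => ?_)
  · rw [hc.zero] at hlt
    rcases hp with ⟨h0, -⟩ | hp
    · omega
    · exact runs_choosePivot h hal hH hc hM hp hnx hnxN hnx0 hnxM hB hNM
  · rcases hp with ⟨-, hno⟩ | hp
    · exact (runs_chooseRoot h hal hX hc hM hno hnx).mono (by omega) fun _ _ => id
    · have : s.reg rA ≠ 0 := fun h0 => h.cotree.zero (h0 ▸ hp.mem)
      rw [hc.zero] at hlt
      omega

lemma runs_insertVertex {B n x : ℕ} {off adj : ℕ → ℕ} {s : Memory} (hL : Lists H n off adj)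
    (hH : P4Free H) (h : Grown H M n off adj x N Λ s) (hx2 : 2 ≤ x) (hxn : x ≤ n)
    (hM : M = 3 * n + 6) (hB : 2 * M + 2 ≤ B) (hBo : off x + 1 ≤ B) :
    Runs B insertVertex s (111 * (off x - off (x - 1)) + 135) fun s' =>
      ∃ N' Λ', Grown H M n off adj (x + 1) N' Λ' s' := by
  set d := off x - off (x - 1) with hd
  obtain ⟨T, hal, hc, hnx1, hnx2, hN, hst, hmk, hoff, hadj⟩ := h
  set X := Finset.Ico 1 x with hX
  set nx := s.reg rNx with hnx
  have h0N : 0 ∉ N := T.cotree.zero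
  have hxN : x ∉ N := fun hx => by have := hN x hx; omega
  have hnxN : nx ∉ N := fun hx => by have := hN nx hx; omega
  have hNM : N.card < M := by
    have : N ⊆ Finset.Ico 1 M := fun u hu => Finset.mem_Ico.2
      ⟨Nat.one_le_iff_ne_zero.2 fun h0 => h0N (h0 ▸ hu), T.counted.lt u hu⟩
    have := Finset.card_le_card this
    rw [Nat.card_Ico] at this
    omega
  -- reading the list
  refine Runs.seq (T₁ := 4) (T₂ := 111 * d + 131)
    (R := fun s₁ => s₁.reg rI = off (x - 1) ∧ s₁.reg rHi = off x ∧ s₁.reg rQn = 0)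
    (.straight rfl (by simp [fetch]) (by simp [fetch, Program.cost])
      (by simp [fetch, hc.cur, hc.one, hc.zero, hoff])) ?_ (by omega)
  rintro s₁ a₁ ⟨i₁, hi₁, q₁⟩
  have T₁ := T.of_agree a₁ (by decide)
  have hc₁ : Consts M x s₁ := hc.of_agree a₁ (by decide)
  have adj₁ : s₁.arr aAdj = adj := (a₁.2 aAdj (by decide)).trans hadj
  have hlt : ∀ i, off (x - 1) ≤ i → i < off x → adj i + 1 ≤ n := fun i h1 h2 =>
    (hL.range x _ ((hL.mem x (by omega) hxn _).1
      (Finset.mem_image.2 ⟨i, Finset.mem_Ico.2 ⟨h1, h2⟩, rfl⟩))).2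
  refine Runs.seq (runs_gather (B := B) i₁ hi₁ hc₁.cur q₁ hc₁.one (hL.mono x (by omega) hxn) hBo
    (fun i h1 h2 => by rw [adj₁]; have := hlt i h1 h2; omega)
    (by rw [adj₁]; exact hL.inj x (by omega) hxn)) (T₂ := 104 * d + 130) ?_ (by omega)
  rintro s₂ a₂ ⟨qle, Q₂⟩
  have T₂ := T₁.of_agree a₂ (by decide)
  have hc₂ : Consts M x s₂ := hc₁.of_agree a₂ (by decide)
  have hnb : ((Finset.Ico (off (x - 1)) (off x)).image fun i => s₁.arr aAdj i + 1).filter (· < x) =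
      nbrs H X x := by
    ext v
    rw [adj₁, Finset.mem_filter, hL.mem x (by omega) hxn, mem_nbrs, hX, Finset.mem_Ico]
    constructor
    · rintro ⟨h1, h2⟩; exact ⟨⟨(hL.range x v h1).1, h2⟩, h1⟩
    · rintro ⟨h1, h2⟩; exact ⟨h2, h1.2⟩
  rw [hnb] at Q₂
  have hcard : (nbrs H X x).card ≤ d := Q₂.2 ▸ qle
  have hcX : (nbrs H X x).card ≤ n := by
    refine (Finset.card_le_card (fun v hv => (mem_nbrs.1 hv).1 : nbrs H X x ⊆ X)).trans ?_
    rw [hX, Nat.card_Ico]; omega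
  have st₂ : ∀ p, s₂.arr aSt p < x := fun p => by
    rw [a₂.2 aSt (by decide), a₁.2 aSt (by decide)]; exact hst p
  have mk₂ : ∀ p, s₂.arr aMk p < x := fun p => by
    rw [a₂.2 aMk (by decide), a₁.2 aMk (by decide)]; exact hmk p
  have al₂ : Alternating N (s₂.arr aPar) (s₂.arr aLab) := by
    rw [a₂.2 aPar (by decide), a₁.2 aPar (by decide), a₂.2 aLab (by decide), a₁.2 aLab (by decide)]
    exact hal
  -- finding the place
  refine Runs.seq (runs_locate (B := B) T₂.cotree T₂.strict al₂ hH T₂.nch_eq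
    (T₂.fresh 0 T₂.cotree.zero).2.1 T₂.two Q₂ hc₂.cur hc₂.one hc₂.zero st₂ mk₂ (by omega))
    (T₂ := 24 * d + 122) ?_ (by omega)
  rintro s₃ a₃ ⟨M₃, mk₃, p₃⟩
  have T₃ := T₂.of_agree a₃ (by decide)
  have hc₃ : Consts M x s₃ := hc₂.of_agree a₃ (by decide)
  rw [← a₃.2 aPar (by decide)] at M₃ p₃
  have al₃ : Alternating N (s₃.arr aPar) (s₃.arr aLab) := by
    rw [a₃.2 aPar (by decide), a₃.2 aLab (by decide)]; exact al₂
  have nx₃ : s₃.reg rNx = nx := by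
    rw [a₃.1 rNx (by decide), a₂.1 rNx (by decide), a₁.1 rNx (by decide)]
  have st₃ : ∀ p, s₃.arr aSt p ≤ x := fun p => by
    rcases Nat.eq_zero_or_pos (childrenIn (s₃.arr aPar) (fullNodes N Λ (nbrs H X x)) p).card with h | h
    · exact (M₃.stamp_zero p h).le
    · exact (M₃.stamp_pos p h).le
  have hq₃ : s₃.reg rQn ≤ 2 * d := by
    rw [← M₃.queue.2]
    refine (T₃.cotree.card_fullNodes_le fun p hp hpX => ?_).trans (by omega)
    rw [← T₃.nch_eq p hp]; exact T₃.two p hp hpX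
  refine Runs.seq (runs_choosePlace (B := B) T₃ al₃ hH ⟨1, Finset.mem_Ico.2 ⟨le_rfl, hx2⟩⟩ hc₃ M₃ p₃ nx₃
    hnxN (by omega) (by omega) hB hNM) (T₂ := 61) ?_ (by omega)
  rintro s₄ a₄ ⟨N₄, Λ₄, T₄, P₄, hN₄⟩
  have hc₄ : Consts M x s₄ := hc₃.of_agree a₄ (by decide)
  have hnxle : nx ≤ s₄.reg rNx := by rcases hN₄ with ⟨-, h⟩ | ⟨-, h⟩ <;> omega
  have hnxle' : s₄.reg rNx ≤ nx + 1 := by rcases hN₄ with ⟨-, h⟩ | ⟨-, h⟩ <;> omega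
  have hnode : ∀ u ∈ N₄, u < x ∨ (n + 1 ≤ u ∧ u < s₄.reg rNx) := by
    intro u hu
    rcases hN₄ with ⟨rfl, h⟩ | ⟨rfl, h⟩
    · rw [h]; exact hN u hu
    · rcases Finset.mem_insert.1 hu with rfl | hu
      · omega
      · have := hN u hu; omega
  have hxN₄ : x ∉ N₄ := fun hx => by have := hnode x hx; omega
  have hnxN₄ : s₄.reg rNx ∉ N₄ := fun hx => by have := hnode _ hx; omega
  refine Runs.seq (runs_attachLeaf (B := B) T₄ hc₄ P₄ hxN₄ (by omega) (by omega) rfl hnxN₄ (by omega)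
    (by omega) (by omega) hB) (T₂ := 1) ?_ (by omega)
  rintro s₅ a₅ ⟨N₅, Λ₅, T₅, al₅, hN₅⟩
  have hc₅ : Consts M x s₅ := hc₄.of_agree a₅ (by decide)
  refine .straight rfl (by simp [hc₅.cur, hc₅.one]; omega) le_rfl ⟨N₅, Λ₅, ?_⟩
  have hr : (Program.add rX rX rOne).run s₅ = s₅.setReg rX (x + 1) := by simp [hc₅.cur, hc₅.one]
  rw [hr]
  have hXx : insert x X = Finset.Ico 1 (x + 1) := by
    ext v; simp only [hX, Finset.mem_insert, Finset.mem_Ico]; omega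
  refine ⟨?_, by simpa using al₅, ⟨?_, ?_, ?_, ?_, by simp⟩, ?_, ?_, ?_, ?_, ?_, ?_, ?_⟩
  · rw [← hXx]; exact ⟨T₅.cotree, T₅.counted, T₅.two, T₅.fresh⟩
  · simpa using hc₅.one
  · simpa using hc₅.two
  · simpa using hc₅.zero
  · simpa using hc₅.mod
  · simp; rcases hN₅ with ⟨-, h⟩ | ⟨-, h⟩ <;> omega
  · simp; rcases hN₅ with ⟨-, h⟩ | ⟨-, h⟩ <;> omega
  · intro u hu
    simp
    rcases hN₅ with ⟨rfl, h⟩ | ⟨rfl, h⟩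
    · rcases Finset.mem_insert.1 hu with rfl | hu
      · omega
      · have := hnode u hu; omega
    · rcases Finset.mem_insert.1 hu with rfl | hu
      · omega
      · rcases Finset.mem_insert.1 hu with rfl | hu
        · omega
        · have := hnode u hu; omega
  · intro p
    simp only [arr_setReg]
    rw [a₅.2 aSt (by decide), a₄.2 aSt (by decide)]
    exact Nat.lt_succ_of_le (st₃ p)
  · intro p
    simp only [arr_setReg]
    rw [a₅.2 aMk (by decide), a₄.2 aMk (by decide)]
    exact Nat.lt_succ_of_le (mk₃ p)
  · simp only [arr_setReg]
    rw [a₅.2 aOff (by decide), a₄.2 aOff (by decide), a₃.2 aOff (by decide), a₂.2 aOff (by decide),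
      a₁.2 aOff (by decide), hoff]
  · simp only [arr_setReg]
    rw [a₅.2 aAdj (by decide), a₄.2 aAdj (by decide), a₃.2 aAdj (by decide), a₂.2 aAdj (by decide),
      adj₁]

lemma Lists.off_le {n : ℕ} {off adj : ℕ → ℕ} (hL : Lists H n off adj) {x : ℕ} (hxn : x ≤ n) :
    off x ≤ off n := by
  have key : ∀ y, x ≤ y → y ≤ n → off x ≤ off y := by
    intro y hy
    induction y, hy using Nat.le_induction with
    | base => exact fun _ => le_rfl
    | succ k hk ih => exact fun hkn => (ih (by omega)).trans (hL.mono (k + 1) (by omega) hkn)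
  exact key n hxn le_rfl

lemma runs_build {B n : ℕ} {off adj : ℕ → ℕ} {s : Memory} (hL : Lists H n off adj)
    (hH : P4Free H) (h : Grown H M n off adj 2 N Λ s) (hn : 1 ≤ n) (hE : s.reg rEnd = n + 1)
    (hM : M = 3 * n + 6) (hB : 2 * M + 2 ≤ B) (hBo : off n + 1 ≤ B) :
    Runs B build s (111 * off n + 136 * n + 1) fun s' =>
      ∃ N' Λ', Grown H M n off adj (n + 1) N' Λ' s' := by
  refine (Runs.while (I := fun k s' => ∃ x N Λ, Grown H M n off adj x N Λ s' ∧ 2 ≤ x ∧ x ≤ n + 1 ∧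
    111 * (off n - off (x - 1)) + 136 * (n + 1 - x) ≤ k) ?_ (k := 111 * off n + 136 * n)
    ⟨2, N, Λ, h, le_rfl, by omega, by omega⟩).mono le_rfl ?_
  · rintro k s' ha ⟨x, N', Λ', hG, hx2, hxn, hk⟩ hlt
    rw [hG.consts.cur, ha.1 rEnd (by decide), hE] at hlt
    have h1 := hL.off_le (x := x) (by omega)
    have h2 := hL.mono x (by omega) (by omega)
    refine ⟨_, (runs_insertVertex hL hH hG hx2 (by omega) hM hB (by omega)).mono le_rfl ?_⟩
    rintro s'' - ⟨N'', Λ'', hG'⟩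
    refine ⟨111 * (off n - off x) + 136 * (n + 1 - (x + 1)), by omega, x + 1, N'', Λ'', hG', by omega,
      by omega, by simp⟩
  · rintro s' - ⟨ha, hge, k, x, N', Λ', hG, hx2, hxn, -⟩
    rw [hG.consts.cur, ha.1 rEnd (by decide), hE] at hge
    obtain rfl : x = n + 1 := by omega
    exact ⟨N', Λ', hG⟩

end

/-! ### Linked lists -/

/-- `S` is the list that starts at `h`, ends at `t`, and in which `ne` gives the next entry. -/
inductive Linked (ne : ℕ → ℕ) : ℕ → List ℕ → ℕ → Prop
  | single (a : ℕ) : Linked ne a [a] a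
  | cons {a t : ℕ} {S : List ℕ} (h : Linked ne (ne a) S t) : Linked ne a (a :: S) t

namespace Linked

variable {ne ne' : ℕ → ℕ} {h t h' t' : ℕ} {S T : List ℕ}

lemma head_mem (hL : Linked ne h S t) : h ∈ S := by cases hL <;> simp

lemma last_mem (hL : Linked ne h S t) : t ∈ S := by
  induction hL with
  | single => simp
  | cons _ ih => exact List.mem_cons_of_mem _ ih

lemma congr (hL : Linked ne h S t) (hS : S.Nodup) (hne : ∀ v ∈ S, v ≠ t → ne' v = ne v) :
    Linked ne' h S t := by
  induction hL with
  | single => exact .single _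
  | @cons a t S hL ih =>
    obtain ⟨haS, hS⟩ := List.nodup_cons.1 hS
    refine .cons ?_
    rw [hne a List.mem_cons_self (by rintro rfl; exact haS hL.last_mem)]
    exact ih hS fun v hv => hne v (List.mem_cons_of_mem _ hv)

lemma append (hL : Linked ne h S t) (hT : Linked ne h' T t') (ht : ne t = h') :
    Linked ne h (S ++ T) t' := by
  induction hL with
  | single a => subst ht; exact .cons hT
  | cons _ ih => exact .cons (ih ht)

/-- Two lists without common entries are concatenated by a change at the end of the first one. -/
lemma concat (hL : Linked ne h S t) (hT : Linked ne h' T t') (hS : S.Nodup) (hT' : T.Nodup)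
    (htT : t ∉ T) : Linked (Function.update ne t h') h (S ++ T) t' := by
  refine (hL.congr hS fun v _ hvt => Function.update_of_ne hvt _ _).append
    (hT.congr hT' fun v hv _ => Function.update_of_ne ?_ _ _) (Function.update_self _ _ _)
  rintro rfl
  exact htT hv

lemma eq_head {a : ℕ} (hL : Linked ne h (a :: S) t) : h = a := by cases hL <;> rfl

lemma tail {a b : ℕ} (hL : Linked ne h (a :: b :: S) t) : Linked ne (ne h) (b :: S) t := by
  cases hL with
  | cons h => exact h

end Linked

/-! ### Optimal sequences of unions and joins -/

/-- A longest legal sequence for the set `A` is stored as the list of the node `p`. -/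
def Holds (H : SimpleGraph ℕ) (s : Memory) (p : ℕ) (A : Finset ℕ) : Prop :=
  ∃ S, Optimal H A S ∧ IsoFlag H A (s.arr aIso p) ∧ s.arr aLen p = S.length ∧
    Linked (s.arr aNe) (s.arr aHd p) S (s.arr aTl p)

/-- The memories differ only at the node `p`, and in the successors of vertices in `W`. -/
structure SameLists (p : ℕ) (W : Finset ℕ) (s s' : Memory) : Prop where
  len : ∀ q, q ≠ p → s'.arr aLen q = s.arr aLen q
  iso : ∀ q, q ≠ p → s'.arr aIso q = s.arr aIso q
  hd : ∀ q, q ≠ p → s'.arr aHd q = s.arr aHd q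
  tl : ∀ q, q ≠ p → s'.arr aTl q = s.arr aTl q
  ne : ∀ v, v ∉ W → s'.arr aNe v = s.arr aNe v

section

variable {H : SimpleGraph ℕ} {p u : ℕ} {A A' W : Finset ℕ} {s s' : Memory}

lemma Holds.of_same {q : ℕ} (h : Holds H s q A) (hs : SameLists p W s s') (hq : q ≠ p)
    (hW : Disjoint A W) : Holds H s' q A := by
  obtain ⟨S, hS, hi, hl, hL⟩ := h
  refine ⟨S, hS, by rwa [hs.iso q hq], by rw [hs.len q hq, hl], ?_⟩
  rw [hs.hd q hq, hs.tl q hq]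
  exact hL.congr hS.1.nodup fun v hv _ =>
    hs.ne v (Finset.disjoint_left.1 hW (hS.1.subset v hv))

/-- The list of the node `rU` becomes the list of the node `rP`. -/
def takeList : Program :=
  block [.load rV aLen rU, .store aLen rP rV, .load rV aIso rU, .store aIso rP rV,
    .load rV aHd rU, .store aHd rP rV, .load rV aTl rU, .store aTl rP rV]

lemma takeList_spec {B : ℕ} (hU : s.reg rU = u) (hP : s.reg rP = p) (h : Holds H s u A) :
    takeList.ok B s ∧ Holds H (takeList.run s) p A ∧ SameLists p ∅ s (takeList.run s) := by
  refine ⟨by simp [takeList], ?_, ?_⟩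
  · obtain ⟨S, hS, hi, hl, hL⟩ := h
    exact ⟨S, hS, by simpa [takeList, hU, hP] using hi, by simpa [takeList, hU, hP] using hl,
      by simpa [takeList, hU, hP] using hL⟩
  · refine ⟨fun q hq => ?_, fun q hq => ?_, fun q hq => ?_, fun q hq => ?_, fun v _ => ?_⟩ <;>
    simp [takeList, hU, hP, *]

/-- The list of the node `rU` is appended to the list of the node `rP`. -/
def appendList : Program :=
  block [.load rT aTl rP, .load rW aHd rU, .store aNe rT rW, .load rT aTl rU, .store aTl rP rT,
    .load rV aLen rU, .load rC aLen rP, .add rC rC rV, .store aLen rP rC, .load rV aIso rU,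
    .ifLt rZero rV (.store aIso rP rOne) .skip]

lemma appendList_spec {B : ℕ} (hU : s.reg rU = u) (hP : s.reg rP = p)
    (hOne : s.reg rOne = 1) (hZ : s.reg rZero = 0) (h : Holds H s p A) (h' : Holds H s u A')
    (hd : Disjoint A A') (hAA : ∀ a ∈ A, ∀ b ∈ A', ¬ H.Adj a b)
    (hB : s.arr aLen p + s.arr aLen u ≤ B) :
    appendList.ok B s ∧ Holds H (appendList.run s) p (A ∪ A') ∧
      SameLists p (A ∪ A') s (appendList.run s) := by
  obtain ⟨S, hS, hi, hl, hL⟩ := h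
  obtain ⟨T, hT, hj, hk, hM⟩ := h'
  have htA := hS.1.subset _ hL.last_mem
  have hS' := hS.1.nodup
  have htT : s.arr aTl p ∉ T := fun h' => Finset.disjoint_left.1 hd htA (hT.1.subset _ h')
  refine ⟨?_, ⟨S ++ T, hS.union hT hd hAA, hi.union hj ?_ hAA, ?_, ?_⟩, ?_⟩
  · simp [appendList, hU, hP, hB]
  · simp [appendList, hU, hP, hOne, hZ]
    split_ifs <;> simp
  · simp [appendList, hU, hP, hOne, hZ]
    split_ifs <;> simp [hl, hk]
  · have e1 : (appendList.run s).arr aNe =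
        Function.update (s.arr aNe) (s.arr aTl p) (s.arr aHd u) := by
      simp [appendList, hU, hP, hOne, hZ]
      split_ifs <;> simp
    have e2 : (appendList.run s).arr aHd p = s.arr aHd p := by
      simp [appendList, hU, hP, hOne, hZ]
      split_ifs <;> simp
    have e3 : (appendList.run s).arr aTl p = s.arr aTl u := by
      simp [appendList, hU, hP, hOne, hZ]
      split_ifs <;> simp
    rw [e1, e2, e3]
    exact hL.concat hM hS' hT.1.nodup htT
  · refine ⟨fun q hq => ?_, fun q hq => ?_, fun q hq => ?_, fun q hq => ?_, fun v hv => ?_⟩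
    iterate 4
      · simp [appendList, hU, hP, hq, hZ]
        split_ifs <;> simp [hq]
    have hv' : v ≠ s.arr aTl p := by rintro rfl; exact hv (Finset.mem_union_left _ htA)
    simp [appendList, hU, hP, hZ]
    split_ifs <;> simp [hv']

/-- The better one of the lists of `rP` and `rU` becomes the list of `rP`, extended by a vertex of
the other list if its own graph has an isolated vertex. -/
def chooseList : Program :=
  block [.load rK aIso rP, .load rS aIso rU, .load rC aLen rP, .load rV aLen rU, .add rA rC rK,
    .add rB rV rS, .store aIso rP rZero, .load rL aHd rP, .load rW aHd rU, .load rT aTl rP,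
    .ifLt rA rB
      (block [.store aHd rP rW, .copy rW rL, .load rT aTl rU, .store aTl rP rT, .copy rC rV,
        .copy rK rS]) .skip,
    .ifLt rZero rK (block [.store aNe rT rW, .store aTl rP rW, .add rC rC rOne]) .skip,
    .store aLen rP rC]

lemma IsoFlag.le_one {i : ℕ} (h : IsoFlag H A i) : i ≤ 1 := by
  rcases h with ⟨rfl, -⟩ | ⟨rfl, -⟩ <;> omega

lemma chooseList_spec {B : ℕ} (hU : s.reg rU = u) (hP : s.reg rP = p)
    (hOne : s.reg rOne = 1) (hZ : s.reg rZero = 0) (h : Holds H s p A) (h' : Holds H s u A')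
    (hd : Disjoint A A') (hAA : ∀ a ∈ A, ∀ b ∈ A', H.Adj a b)
    (hB : s.arr aLen p + 1 ≤ B) (hB' : s.arr aLen u + 1 ≤ B) :
    chooseList.ok B s ∧ Holds H (chooseList.run s) p (A ∪ A') ∧
      SameLists p (A ∪ A') s (chooseList.run s) := by
  obtain ⟨S, hS, hi, hl, hL⟩ := h
  obtain ⟨T, hT, hj, hk, hM⟩ := h'
  have hpA := hS.1.subset _ hL.head_mem
  have huA := hT.1.subset _ hM.head_mem
  have htA := hS.1.subset _ hL.last_mem
  have htA' := hT.1.subset _ hM.last_mem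
  have hfl := isoFlag_join ⟨_, hpA⟩ ⟨_, huA⟩ hAA
  have hi1 := hi.le_one
  have hj1 := hj.le_one
  by_cases hlt : s.arr aLen p + s.arr aIso p < s.arr aLen u + s.arr aIso u
  · have hopt := hT.join hS hj hi hd.symm (fun a ha b hb => (hAA b hb a ha).symm) (by omega) hpA
    rw [Finset.union_comm] at hopt
    by_cases hz : 0 < s.arr aIso u
    · rw [if_pos hz] at hopt
      refine ⟨?_, ⟨_, hopt, ?_, ?_, ?_⟩, ?_⟩
      · simp [chooseList, hU, hP, hOne, hZ, hlt, hz]; omega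
      · simpa [chooseList, hU, hP, hOne, hZ, hlt, hz] using hfl
      · have : (chooseList.run s).arr aLen p = s.arr aLen u + 1 := by
          simp [chooseList, hU, hP, hOne, hZ, hlt, hz]
        rw [this, hk, List.length_append, List.length_singleton]
      · have := hM.concat (.single (s.arr aHd p)) hT.1.nodup (by simp) (by
          rw [List.mem_singleton]; rintro he
          exact Finset.disjoint_left.1 hd hpA (he ▸ htA'))
        simpa [chooseList, hU, hP, hOne, hZ, hlt, hz] using this
      · refine ⟨fun q hq => ?_, fun q hq => ?_, fun q hq => ?_, fun q hq => ?_, fun v hv => ?_⟩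
        iterate 4 · simp [chooseList, hU, hP, hOne, hZ, hlt, hz, hq]
        have hv' : v ≠ s.arr aTl u := by rintro rfl; exact hv (Finset.mem_union_right _ htA')
        simp [chooseList, hU, hP, hOne, hZ, hlt, hz, hv']
    · rw [if_neg hz] at hopt
      refine ⟨?_, ⟨_, hopt, ?_, ?_, ?_⟩, ?_⟩
      · simp [chooseList, hU, hP, hOne, hZ, hlt, hz]; omega
      · simpa [chooseList, hU, hP, hOne, hZ, hlt, hz] using hfl
      · have : (chooseList.run s).arr aLen p = s.arr aLen u := by
          simp [chooseList, hU, hP, hOne, hZ, hlt, hz]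
        rw [this, hk]
      · simpa [chooseList, hU, hP, hOne, hZ, hlt, hz] using hM
      · refine ⟨fun q hq => ?_, fun q hq => ?_, fun q hq => ?_, fun q hq => ?_, fun v _ => ?_⟩
        iterate 4 · simp [chooseList, hU, hP, hOne, hZ, hlt, hz, hq]
        simp [chooseList, hU, hP, hOne, hZ, hlt, hz]
  · have hopt := hS.join hT hi hj hd hAA (by omega) huA
    by_cases hz : 0 < s.arr aIso p
    · rw [if_pos hz] at hopt
      refine ⟨?_, ⟨_, hopt, ?_, ?_, ?_⟩, ?_⟩
      · simp [chooseList, hU, hP, hOne, hZ, hlt, hz]; omega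
      · simpa [chooseList, hU, hP, hOne, hZ, hlt, hz] using hfl
      · have : (chooseList.run s).arr aLen p = s.arr aLen p + 1 := by
          simp [chooseList, hU, hP, hOne, hZ, hlt, hz]
        rw [this, hl, List.length_append, List.length_singleton]
      · have := hL.concat (.single (s.arr aHd u)) hS.1.nodup (by simp) (by
          rw [List.mem_singleton]; rintro he
          exact Finset.disjoint_left.1 hd htA (he ▸ huA))
        simpa [chooseList, hU, hP, hOne, hZ, hlt, hz] using this
      · refine ⟨fun q hq => ?_, fun q hq => ?_, fun q hq => ?_, fun q hq => ?_, fun v hv => ?_⟩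
        iterate 4 · simp [chooseList, hU, hP, hOne, hZ, hlt, hz, hq]
        have hv' : v ≠ s.arr aTl p := by rintro rfl; exact hv (Finset.mem_union_left _ htA)
        simp [chooseList, hU, hP, hOne, hZ, hlt, hz, hv']
    · rw [if_neg hz] at hopt
      refine ⟨?_, ⟨_, hopt, ?_, ?_, ?_⟩, ?_⟩
      · simp [chooseList, hU, hP, hOne, hZ, hlt, hz]; omega
      · simpa [chooseList, hU, hP, hOne, hZ, hlt, hz] using hfl
      · have : (chooseList.run s).arr aLen p = s.arr aLen p := by
          simp [chooseList, hU, hP, hOne, hZ, hlt, hz]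
        rw [this, hl]
      · simpa [chooseList, hU, hP, hOne, hZ, hlt, hz] using hL
      · refine ⟨fun q hq => ?_, fun q hq => ?_, fun q hq => ?_, fun q hq => ?_, fun v _ => ?_⟩
        iterate 4 · simp [chooseList, hU, hP, hOne, hZ, hlt, hz, hq]
        simp [chooseList, hU, hP, hOne, hZ, hlt, hz]

end

/-! ### Evaluation of the cotree -/

/-- The leaves that are stored at the node `p`, if `τ` gives the node for every leaf. -/
def part (X : Finset ℕ) (τ : ℕ → ℕ) (p : ℕ) : Finset ℕ := X.filter fun v => τ v = p

/-- The nodes in `D` have been merged into their parents, and the leaf `v` is now stored at the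
node `τ v`. -/
structure Merged (X N : Finset ℕ) (Λ : ℕ → Finset ℕ) (par : ℕ → ℕ) (D : Finset ℕ) (τ : ℕ → ℕ) :
    Prop where
  mem : ∀ v ∈ X, τ v = 0 ∨ τ v ∈ N
  notMem : ∀ v ∈ X, τ v ∉ D
  below : ∀ v ∈ X, τ v = v ∨ ∃ w ∈ D, par w = τ v ∧ v ∈ Λ w
  leaf : ∀ v ∈ X, v ∉ D → τ v = v
  full : ∀ w ∈ D, par w ∉ D → ∃ v ∈ X, τ v = par w

section

variable {H : SimpleGraph ℕ} {X N D : Finset ℕ} {Λ : ℕ → Finset ℕ} {par lab τ : ℕ → ℕ} {u : ℕ}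

lemma mem_part {p v : ℕ} : v ∈ part X τ p ↔ v ∈ X ∧ τ v = p := Finset.mem_filter

lemma Merged.subset (T : Cotree H X N Λ par lab) (h : Merged X N Λ par D τ) (hD : D ⊆ N) {v : ℕ}
    (hv : v ∈ X) (h0 : τ v ≠ 0) : v ∈ Λ (τ v) := by
  rcases h.below v hv with hw | ⟨w, hw, hpw, hvw⟩
  · rw [hw, T.leaf v hv]; simp
  · rw [← hpw] at h0 ⊢
    exact T.par_sub w (hD hw) h0 hvw

lemma Merged.nonempty (T : Cotree H X N Λ par lab) (h : Merged X N Λ par D τ) (hu : u ∈ N)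
    (huD : u ∉ D) (hch : ∀ w ∈ N, par w = u → w ∈ D) : (part X τ u).Nonempty := by
  by_cases huX : u ∈ X
  · exact ⟨u, mem_part.2 ⟨huX, h.leaf u huX huD⟩⟩
  · obtain ⟨v, hv⟩ := T.nonempty u hu
    obtain ⟨w, hw, hpw, -⟩ := T.child u hu huX v hv
    obtain ⟨v, hv, hτ⟩ := h.full w (hch w hw hpw) (hpw ▸ huD)
    exact ⟨v, mem_part.2 ⟨hv, hτ.trans hpw⟩⟩

/-- What is stored at a node that is ready to be merged and what is stored at its parent comes from
different children of the parent. -/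
lemma Merged.adj_iff (T : Cotree H X N Λ par lab) (h : Merged X N Λ par D τ) (hD : D ⊆ N)
    (hu : u ∈ N) (huD : u ∉ D) {a b : ℕ} (ha : a ∈ part X τ (par u)) (hb : b ∈ part X τ u) :
    H.Adj a b ↔ lab (par u) = 2 := by
  obtain ⟨ha, hτa⟩ := mem_part.1 ha
  obtain ⟨hb, hτb⟩ := mem_part.1 hb
  have hbu : b ∈ Λ u := by
    have := h.subset T hD hb (by rw [hτb]; rintro rfl; exact T.zero hu)
    rwa [hτb] at this
  rcases h.below a ha with hw | ⟨w, hw, hpw, haw⟩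
  · exact absurd (by rw [← hτa, hw]; exact ha : par u ∈ X) (T.par_leaf u hu)
  · rw [hτa] at hpw
    have := (T.sib w (hD hw) u hu (by rintro rfl; exact huD hw) hpw a haw b hbu).2
    rwa [hpw] at this

lemma Merged.step (T : Cotree H X N Λ par lab) (h : Merged X N Λ par D τ) (hD : D ⊆ N) (hu : u ∈ N)
    (huD : u ∉ D) (hch : ∀ w ∈ N, par w = u → w ∈ D) (hpD : par u ∉ insert u D) :
    Merged X N Λ par (insert u D) fun v => if τ v = u then par u else τ v := by
  have hu0 : u ≠ 0 := by rintro rfl; exact T.zero hu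
  refine ⟨fun v hv => ?_, fun v hv => ?_, fun v hv => ?_, fun v hv hvD => ?_, fun w hw hpw => ?_⟩
  · split_ifs
    · exact or_iff_not_imp_left.2 (T.par_mem u hu)
    · exact h.mem v hv
  · split_ifs with hτ
    · exact hpD
    · rw [Finset.mem_insert, not_or]; exact ⟨hτ, h.notMem v hv⟩
  · split_ifs with hτ
    · refine Or.inr ⟨u, Finset.mem_insert_self _ _, rfl, ?_⟩
      have := h.subset T hD hv (by rw [hτ]; exact hu0)
      rwa [hτ] at this
    · exact (h.below v hv).imp id fun ⟨w, hw, h'⟩ => ⟨w, Finset.mem_insert_of_mem hw, h'⟩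
  · rw [Finset.mem_insert, not_or] at hvD
    rw [h.leaf v hv hvD.2, if_neg hvD.1]
  · rcases Finset.mem_insert.1 hw with rfl | hw
    · obtain ⟨v, hv⟩ := h.nonempty T hu huD hch
      obtain ⟨hv, hτ⟩ := mem_part.1 hv
      exact ⟨v, hv, if_pos hτ⟩
    · rw [Finset.mem_insert, not_or] at hpw
      obtain ⟨v, hv, hτ⟩ := h.full w hw hpw.2
      exact ⟨v, hv, by rw [hτ, if_neg hpw.1]⟩

lemma part_step_self {p : ℕ} (hpu : p ≠ u) :
    part X (fun v => if τ v = u then p else τ v) p = part X τ p ∪ part X τ u := by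
  ext v
  simp only [mem_part, Finset.mem_union]
  split_ifs with h <;> grind

lemma part_step_of_ne {p q : ℕ} (hqp : q ≠ p) (hqu : q ≠ u) :
    part X (fun v => if τ v = u then p else τ v) q = part X τ q := by
  ext v
  simp only [mem_part]
  split_ifs with h <;> grind

lemma disjoint_part {p q : ℕ} (hpq : p ≠ q) : Disjoint (part X τ p) (part X τ q) :=
  Finset.disjoint_left.2 fun _ h h' => hpq ((mem_part.1 h).2.symm.trans (mem_part.1 h').2)

/-- Longest legal sequences are stored at all nodes at which leaves are stored. -/
structure Stored (H : SimpleGraph ℕ) (X D : Finset ℕ) (τ : ℕ → ℕ) (s : Memory) : Prop where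
  holds : ∀ v ∈ X, Holds H s (τ v) (part X τ (τ v))
  empty : ∀ p, p ∉ D → (∀ v ∈ X, τ v ≠ p) → s.arr aLen p = 0

lemma Holds.len_le {s : Memory} {p : ℕ} {A : Finset ℕ} (h : Holds H s p A) (hA : A ⊆ X) :
    s.arr aLen p ≤ X.card := by
  obtain ⟨S, hS, -, hl, -⟩ := h
  rw [hl, ← List.toFinset_card_of_nodup hS.1.nodup]
  exact Finset.card_le_card fun v hv => hA (hS.1.subset v (List.mem_toFinset.1 hv))

lemma Holds.len_pos {s : Memory} {p : ℕ} {A : Finset ℕ} (h : Holds H s p A) : 0 < s.arr aLen p := by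
  obtain ⟨S, -, -, hl, hL⟩ := h
  rw [hl]
  exact List.length_pos_of_mem hL.head_mem

/-- The list of the node `rU` is merged into the list of its parent `rP`, whose label is `rLg`. -/
def mergeLists : Program :=
  .ifLt rZero rV (.ifLt rLg rTwo appendList chooseList) takeList

lemma mergeLists_spec {B p : ℕ} {s : Memory} {A A' : Finset ℕ} (hU : s.reg rU = u)
    (hP : s.reg rP = p) (hV : s.reg rV = s.arr aLen p) (hOne : s.reg rOne = 1)
    (hZ : s.reg rZero = 0) (hTwo : s.reg rTwo = 2)
    (h : (A = ∅ ∧ s.arr aLen p = 0) ∨ (Holds H s p A ∧ (s.reg rLg = 1 ∨ s.reg rLg = 2)))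
    (h' : Holds H s u A') (hd : Disjoint A A')
    (hAA : ∀ a ∈ A, ∀ b ∈ A', H.Adj a b ↔ s.reg rLg = 2)
    (hA : A ⊆ X) (hA' : A' ⊆ X) (hB : 2 * X.card + 1 ≤ B) :
    mergeLists.ok B s ∧ Holds H (mergeLists.run s) p (A ∪ A') ∧
      SameLists p (A ∪ A') s (mergeLists.run s) := by
  have hB' := h'.len_le hA'
  have hp' := h'.len_pos
  simp only [mergeLists, Program.ok, Program.run, hZ, hV, hTwo]
  rcases h with ⟨rfl, h0⟩ | ⟨h, hl⟩
  · rw [h0]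
    simp only [lt_irrefl, if_false, Finset.empty_union]
    obtain ⟨h1, h2, h3⟩ := takeList_spec (B := B) hU hP h'
    exact ⟨h1, h2, h3.len, h3.iso, h3.hd, h3.tl, fun v _ => h3.ne v (Finset.notMem_empty v)⟩
  · have hB := h.len_le hA
    rw [if_pos h.len_pos, if_pos h.len_pos]
    rcases hl with hl | hl
    · rw [if_pos (by omega), if_pos (by omega)]
      exact appendList_spec hU hP hOne hZ h h' hd (fun a ha b hb hab => by
        have := (hAA a ha b hb).1 hab; omega) (by omega)
    · rw [if_neg (by omega), if_neg (by omega)]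
      exact chooseList_spec hU hP hOne hZ h h' hd (fun a ha b hb => (hAA a ha b hb).2 hl)
        (by omega) (by omega)

/-- The next node in the queue is merged into its parent; the length `0` marks an empty list. -/
def mergeNext : Program :=
  block [.load rU aQ rI, .load rP aPar rU, .load rV aLen rP, .load rLg aLab rP, mergeLists,
    .add rI rI rOne]

/-- The nodes in the queue are merged into their parents. -/
def merge : Program := .whileLt rI rQn mergeNext

/-- Since every node is merged after its children, it then holds all its leaves; what its parent
holds by then comes from siblings, to which the label of the parent applies. -/
lemma runs_merge {B : ℕ} {s : Memory} (T : Cotree H X N Λ (s.arr aPar) (s.arr aLab))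
    (hX : X.Nonempty) (hQ : Enumerates (s.arr aQ) (s.reg rQn) N)
    (hord : ∀ j < s.reg rQn, ∀ u ∈ N, s.arr aPar u = s.arr aQ j → ∃ j' < j, s.arr aQ j' = u)
    (hI : s.reg rI = 0) (hOne : s.reg rOne = 1) (hTwo : s.reg rTwo = 2) (hZ : s.reg rZero = 0)
    (hleaf : ∀ v ∈ X, Holds H s v {v}) (hempty : ∀ p, p ∉ X → s.arr aLen p = 0)
    (hB : 2 * X.card + 1 ≤ B) (hB' : s.reg rQn + 1 ≤ B) :
    Runs B merge s (40 * s.reg rQn + 1) fun s' => Holds H s' 0 X := by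
  set par := s.arr aPar with hpar
  set lab := s.arr aLab with hlab
  set q := s.arr aQ with hq
  refine (Runs.for (I := fun i s' => s'.reg rI = i ∧ i ≤ s.reg rQn ∧
      ∃ τ, Merged X N Λ par ((Finset.range i).image q) τ ∧
        Stored H X ((Finset.range i).image q) τ s')
      (s.reg rQn) 0 rfl ?_ ⟨hI, Nat.zero_le _, id, ?_, ?_⟩ le_rfl).mono ?_ ?_
  · rintro i s' ha ⟨hi', hle, τ, hM, hS⟩ hlt
    have eOne : s'.reg rOne = 1 := (ha.1 rOne (by decide)).trans hOne
    have eTwo : s'.reg rTwo = 2 := (ha.1 rTwo (by decide)).trans hTwo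
    have eZ : s'.reg rZero = 0 := (ha.1 rZero (by decide)).trans hZ
    have eQ : s'.arr aQ = q := ha.2 aQ (by decide)
    have ePar : s'.arr aPar = par := ha.2 aPar (by decide)
    have eLab : s'.arr aLab = lab := ha.2 aLab (by decide)
    rw [hi', ha.1 rQn (by decide)] at hlt
    set D := (Finset.range i).image q with hD
    set u := q i with hu
    have huN : u ∈ N := hQ.mem hlt
    have huD : u ∉ D := hQ.notMem_image hlt
    have hDN : D ⊆ N := hQ.image_subset hle
    -- the children of a node precede it
    have hcl : ∀ w ∈ N, par w ∈ insert u D → w ∈ D := by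
      intro w hw hpw
      rw [hu, hD, ← image_range_succ] at hpw
      obtain ⟨j, hj, hj'⟩ := Finset.mem_image.1 hpw
      rw [Finset.mem_range] at hj
      obtain ⟨k, hk, rfl⟩ := hord j (by omega) w hw hj'.symm
      exact Finset.mem_image_of_mem q (Finset.mem_range.2 (by omega))
    have hch : ∀ w ∈ N, par w = u → w ∈ D := fun w hw hpw =>
      hcl w hw (hpw ▸ Finset.mem_insert_self _ _)
    have hpD : par u ∉ insert u D := fun h' => huD (hcl u huN h')
    have hpu : par u ≠ u := fun h' => hpD (by rw [h']; exact Finset.mem_insert_self _ _)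
    obtain ⟨v₀, hv₀⟩ := hM.nonempty T huN huD hch
    obtain ⟨hv₀X, hv₀⟩ := mem_part.1 hv₀
    set s₁ := (((s'.setReg rU u).setReg rP (par u)).setReg rV (s'.arr aLen (par u))).setReg rLg
      (lab (par u)) with hs₁
    have hHu : Holds H s₁ u (part X τ u) := by
      have := hS.holds v₀ hv₀X
      rwa [hv₀] at this
    have hpart : ∀ p, part X τ p ⊆ X := fun p => Finset.filter_subset _ _
    obtain ⟨hok, hh, hsame⟩ := mergeLists_spec (B := B) (p := par u) (s := s₁) (u := u)
      (A := part X τ (par u)) (A' := part X τ u) (H := H) (by simp [hs₁]) (by simp [hs₁])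
      (by simp [hs₁]) (by simpa [hs₁] using eOne) (by simpa [hs₁] using eZ)
      (by simpa [hs₁] using eTwo)
      (by
        by_cases hne : (part X τ (par u)).Nonempty
        · obtain ⟨v, hv⟩ := hne
          obtain ⟨hvX, hτv⟩ := mem_part.1 hv
          refine Or.inr ⟨?_, ?_⟩
          · have := hS.holds v hvX
            rwa [hτv] at this
          · have h0 : par u ≠ 0 := by
              intro h0
              rcases hM.below v hvX with hw | ⟨w, hw, hpw, hvw⟩
              · exact T.zero (T.leaf_mem (by rw [← h0, ← hτv, hw]; exact hvX))
              · rw [hτv] at hpw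
                have hww : w ≠ u := by rintro rfl; exact huD hw
                have hr := T.root u huN h0
                exact (T.sib w (hDN hw) u huN hww hpw v hvw v (hr ▸ hvX)).1 rfl
            simpa [hs₁] using T.lab_node _ (T.par_mem u huN h0) (T.par_leaf u huN)
        · refine Or.inl ⟨Finset.not_nonempty_iff_eq_empty.1 hne, ?_⟩
          exact hS.empty _ (fun h' => hpD (Finset.mem_insert_of_mem h')) fun v hv hτ =>
            hne ⟨v, mem_part.2 ⟨hv, hτ⟩⟩)
      hHu (disjoint_part hpu) (fun a ha b hb => by
        simpa [hs₁] using hM.adj_iff T hDN huN huD ha hb) (hpart _) (hpart _) hB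
    set s₂ := mergeLists.run s₁ with hs₂
    have a₂ : Agree mergeLists s₁ s₂ := agree_run _ _
    have i₂ : s₂.reg rI = i := by rw [a₂.1 rI (by decide), hs₁]; simpa using hi'
    have o₂ : s₂.reg rOne = 1 := by rw [a₂.1 rOne (by decide), hs₁]; simpa using eOne
    have hrun : mergeNext.run s' = s₂.setReg rI (i + 1) := by
      have e : (((s'.setReg rU u).setReg rP (par u)).setReg rV (s'.arr aLen (par u))).setReg rLg
        (lab (par u)) = s₁ := rfl
      simp [mergeNext, hi', eQ, ePar, eLab, ← hu, e, ← hs₂, i₂, o₂]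
    have hokn : mergeNext.ok B s' := by
      have e : (((s'.setReg rU u).setReg rP (par u)).setReg rV (s'.arr aLen (par u))).setReg rLg
        (lab (par u)) = s₁ := rfl
      simp [mergeNext, hi', eQ, ePar, eLab, ← hu, e, ← hs₂, i₂, o₂, hok]
      omega
    refine ⟨hlt, hokn, ?_⟩
    rw [hrun, image_range_succ, ← hD, ← hu]
    refine ⟨by simp, hlt, _, hM.step T hDN huN huD hch hpD, ⟨fun v hv => ?_, fun r hr hτr => ?_⟩⟩
    · have key : ∀ r, r = par u ∨ (r ≠ par u ∧ ∃ v ∈ X, τ v = r ∧ r ≠ u) →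
          Holds H s₂ r (part X (fun v => if τ v = u then par u else τ v) r) := by
        rintro r (rfl | ⟨hr, v, hv, hτ, hru⟩)
        · rw [part_step_self hpu]; exact hh
        · rw [part_step_of_ne hr hru]
          have h1 : Holds H s₁ r (part X τ r) := by
            have := hS.holds v hv
            rwa [hτ] at this
          exact h1.of_same hsame hr (Finset.disjoint_union_right.2
            ⟨disjoint_part hr, disjoint_part hru⟩)
      refine key _ ?_
      by_cases hτ : τ v = u
      · exact Or.inl (if_pos hτ)
      · rw [if_neg hτ]
        exact (Classical.em (τ v = par u)).imp id fun h' => ⟨h', v, hv, rfl, hτ⟩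
    · rw [Finset.mem_insert, not_or] at hr
      have hrp : r ≠ par u := by
        rintro rfl
        exact hτr v₀ hv₀X (if_pos hv₀)
      refine (hsame.len r hrp).trans (hS.empty r hr.2 fun v hv hτ => hτr v hv ?_)
      rw [if_neg (by rw [hτ]; exact hr.1), hτ]
  · refine ⟨fun v hv => Or.inr (T.leaf_mem hv), by simp, fun v _ => Or.inl rfl, fun _ _ _ => rfl,
      by simp⟩
  · refine ⟨fun v hv => ?_, fun p _ hp => hempty p fun h' => hp p h' rfl⟩
    have : part X id v = {v} := by
      ext w; simp only [mem_part, id, Finset.mem_singleton]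
      exact ⟨fun h' => h'.2, fun h' => ⟨h' ▸ hv, h'⟩⟩
    simp only [id] at this ⊢
    rw [this]; exact hleaf v hv
  · simp [mergeNext, mergeLists, appendList, chooseList, takeList, Program.cost]
    omega
  · rintro s' ha ⟨hge, i, hi', hle, τ, hM, hS⟩
    rw [hi', ha.1 rQn (by decide)] at hge
    obtain rfl : i = s.reg rQn := by omega
    rw [hQ.1] at hM
    have h0 : ∀ v ∈ X, τ v = 0 := fun v hv => (hM.mem v hv).resolve_right (hM.notMem v hv)
    obtain ⟨v, hv⟩ := hX
    have := hS.holds v hv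
    rw [h0 v hv] at this
    rwa [show part X τ 0 = X from Finset.filter_true_of_mem h0] at this

end

/-- The leaf `rI` enters the queue; its list consists of itself, and it is isolated. -/
def fillBody : Program :=
  block [.sub rV rI rOne, .store aQ rV rI, .store aLen rI rOne, .store aIso rI rOne,
    .store aHd rI rI, .store aTl rI rI, .add rI rI rOne]

/-- All leaves enter the queue, each with its own list. -/
def fill : Program := .seq (.copy rI rOne) (.seq (.whileLt rI rEnd fillBody) (.sub rQn rEnd rOne))

/-- The cotree is evaluated from the leaves to the root; `mark` is used to list its nodes in an
order in which the children of a node come first. -/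
def evaluate : Program :=
  .seq fill (.seq (block [.copy rI rZero, .copy rTn rZero]) (.seq mark (.seq (.copy rI rZero) merge)))

section

variable {H : SimpleGraph ℕ} {M : ℕ} {X N : Finset ℕ} {Λ : ℕ → Finset ℕ}

lemma runs_fill {B n : ℕ} {s : Memory} (hOne : s.reg rOne = 1) (hE : s.reg rEnd = n + 1)
    (hlen : ∀ p, s.arr aLen p = 0) (hB : n + 1 ≤ B) :
    Runs B fill s (8 * n + 3) fun s' => s'.reg rQn = n ∧
      Enumerates (s'.arr aQ) n (Finset.Ico 1 (n + 1)) ∧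
      (∀ v ∈ Finset.Ico 1 (n + 1), Holds H s' v {v}) ∧
      ∀ p, p ∉ Finset.Ico 1 (n + 1) → s'.arr aLen p = 0 := by
  refine Runs.seq (T₁ := 1) (T₂ := 8 * n + 2) (R := fun s₁ => s₁ = s.setReg rI 1)
    (.straight rfl trivial le_rfl (by simp [hOne])) ?_ (by omega)
  rintro s₁ a₁ hs₁
  have q₁ : ∀ a, s₁.arr a = s.arr a := fun a => by rw [hs₁]; rfl
  refine Runs.seq (T₁ := 8 * n + 1) (T₂ := 1) (Runs.for (I := fun i s' => s'.reg rI = i ∧ 1 ≤ i ∧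
      i ≤ n + 1 ∧ Enumerates (s'.arr aQ) (i - 1) (Finset.Ico 1 i) ∧
      (∀ v ∈ Finset.Ico 1 i, s'.arr aLen v = 1 ∧ s'.arr aIso v = 1 ∧ s'.arr aHd v = v ∧
        s'.arr aTl v = v) ∧
      ∀ p, p ∉ Finset.Ico 1 i → s'.arr aLen p = 0)
      (n + 1) 1 rfl ?_ ⟨by rw [hs₁]; simp, le_rfl, by omega, ?_, by simp, ?_⟩
      (by simp [fillBody, Program.cost])) ?_ (by omega)
  · rintro i s' ha ⟨hi', h1, h2, h3, h4, h5⟩ hlt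
    have eOne : s'.reg rOne = 1 := by
      rw [ha.1 rOne (by decide), a₁.1 rOne (by decide), hOne]
    rw [hi', ha.1 rEnd (by decide), a₁.1 rEnd (by decide), hE] at hlt
    have hins : Finset.Ico 1 (i + 1) = insert i (Finset.Ico 1 i) := by
      ext j; simp only [Finset.mem_insert, Finset.mem_Ico]; omega
    refine ⟨hlt, by simp [fillBody, hi', eOne]; omega, by simp [fillBody, hi', eOne], by omega, hlt,
      ?_, ?_, ?_⟩
    · have : (fillBody.run s').arr aQ = Function.update (s'.arr aQ) (i - 1) i := by
        simp [fillBody, hi', eOne]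
      rw [this, hins, show i + 1 - 1 = i - 1 + 1 by omega]
      exact h3.push (by simp)
    · intro v hv
      by_cases hvi : v = i
      · subst hvi; simp [fillBody, hi', eOne]
      · rw [hins] at hv
        have := h4 v (Finset.mem_of_mem_insert_of_ne hv hvi)
        simpa [fillBody, hi', eOne, hvi] using this
    · intro p hp
      rw [hins, Finset.mem_insert, not_or] at hp
      have := h5 p hp.2
      simpa [fillBody, hi', eOne, hp.1] using this
  · simpa using Enumerates.empty _
  · intro p _; rw [q₁]; exact hlen p
  · rintro s₂ a₂ ⟨hge, i, hi', h1, h2, h3, h4, h5⟩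
    have eE : s₂.reg rEnd = n + 1 := by
      rw [a₂.1 rEnd (by decide), a₁.1 rEnd (by decide), hE]
    have eOne : s₂.reg rOne = 1 := by
      rw [a₂.1 rOne (by decide), a₁.1 rOne (by decide), hOne]
    rw [hi', eE] at hge
    obtain rfl : i = n + 1 := by omega
    refine .straight rfl trivial le_rfl ⟨by simp [eE, eOne], by simpa using h3, fun v hv => ?_,
      by simpa using h5⟩
    obtain ⟨e1, e2, e3, e4⟩ := h4 v hv
    refine ⟨[v], optimal_singleton v, ?_, ?_, ?_⟩
    · simpa [e2] using isoFlag_singleton v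
    · simpa using e1
    · simpa [e3, e4] using Linked.single v

/-- When all leaves are in the queue, marking lists all nodes of the tree, children before parents;
then merging evaluates the tree, and the number `0` ends up with all vertices. -/
lemma runs_evaluate {B n : ℕ} {s : Memory} (h : Tree H M (Finset.Ico 1 (n + 1)) N Λ s)
    (hc : Consts M (n + 1) s) (hE : s.reg rEnd = n + 1) (hst : ∀ p, s.arr aSt p < n + 1)
    (hlen : ∀ p, s.arr aLen p = 0) (hn : 1 ≤ n) (hB : 2 * n + 2 ≤ B) :
    Runs B evaluate s (130 * n + 10) fun s' => Holds H s' 0 (Finset.Ico 1 (n + 1)) := by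
  set X := Finset.Ico 1 (n + 1) with hX
  have hXc : X.card = n := by rw [hX, Nat.card_Ico]; omega
  refine Runs.seq (runs_fill (H := H) (B := B) hc.one hE hlen (by omega)) (T₂ := 122 * n + 7) ?_
    (by omega)
  rintro s₁ a₁ ⟨qn₁, Q₁, hl₁, he₁⟩
  have T₁ := h.of_agree a₁ (by decide)
  have hc₁ : Consts M (n + 1) s₁ := hc.of_agree a₁ (by decide)
  refine Runs.seq (T₁ := 2) (T₂ := 122 * n + 5)
    (R := fun s₂ => s₂.reg rI = 0 ∧ s₂.reg rTn = 0)
    (.straight rfl (by simp) (by simp [Program.cost]) (by simp [hc₁.zero])) ?_ (by omega)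
  rintro s₂ a₂ ⟨i₂, t₂⟩
  have T₂ := T₁.of_agree a₂ (by decide)
  have hc₂ : Consts M (n + 1) s₂ := hc₁.of_agree a₂ (by decide)
  have ar₂ : ∀ a, s₂.arr a = s₁.arr a := fun a => a₂.2 a (by simp [block, Program.arrs])
  refine Runs.seq (runs_mark (B := B) (x := n + 1) T₂.cotree T₂.strict T₂.nch_eq
    (T₂.fresh 0 T₂.cotree.zero).2.1 T₂.two (F := X) subset_rfl
    (by rw [ar₂, a₂.1 rQn (by decide), qn₁]; exact Q₁) hc₂.cur hc₂.one i₂ t₂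
    (fun p => by rw [ar₂, a₁.2 aSt (by decide)]; exact hst p) (by omega)) (T₂ := 82 * n + 4) ?_
    (by rw [hXc]; omega)
  rintro s₃ a₃ M₃
  have T₃ := T₂.of_agree a₃ (by decide)
  have hc₃ : Consts M (n + 1) s₃ := hc₂.of_agree a₃ (by decide)
  have hfull : fullNodes N Λ X = N := Finset.filter_true_of_mem fun u hu => h.cotree.sub u hu
  rw [hfull, ← a₃.2 aPar (by decide)] at M₃
  have hN : N.card ≤ 2 * n := by
    have := T₃.cotree.card_fullNodes_le (F := X) fun p hp hpX => by
      rw [← T₃.nch_eq p hp]; exact T₃.two p hp hpX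
    rwa [hfull, hXc] at this
  have hq₃ : s₃.reg rQn ≤ 2 * n := M₃.queue.2 ▸ hN
  refine Runs.seq (T₁ := 1) (T₂ := 82 * n + 3) (R := fun s₄ => s₄ = s₃.setReg rI 0)
    (.straight rfl trivial le_rfl (by simp [hc₃.zero])) ?_ (by omega)
  rintro s₄ - hs₄
  have ar₄ : ∀ a, s₄.arr a = s₃.arr a := fun a => by rw [hs₄]; rfl
  have qn₄ : s₄.reg rQn = s₃.reg rQn := by rw [hs₄]; simp
  have h₄ : ∀ a, a ≠ aQ → a ≠ aSt → a ≠ aT → a ≠ aCnt → s₄.arr a = s₁.arr a := by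
    intro a h1 h2 h3 h4
    rw [ar₄, a₃.2 a (by simp [mark, markBody, ifEq, Program.arrs, block, h1, h2, h3, h4]), ar₂]
  refine (runs_merge (B := B) (H := H) (X := X) (N := N) (Λ := Λ)
    (by rw [ar₄, ar₄]; exact T₃.cotree) ⟨1, Finset.mem_Ico.2 ⟨le_rfl, by omega⟩⟩
    (by rw [ar₄, qn₄]; exact M₃.queue) (by rw [ar₄, ar₄, qn₄]; exact M₃.order) (by rw [hs₄]; simp)
    (by rw [hs₄]; simpa using hc₃.one) (by rw [hs₄]; simpa using hc₃.two)
    (by rw [hs₄]; simpa using hc₃.zero) (fun v hv => ?_) (fun p hp => ?_) (by omega)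
    (by omega)).mono (by omega) fun _ _ => id
  · obtain ⟨S, hS, hi, hl, hL⟩ := hl₁ v hv
    refine ⟨S, hS, ?_, ?_, ?_⟩
    · rw [h₄ aIso (by decide) (by decide) (by decide) (by decide)]; exact hi
    · rw [h₄ aLen (by decide) (by decide) (by decide) (by decide)]; exact hl
    · rw [h₄ aNe (by decide) (by decide) (by decide) (by decide),
        h₄ aHd (by decide) (by decide) (by decide) (by decide),
        h₄ aTl (by decide) (by decide) (by decide) (by decide)]; exact hL
  · rw [h₄ aLen (by decide) (by decide) (by decide) (by decide)]; exact he₁ p hp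

/-! ### Output -/

/-- The vertex `rU` is written, and its successor becomes `rU`. -/
def outputBody : Program :=
  block [.sub rV rU rOne, .store aOut rI rV, .load rU aNe rU, .add rI rI rOne]

/-- The list of the number `0` is written into the output array, with names that are smaller
by `1`. -/
def output : Program :=
  .seq (block [.load rU aHd rZero, .load rHi aLen rZero, .copy rI rZero])
    (.seq (.whileLt rI rHi outputBody) (.copy rN rHi))

lemma runs_output {B : ℕ} {s : Memory} (h : Holds H s 0 X) (hOne : s.reg rOne = 1)
    (hZ : s.reg rZero = 0) (hB : X.card + 1 ≤ B) :
    Runs B output s (5 * X.card + 5) fun s' => ∃ S, Optimal H X S ∧ s'.reg rN = S.length ∧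
      ∀ (i : ℕ) (hi : i < S.length), s'.arr aOut i = S[i] - 1 := by
  have hle := h.len_le subset_rfl
  obtain ⟨S, hS, -, hl, hL⟩ := h
  refine Runs.seq (T₁ := 3) (T₂ := 5 * X.card + 2)
    (R := fun s₁ => s₁.reg rU = s.arr aHd 0 ∧ s₁.reg rHi = S.length ∧ s₁.reg rI = 0)
    (.straight rfl (by simp) (by simp [Program.cost]) (by simp [hZ, hl])) ?_ (by omega)
  rintro s₁ a₁ ⟨u₁, hi₁, i₁⟩
  have o₁ : s₁.reg rOne = 1 := (a₁.1 rOne (by decide)).trans hOne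
  have n₁ : s₁.arr aNe = s.arr aNe := a₁.2 aNe (by decide)
  refine Runs.seq (T₁ := 5 * X.card + 1) (T₂ := 1) (Runs.for (I := fun i s' => s'.reg rI = i ∧
      i ≤ S.length ∧ (i < S.length → Linked (s.arr aNe) (s'.reg rU) (S.drop i) (s.arr aTl 0)) ∧
      ∀ (j : ℕ) (hj : j < S.length), j < i → s'.arr aOut j = S[j] - 1)
      S.length 0 rfl ?_ ⟨i₁, Nat.zero_le _, fun _ => by rw [u₁]; exact hL, by simp⟩ ?_) ?_ (by omega)
  · rintro i s' ha ⟨hi', hle', hLi, hout⟩ hlt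
    have eOne : s'.reg rOne = 1 := (ha.1 rOne (by decide)).trans o₁
    have eNe : s'.arr aNe = s.arr aNe := (ha.2 aNe (by decide)).trans n₁
    rw [hi', ha.1 rHi (by decide), hi₁] at hlt
    have hLi := hLi hlt
    rw [List.drop_eq_getElem_cons hlt] at hLi
    have hhd := hLi.eq_head
    refine ⟨hlt, by simp [outputBody, hi', eOne]; omega, by simp [outputBody, hi', eOne], hlt,
      fun hlt' => ?_, fun j hj hji => ?_⟩
    · rw [List.drop_eq_getElem_cons hlt'] at hLi ⊢
      simpa [outputBody, hi', eOne, eNe] using hLi.tail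
    · by_cases hji' : j = i
      · subst hji'; simp [outputBody, hi', eOne, hhd]
      · have := hout j hj (by omega)
        simpa [outputBody, hi', eOne, hji'] using this
  · simp [outputBody, Program.cost]; omega
  · rintro s₂ a₂ ⟨hge, i, hi', hle', -, hout⟩
    have e : s₂.reg rHi = S.length := (a₂.1 rHi (by decide)).trans hi₁
    rw [hi', e] at hge
    refine .straight rfl trivial le_rfl ⟨S, hS, by simp [e], fun j hj => ?_⟩
    simpa using hout j hj (by omega)

end

/-! ### The algorithm -/

/-- The fixed registers are set, and the vertex `1` becomes the only node of the cotree. -/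
def init : Program :=
  block [.const rOne 1, .const rTwo 2, .add rEnd rN rOne, .copy rNx rEnd, .copy rX rTwo,
    .add rM rN rN, .add rM rM rN, .const rV 6, .add rM rM rV, .store aSum rZero rOne]

/-- The whole algorithm; nothing is to be done for the graph without vertices. -/
def algorithm : Program :=
  .ifLt rZero rN (.seq init (.seq build (.seq evaluate output))) .skip

section

variable {H : SimpleGraph ℕ}

lemma cotree_singleton {par lab : ℕ → ℕ} (hpar : ∀ u, par u = 0) (hlab : ∀ u, lab u = 0) :
    Cotree H {1} {1} (fun _ => {1}) par lab where
  zero := by simp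
  par_zero := hpar 0
  leaf_mem := subset_rfl
  leaf := by simp
  lab_leaf := fun v _ => hlab v
  lab_node := fun u hu h => absurd hu h
  sub := by simp
  nonempty := by simp
  par_mem := fun u _ h => absurd (hpar u) h
  par_leaf := fun u _ => by rw [hpar]; simp
  par_sub := fun _ _ _ => subset_rfl
  root := fun _ _ _ => rfl
  child := fun p hp h => absurd hp h
  sib := fun u hu u' hu' h => absurd ((Finset.mem_singleton.1 hu).trans
    (Finset.mem_singleton.1 hu').symm) h

lemma runs_init {B n : ℕ} {s : Memory} (hN : s.reg rN = n) (hr : s.reg rZero = 0) (hn : 1 ≤ n)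
    (ha : ∀ a, 2 ≤ a → ∀ i, s.arr a i = 0) (hB : 3 * n + 6 ≤ B) :
    Runs B init s 10 fun s' => Grown H (3 * n + 6) n (s.arr aOff) (s.arr aAdj) 2 {1} (fun _ => {1}) s' ∧
      s'.reg rEnd = n + 1 ∧ ∀ p, s'.arr aLen p = 0 := by
  have hz : ∀ a, 2 ≤ a → a ≠ aSum → (init.run s).arr a = fun _ => 0 := by
    intro a h2 h6
    rw [(agree_run init s).2 a (by simpa [init, block, Program.arrs] using h6)]
    exact funext (ha a h2)
  have hs : (init.run s).arr aSum = fun u => if u = 0 then 1 else 0 := by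
    funext u
    by_cases hu : u = 0 <;> simp [init, hr, hu, ha]
  have e1 := hz aPar (by decide) (by decide)
  have e2 := hz aLab (by decide) (by decide)
  have e3 := hz aNch (by decide) (by decide)
  have e4 := hz aSt (by decide) (by decide)
  have e5 := hz aMk (by decide) (by decide)
  have e6 := hz aLen (by decide) (by decide)
  refine .straight rfl ?_ (by simp [init, Program.cost]) ⟨⟨⟨?_, ⟨?_, ?_, ?_, ?_⟩, ?_, ?_⟩, ?_, ⟨?_, ?_, ?_, ?_, ?_⟩,
    ?_, ?_, ?_, ?_, ?_, ?_, ?_⟩, ?_, ?_⟩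
  · simp [init, hN]; omega
  · exact cotree_singleton (fun u => by rw [e1]) (fun u => by rw [e2])
  · intro p hp
    rw [Finset.mem_singleton] at hp
    subst hp
    rw [e3, e1]; simp [childSum]
  · intro p _
    rw [hs]; simp only; split_ifs <;> omega
  · rintro p (rfl | hp)
    · rw [hs, e1]; simp [childSum]
    · rw [Finset.mem_singleton] at hp
      subst hp
      rw [hs, e1]; simp [childSum]
  · intro u hu
    rw [Finset.mem_singleton] at hu; omega
  · intro p hp hpX
    rw [Finset.mem_singleton] at hp
    exact absurd (by simp [hp]) hpX
  · intro u _
    exact ⟨by rw [e2], by rw [e3], fun h0 => by rw [hs]; simp [h0]⟩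
  · intro u _ h0
    exact absurd (by rw [e1]) h0
  · simp [init]
  · simp [init]
  · simp [init, hr]
  · simp [init, hN]; omega
  · simp [init]
  · simp [init, hN]
  · simp [init, hN]
  · intro u hu
    rw [Finset.mem_singleton] at hu; omega
  · intro p; rw [e4]; simp
  · intro p; rw [e5]; simp
  · exact (agree_run init s).2 aOff (by decide)
  · exact (agree_run init s).2 aAdj (by decide)
  · simp [init, hN]
  · intro p; rw [e6]

/-- The algorithm is correct and runs in linear time, on a graph on the vertices `1, …, n`. -/
lemma runs_algorithm {B n : ℕ} {off adj : ℕ → ℕ} {s : Memory} (hL : Lists H n off adj)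
    (hH : P4Free H) (hN : s.reg rN = n) (hr : s.reg rZero = 0) (hn : 1 ≤ n)
    (ha : ∀ a, 2 ≤ a → ∀ i, s.arr a i = 0) (hoff : s.arr aOff = off) (hadj : s.arr aAdj = adj)
    (hB : 6 * n + 14 ≤ B) (hBo : off n + 1 ≤ B) :
    Runs B algorithm s (111 * off n + 271 * n + 27) fun s' =>
      ∃ S, Optimal H (Finset.Ico 1 (n + 1)) S ∧ s'.reg rN = S.length ∧
        ∀ (i : ℕ) (hi : i < S.length), s'.arr aOut i = S[i] - 1 := by
  refine Runs.ifLt (T := 111 * off n + 271 * n + 26) (fun _ => ?_) (fun h => absurd (by omega) h)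
  refine Runs.seq (runs_init (H := H) (B := B) hN hr hn ha (by omega))
    (T₂ := 111 * off n + 271 * n + 16) ?_ (by omega)
  rintro s₁ - ⟨G₁, E₁, l₁⟩
  rw [hoff, hadj] at G₁
  refine Runs.seq (runs_build (B := B) hL hH G₁ hn E₁ rfl (by omega) hBo)
    (T₂ := 135 * n + 15) ?_ (by omega)
  rintro s₂ a₂ ⟨N, Λ, G₂⟩
  refine Runs.seq (runs_evaluate (B := B) G₂.tree G₂.consts ((a₂.1 rEnd (by decide)).trans E₁) G₂.stamp
    (fun p => by rw [a₂.2 aLen (by decide)]; exact l₁ p) hn (by omega)) (T₂ := 5 * n + 5) ?_ (by omega)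
  rintro s₃ a₃ h₃
  have hc := G₂.consts.of_agree a₃ (by decide)
  have hcard : (Finset.Ico 1 (n + 1)).card = n := by rw [Nat.card_Ico]; omega
  exact (runs_output (B := B) h₃ hc.one hc.zero (by omega)).mono (by omega) fun _ _ => id

end

/-! ### From the input to the algorithm -/

/-- The vertex `v` of the input is the leaf `v + 1`. -/
def leafOf (n : ℕ) : Fin n ↪ ℕ := ⟨fun v => v.val + 1, fun v w h => Fin.ext (by simpa using h)⟩

@[simp] lemma leafOf_apply {n : ℕ} (v : Fin n) : leafOf n v = v.val + 1 := rfl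

section

variable {n : ℕ} {G : SimpleGraph (Fin n)} {L : Fin n → List (Fin n)}

lemma map_leafOf : Finset.univ.map (leafOf n) = Finset.Ico 1 (n + 1) := by
  ext v
  simp only [Finset.mem_map, Finset.mem_univ, true_and, Finset.mem_Ico]
  constructor
  · rintro ⟨w, rfl⟩
    have := w.isLt
    rw [leafOf_apply]; omega
  · rintro ⟨h1, h2⟩
    exact ⟨⟨v - 1, by omega⟩, by rw [leafOf_apply]; simp; omega⟩

lemma IsCograph.p4Free (h : IsCograph G) : P4Free G := by
  intro a b c d hab hbc hcd hac hbd had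
  have hne : a ≠ b ∧ b ≠ c ∧ c ≠ d ∧ a ≠ c ∧ b ≠ d ∧ a ≠ d :=
    ⟨hab.ne, hbc.ne, hcd.ne, fun e => had (e ▸ hcd), fun e => had (e ▸ hab), fun e => hac (e ▸ hcd.symm)⟩
  obtain ⟨h1, h2, h3, h4, h5, h6⟩ := hne
  refine h.false ⟨⟨![a, b, c, d], fun i j hij => ?_⟩, fun {i j} => ?_⟩
  · fin_cases i <;> fin_cases j <;> simp_all
  · rw [SimpleGraph.pathGraph_adj]
    change G.Adj (![a, b, c, d] i) (![a, b, c, d] j) ↔ _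
    fin_cases i <;> fin_cases j <;> simp_all [G.adj_comm]

lemma P4Free.map {V W : Type*} {G : SimpleGraph V} (h : P4Free G) (e : V ↪ W) :
    P4Free (G.map e) := by
  rintro a b c d ⟨-, a, b, hab, rfl, rfl⟩ ⟨-, b', c, hbc, hb, rfl⟩ ⟨-, c', d, hcd, hc, rfl⟩ h1 h2 h3
  obtain rfl := e.injective hb
  obtain rfl := e.injective hc
  exact h a b' c' d hab hbc hcd (by simpa using h1) (by simpa using h2) (by simpa using h3)

lemma off_eq {i : ℕ} (hi : i ≤ n) :
    (inputMemory L).arr aOff i = ((List.ofFn L).take i).flatten.length := by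
  simp [inputMemory, hi]

lemma off_succ (v : Fin n) :
    (inputMemory L).arr aOff (v + 1) = (inputMemory L).arr aOff v + (L v).length := by
  rw [off_eq (by omega), off_eq (by omega), List.take_add_one]
  simp

lemma adj_eq (v : Fin n) {j : ℕ} (hj : j < (L v).length) :
    (inputMemory L).arr aAdj ((inputMemory L).arr aOff v + j) = ((L v)[j] : Fin n).val := by
  have hsplit : (List.ofFn L).flatten = ((List.ofFn L).take v).flatten ++
      (L v ++ ((List.ofFn L).drop (v + 1)).flatten) := by
    conv_lhs => rw [← List.take_append_drop v (List.ofFn L)]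
    rw [List.flatten_append, List.drop_eq_getElem_cons (by simp)]
    simp
  rw [off_eq (by omega)]
  simp only [inputMemory, show ¬ (1 = 0) by decide, if_false, if_true]
  rw [hsplit, List.getD_eq_getElem?_getD, List.getElem?_map, List.getElem?_append_right (by omega)]
  rw [Nat.add_sub_cancel_left, List.getElem?_append_left hj, List.getElem?_eq_getElem hj]
  rfl

lemma lists_inputMemory (hL : IsAdjacencyLists G L) :
    Lists (G.map (leafOf n)) n ((inputMemory L).arr aOff) ((inputMemory L).arr aAdj) := by
  -- the list of the leaf `x` is the one of the vertex `x - 1`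
  have hx : ∀ x, 1 ≤ x → x ≤ n → ∃ v : Fin n, x = v + 1 := fun x h1 h2 =>
    ⟨⟨x - 1, by omega⟩, by simp; omega⟩
  have hidx : ∀ (v : Fin n) i, (inputMemory L).arr aOff v ≤ i → i < (inputMemory L).arr aOff (v + 1) →
      ∃ j, ∃ hj : j < (L v).length, i = (inputMemory L).arr aOff v + j ∧
        (inputMemory L).arr aAdj i = ((L v)[j] : Fin n).val := by
    intro v i h1 h2
    rw [off_succ] at h2
    obtain ⟨j, rfl⟩ := Nat.exists_eq_add_of_le h1
    exact ⟨j, by omega, rfl, adj_eq v (by omega)⟩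
  refine ⟨fun x h1 h2 => ?_, fun x h1 h2 w => ?_, fun x h1 h2 i j hi hi' hj hj' he => ?_, ?_⟩
  · obtain ⟨v, rfl⟩ := hx x h1 h2
    rw [off_succ]; simp
  · obtain ⟨v, rfl⟩ := hx x h1 h2
    rw [Nat.add_sub_cancel, Finset.mem_image]
    constructor
    · rintro ⟨i, hi, rfl⟩
      rw [Finset.mem_Ico] at hi
      obtain ⟨j, hj, -, he⟩ := hidx v i hi.1 hi.2
      rw [he]
      have : G.Adj v (L v)[j] := ((hL v).2 _).1 (List.getElem_mem hj)
      exact (SimpleGraph.map_adj_apply (f := leafOf n)).2 this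
    · rintro ⟨-, v', w', hadj, hv, rfl⟩
      obtain rfl := (leafOf n).injective (hv : leafOf n v' = leafOf n v)
      obtain ⟨j, hj, rfl⟩ := List.getElem_of_mem (((hL v').2 _).2 hadj)
      refine ⟨(inputMemory L).arr aOff v' + j, ?_, ?_⟩
      · rw [Finset.mem_Ico, off_succ]; omega
      · rw [adj_eq v' hj]; rfl
  · obtain ⟨v, rfl⟩ := hx x h1 h2
    rw [Nat.add_sub_cancel] at hi hj
    obtain ⟨k, hk, rfl, e1⟩ := hidx v i hi hi'
    obtain ⟨l, hl, rfl, e2⟩ := hidx v j hj hj'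
    rw [e1, e2] at he
    have := (List.Nodup.getElem_inj_iff (hL v).1).1 (Fin.ext he)
    rw [this]
  · rintro v w ⟨-, v', w', -, -, rfl⟩
    have := w'.isLt
    rw [leafOf_apply]; omega

lemma off_last (hL : IsAdjacencyLists G L) : (inputMemory L).arr aOff n = 2 * G.edgeSet.ncard := by
  classical
  have hdeg : ∀ v, (L v).length = G.degree v := by
    intro v
    rw [← List.toFinset_card_of_nodup (hL v).1, SimpleGraph.degree]
    congr 1
    ext u
    rw [List.mem_toFinset, (hL v).2, SimpleGraph.mem_neighborFinset]
  rw [off_eq le_rfl, List.take_of_length_le (by simp), List.length_flatten, List.map_ofFn,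
    List.sum_ofFn]
  simp only [Function.comp_apply, hdeg]
  rw [G.sum_degrees_eq_twice_card_edges, ← SimpleGraph.coe_edgeFinset, Set.ncard_coe_finset]

end

end GrundyDouble

/-- One program computes the Grundy double domination number and a Grundy double dominating
sequence of every cograph without isolated vertices, given by adjacency lists, in `O(n + m)` steps
on words of `O(log (n + m))` bits, where `n` and `m` are the numbers of vertices and edges. -/
theorem mainTheorem2 :
    ∃ (P : GrundyDouble.Program) (c : ℕ),
      ∀ (n : ℕ) (G : SimpleGraph (Fin n)) (L : Fin n → List (Fin n)),
        GrundyDouble.IsCograph G → GrundyDouble.NoIsolated G →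
        GrundyDouble.IsAdjacencyLists G L →
        ∃ (t : ℕ) (s : GrundyDouble.Memory),
          GrundyDouble.Exec (c * (n + G.edgeSet.ncard + 1)) P (GrundyDouble.inputMemory L) t s ∧
          t ≤ c * (n + G.edgeSet.ncard + 1) ∧
          s.reg 0 = GrundyDouble.gddn G ∧
          ∃ S : List (Fin n), GrundyDouble.IsGDDS G S ∧ GrundyDouble.OutputsSequence s S := by
  -- the time is at most `111 * 2 m + 271 n + 27`
  refine ⟨GrundyDouble.algorithm, 300, fun n G L hG hiso hL => ?_⟩
  rcases Nat.eq_zero_or_pos n with rfl | hn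
  · have hopt : GrundyDouble.Optimal G Finset.univ [] :=
      ⟨.nil, fun T _ => by
        cases T with
        | nil => exact le_rfl
        | cons a T => exact a.elim0⟩
    have hgd := hopt.isGDDS hiso
    refine ⟨2, _, .ifLt_false (by simp [GrundyDouble.inputMemory]) (.skip _), by omega, ?_, [], hgd,
      ?_, by simp⟩
    · rw [hgd.gddn_eq]; simp [GrundyDouble.inputMemory]
    · simp [GrundyDouble.inputMemory]
  · have hoff := GrundyDouble.off_last hL
    obtain ⟨t, s, ht, he, S, hS, hlen, hout⟩ := GrundyDouble.runs_algorithm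
      (B := 300 * (n + G.edgeSet.ncard + 1)) (GrundyDouble.lists_inputMemory hL)
      (hG.p4Free.map _) (by simp [GrundyDouble.inputMemory]) (by simp [GrundyDouble.inputMemory]) hn
      (fun a ha i => by
        have h0 : a ≠ 0 := by omega
        have h1 : a ≠ 1 := by omega
        simp [GrundyDouble.inputMemory, h0, h1]) rfl rfl (by omega) (by omega)
    rw [← GrundyDouble.map_leafOf] at hS
    obtain ⟨S', rfl, hS'⟩ := hS.exists_of_map
    have hgd := hS'.isGDDS hiso
    rw [List.length_map] at hlen
    refine ⟨t, s, he, by omega, by rw [hgd.gddn_eq]; exact hlen, S', hgd, hlen, fun i hi => ?_⟩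
    rw [hout i (by simpa using hi)]
    simp
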